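/- **Setting.** Let $1\le d\le 4$ and let $\Omega\subset\mathbb R^d$ be a bounded domain (open, connected) with Lipschitz boundary $\partial\Omega=\Gamma_D\cup\Gamma_N$, $\Gamma_D\cap\Gamma_N=\emptyset$, $\Gamma_N$ open in $\partial\Omega$, and either $\Gamma_D=\emptyset$ or $\Gamma_D$ of positive surface measure. Let $T>0$, $\sigma>0$, $z_i\in\mathbb R$ ($i=1,\dots,n$), and let $(a_{ij})\in\mathbb R^{n\times n}$ be symmetric positive definite. Let $u_i^0\in L^2(\Omega)$, $u_i^0>0$ in $\Omega$, and $\sum_i\int_\Omega z_iu_i^0\,dx=0$ if $\Gamma_D=\emptyset$. Put $H^1_D(\Omega)=\{v\in H^1(\Omega): v=0\text{ on }\Gamma_D\}$ (in the sense of traces). Let $\Phi_D\in H^1(\Omega)\cap L^\infty(\Omega)$ satisfy $\Delta\Phi_D=0$ in $\Omega$, $\nabla\Phi_D\cdot\nu=0$ on $\Gamma_N$ weakly, i.e. $\int_\Omega\nabla\Phi_D\cdot\nabla\psi\,dx=0$ for all $\psi\in H^1_D(\Omega)$. For $f\in L^2(\Omega)$, "the solution of the mixed problem with right-hand side $f$"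 means $\phi\in\Phi_D+H^1_D(\Omega)$ with $\int_\Omega\nabla\phi\cdot\nabla\psi\,dx=\int_\Omega f\psi\,dx$ for all $\psi\in H_D^1(\Omega)$, and with $\int_\Omega\phi\,dx=0$ if $\Gamma_D=\emptyset$. Assume $H^2$ regularity: there is $C>0$ such that whenever $f\in L^2(\Omega)$ and $\phi$ is the solution of the mixed problem with right-hand side $f$, then $\phi\in H^2(\Omega)$ and $\|\phi\|_{H^2(\Omega)}\le C(\|f\|_{L^2(\Omega)}+1)$. **Solutions.** Write $p_i(u)=\sum_ja_{ij}u_j$. A *weak solution* of $$\partial_tu_i=\operatorname{div}\big(\sigma\nabla u_i+z_iu_i\nabla\Phi+u_i\nabla p_i(u)\big),\qquad -\Delta\Phi=\sum_{i=1}^n z_iu_i\quad\text{in }\Omega\times(0,T),$$ with no-flux boundary conditions for the $u_i$, the conditions $\Phi=\Phi_D$ on $\Gamma_D$, $\nabla\Phi\cdot\nu=0$ on $\Gamma_N$, and initial data $u^0$, is a pair $(u,\Phi)$ with $u_i\ge0$, $u_i,\sqrt{u_i},\Phi\in L^2(0,T;H^1(\Omega))$, $\partial_tu_i\in L^2(0,T;W^{1,4}(\Omega)')$,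 such that for a.e. $t\in(0,T)$ and all $i$ $$\langle\partial_tu_i,\varphi\rangle+\int_\Omega\big(\sigma\nabla u_i+z_iu_i\nabla\Phi+u_i\nabla p_i(u)\big)\cdot\nabla\varphi\,dx=0\quad\text{for all }\varphi\in W^{1,4}(\Omega),$$ $\Phi(t)$ is the solution of the mixed problem with right-hand side $\sum_iz_iu_i(t)$, and the representative of $u_i$ in $C([0,T];W^{1,4}(\Omega)')$ equals $u_i^0$ at $t=0$. It is called *strong* if moreover $\nabla u_i,\nabla\Phi\in L^\infty(\Omega\times(0,T))$ for all $i$. Let $$H_{BR}(u)=\int_\Omega\Big(\sigma\sum_iu_i(\log u_i-1)+\tfrac12|\nabla(\Phi-\Phi_D)|^2+\tfrac12\sum_{i,j}a_{ij}u_iu_j+\sum_iz_iu_i\Phi_D\Big)dx,$$ where $\Phi$ is the solution of the mixed problem with right-hand side $\sum_i z_iu_i$ (also for $u=u^0$). The *entropy inequality* is $$H_{BR}(u(t))+\sum_{i=1}^n\int_0^t\!\!\int_\Omega u_i|\nabla w_i|^2\,dx\,ds\le H_{BR}(u^0)\quad\text{for a.e. }t\in(0,T),$$ where $w_i=\sigma\log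 u_i+z_i\Phi+p_i(u)$ on $\{u_i>0\}$ and $w_i=0$ on $\{u_i=0\}$, with $\sqrt{u_i}\nabla w_i:=2\sigma\nabla\sqrt{u_i}+\sqrt{u_i}\,\nabla(z_i\Phi+p_i(u))\in L^2(\Omega\times(0,T))$. **Theorem 2 (Weak–strong uniqueness).** Let $(u,\Phi)$ be a weak solution and $(\bar u,\bar\Phi)$ a strong solution with the same initial data $u^0$, both satisfying the entropy inequality. Then $u(t)=\bar u(t)$ and $\Phi(t)=\bar\Phi(t)$ in $\Omega$ for a.e. $t\in(0,T)$, and the representatives of $u_i$ and $\bar u_i$ in $C([0,T];W^{1,4}(\Omega)')$ coincide for every $t\in[0,T]$. -/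

import Mathlib

open MeasureTheory Set Filter Topology
open scoped ENNReal ContDiff Gradient InnerProductSpace

namespace StericPNP

/-- The Euclidean space `ℝᵈ`. -/
abbrev E (d : ℕ) : Type := EuclideanSpace ℝ (Fin d)

instance instFactOneLeFour : Fact ((1 : ℝ≥0∞) ≤ 4) := ⟨by norm_num⟩

/-- `f` has the weak gradient `G` on `Ω`. -/
def HasWeakGradient {d : ℕ} (Ω : Set (E d)) (f : E d → ℝ) (G : E d → E d) : Prop :=
  ∀ φ : E d → ℝ, ContDiff ℝ ∞ φ → HasCompactSupport φ → tsupport φ ⊆ Ω →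
    ∫ x in Ω, f x • ∇ φ x = - ∫ x in Ω, φ x • G x

theorem integrable_smul_gradient {d : ℕ} (Ω : Set (E d)) {p : ℝ≥0∞} [hp : Fact (1 ≤ p)]
    (f : Lp ℝ p (volume.restrict Ω)) {φ : E d → ℝ} (hφ : ContDiff ℝ ∞ φ)
    (hc : HasCompactSupport φ) :
    Integrable (fun x => f x • ∇ φ x) (volume.restrict Ω) := by
  have h1 : LocallyIntegrable (fun x => f x) (volume.restrict Ω) :=
    (Lp.memLp f).locallyIntegrable hp.out
  have hcont : Continuous (∇ φ) :=
    (InnerProductSpace.toDual ℝ (E d)).symm.continuous.comp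
      (hφ.continuous_fderiv (by simp))
  have hsupp : HasCompactSupport (∇ φ) :=
    (hc.fderiv (𝕜 := ℝ)).comp_left (g := (InnerProductSpace.toDual ℝ (E d)).symm) (map_zero _)
  exact h1.integrable_smul_right_of_hasCompactSupport hcont hsupp

theorem integrable_smul_field {d : ℕ} (Ω : Set (E d)) {p : ℝ≥0∞} [hp : Fact (1 ≤ p)]
    (G : Lp (E d) p (volume.restrict Ω)) {φ : E d → ℝ} (hφ : ContDiff ℝ ∞ φ)
    (hc : HasCompactSupport φ) :
    Integrable (fun x => φ x • G x) (volume.restrict Ω) := by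
  have h1 : LocallyIntegrable (fun x => G x) (volume.restrict Ω) :=
    (Lp.memLp G).locallyIntegrable hp.out
  exact h1.integrable_smul_left_of_hasCompactSupport hφ.continuous hc

/-- The Sobolev space `W^{1,p}(Ω)`, as the space of pairs (function, weak gradient) in
`L^p(Ω) × L^p(Ω; ℝᵈ)`, with the norm of that product. -/
def W1 {d : ℕ} (Ω : Set (E d)) (p : ℝ≥0∞) [Fact (1 ≤ p)] :
    Submodule ℝ (Lp ℝ p (volume.restrict Ω) × Lp (E d) p (volume.restrict Ω)) where
  carrier := {v | HasWeakGradient Ω v.1 v.2}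
  zero_mem' := by
    intro φ _ _ _
    have h1 : ∫ x in Ω, ((0 : Lp ℝ p (volume.restrict Ω)) : E d → ℝ) x • ∇ φ x = 0 :=
      integral_eq_zero_of_ae (by
        filter_upwards [Lp.coeFn_zero ℝ p (volume.restrict Ω)] with x hx
        rw [hx]; simp)
    have h2 : ∫ x in Ω, φ x • ((0 : Lp (E d) p (volume.restrict Ω)) : E d → E d) x = 0 :=
      integral_eq_zero_of_ae (by
        filter_upwards [Lp.coeFn_zero (E d) p (volume.restrict Ω)] with x hx
        rw [hx]; simp)
    simpa only [Prod.fst_zero, Prod.snd_zero, h1, neg_zero] using h2.symm ▸ neg_zero.symm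
  add_mem' := by
    rintro ⟨f, F⟩ ⟨g, G⟩ hf hg φ hφ hc hs
    have h1 : ∫ x in Ω, ((f + g : Lp ℝ p (volume.restrict Ω)) : E d → ℝ) x • ∇ φ x
        = ∫ x in Ω, f x • ∇ φ x + g x • ∇ φ x :=
      integral_congr_ae (by
        filter_upwards [Lp.coeFn_add f g] with x hx
        rw [hx, Pi.add_apply, add_smul])
    have h2 : ∫ x in Ω, φ x • ((F + G : Lp (E d) p (volume.restrict Ω)) : E d → E d) x
        = ∫ x in Ω, φ x • F x + φ x • G x :=
      integral_congr_ae (by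
        filter_upwards [Lp.coeFn_add F G] with x hx
        rw [hx, Pi.add_apply, smul_add])
    have hf' := hf φ hφ hc hs
    have hg' := hg φ hφ hc hs
    simp only at hf' hg'
    change ∫ x in Ω, ((f + g : Lp ℝ p (volume.restrict Ω)) : E d → ℝ) x • ∇ φ x
      = - ∫ x in Ω, φ x • ((F + G : Lp (E d) p (volume.restrict Ω)) : E d → E d) x
    rw [h1, h2, integral_add (integrable_smul_gradient Ω f hφ hc)
      (integrable_smul_gradient Ω g hφ hc), integral_add (integrable_smul_field Ω F hφ hc)
      (integrable_smul_field Ω G hφ hc), hf', hg', neg_add]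
  smul_mem' := by
    rintro c ⟨f, F⟩ hf φ hφ hc hs
    have h1 : ∫ x in Ω, ((c • f : Lp ℝ p (volume.restrict Ω)) : E d → ℝ) x • ∇ φ x
        = ∫ x in Ω, c • (f x • ∇ φ x) :=
      integral_congr_ae (by
        filter_upwards [Lp.coeFn_smul c f] with x hx
        rw [hx, Pi.smul_apply, smul_assoc])
    have h2 : ∫ x in Ω, φ x • ((c • F : Lp (E d) p (volume.restrict Ω)) : E d → E d) x
        = ∫ x in Ω, c • (φ x • F x) :=
      integral_congr_ae (by
        filter_upwards [Lp.coeFn_smul c F] with x hx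
        rw [hx, Pi.smul_apply, smul_comm])
    have hf' := hf φ hφ hc hs
    simp only at hf'
    change ∫ x in Ω, ((c • f : Lp ℝ p (volume.restrict Ω)) : E d → ℝ) x • ∇ φ x
      = - ∫ x in Ω, φ x • ((c • F : Lp (E d) p (volume.restrict Ω)) : E d → E d) x
    rw [h1, h2, integral_smul, integral_smul, hf', smul_neg]

/-- The Sobolev space `H¹(Ω)`. -/
abbrev H1 {d : ℕ} (Ω : Set (E d)) : Type := W1 Ω 2

/-- The dual space `W^{1,4}(Ω)'`. -/
abbrev W14Dual {d : ℕ} (Ω : Set (E d)) : Type := W1 Ω 4 →L[ℝ] ℝ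

/-- The function underlying an element of `W^{1,p}(Ω)`. -/
noncomputable def fn {d : ℕ} {Ω : Set (E d)} {p : ℝ≥0∞} [Fact (1 ≤ p)] (v : W1 Ω p) :
    E d → ℝ := v.1.1

/-- The weak gradient of an element of `W^{1,p}(Ω)`. -/
noncomputable def wgrad {d : ℕ} {Ω : Set (E d)} {p : ℝ≥0∞} [Fact (1 ≤ p)] (v : W1 Ω p) :
    E d → E d := v.1.2

/-- The boundary of `Ω` is Lipschitz: near each boundary point, `Ω` is the set above the graph,
in some direction `e`, of a Lipschitz function of the component orthogonal to `e`. -/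
def HasLipschitzBoundary {d : ℕ} (Ω : Set (E d)) : Prop :=
  ∀ x ∈ frontier Ω, ∃ e : E d, ‖e‖ = 1 ∧ ∃ (K : NNReal) (γ : E d → ℝ), LipschitzWith K γ ∧
    ∃ r > 0, ∀ y ∈ Metric.ball x r,
      (y ∈ Ω ↔ γ (y - ⟪e, y⟫_ℝ • e) < ⟪e, y⟫_ℝ)

/-- `v ∈ H¹(Ω)` vanishes on the boundary part `Γ` in the sense of traces: the trace is the limit
in `L²` of the surface measure of the boundary values of smooth functions tending to `v`
in `H¹(Ω)`. -/
def VanishesOn {d : ℕ} {Ω : Set (E d)} (Γ : Set (E d)) (v : H1 Ω) : Prop :=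
  ∃ φ : ℕ → E d → ℝ, (∀ k, ContDiff ℝ ∞ (φ k)) ∧
    Tendsto (fun k => eLpNorm (φ k - fn v) 2 (volume.restrict Ω)) atTop (𝓝 0) ∧
    Tendsto (fun k => eLpNorm (∇ (φ k) - wgrad v) 2 (volume.restrict Ω)) atTop (𝓝 0) ∧
    Tendsto (fun k => eLpNorm (φ k) 2
      ((Measure.hausdorffMeasure ((d : ℝ) - 1)).restrict Γ)) atTop (𝓝 0)

/-- The data of the system: domain, Dirichlet and Neumann boundary parts, final time, diffusion
coefficient, charges, interaction matrix, (extended) boundary potential, initial densities. -/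
structure Data (d n : ℕ) where
  Ω : Set (E d)
  ΓD : Set (E d)
  ΓN : Set (E d)
  T : ℝ
  σ : ℝ
  z : Fin n → ℝ
  a : Matrix (Fin n) (Fin n) ℝ
  ΦD : H1 Ω
  u0 : Fin n → E d → ℝ

variable {d n : ℕ}

/-- `φ` is the weak solution of `-Δφ = ρ` in `Ω`, `φ = Φ_D` on `Γ_D`, `∇φ·ν = 0` on `Γ_N`,
normalized by `∫ φ = 0` if `Γ_D` is empty. -/
structure IsPotential (P : Data d n) (ρ : E d → ℝ) (φ : H1 P.Ω) : Prop where
  dirichlet : VanishesOn P.ΓD (φ - P.ΦD)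
  poisson : ∀ ψ : H1 P.Ω, VanishesOn P.ΓD ψ →
    ∫ x in P.Ω, ⟪wgrad φ x, wgrad ψ x⟫_ℝ = ∫ x in P.Ω, ρ x * fn ψ x
  mean_zero : P.ΓD = ∅ → ∫ x in P.Ω, fn φ x = 0

/-- The total charge `∑ᵢ zᵢ uᵢ`. -/
def charge (P : Data d n) (u : Fin n → E d → ℝ) (x : E d) : ℝ := ∑ i, P.z i * u i x

/-- The standing assumptions on the data. -/
structure Assumptions (P : Data d n) : Prop where
  /- domain -/
  one_le_dim : 1 ≤ d
  dim_le_four : d ≤ 4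
  isOpen : IsOpen P.Ω
  isConnected : IsConnected P.Ω
  isBounded : Bornology.IsBounded P.Ω
  lipschitz : HasLipschitzBoundary P.Ω
  boundary_union : P.ΓD ∪ P.ΓN = frontier P.Ω
  boundary_disjoint : Disjoint P.ΓD P.ΓN
  neumann_open : ∃ U : Set (E d), IsOpen U ∧ P.ΓN = U ∩ frontier P.Ω
  dirichlet_pos : P.ΓD = ∅ ∨ 0 < Measure.hausdorffMeasure ((d : ℝ) - 1) P.ΓD
  /- parameters -/
  T_pos : 0 < P.T
  σ_pos : 0 < P.σ
  a_posDef : P.a.PosDef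
  /- initial data -/
  u0_memLp : ∀ i, MemLp (P.u0 i) 2 (volume.restrict P.Ω)
  u0_pos : ∀ i, ∀ᵐ x ∂(volume.restrict P.Ω), 0 < P.u0 i x
  u0_neutral : P.ΓD = ∅ → ∑ i, ∫ x in P.Ω, P.z i * P.u0 i x = 0
  /- boundary potential: bounded, harmonic in `Ω`, no flux through `Γ_N` -/
  ΦD_bounded : MemLp (fn P.ΦD) ∞ (volume.restrict P.Ω)
  ΦD_harmonic : ∀ ψ : H1 P.Ω, VanishesOn P.ΓD ψ →
    ∫ x in P.Ω, ⟪wgrad P.ΦD x, wgrad ψ x⟫_ℝ = 0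
  /- `H²` regularity for the mixed problem; `D j` is the partial derivative `∂ⱼφ ∈ H¹(Ω)` -/
  h2_regularity : ∃ C > 0, ∀ (f : Lp ℝ 2 (volume.restrict P.Ω)) (φ : H1 P.Ω),
    IsPotential P f φ → ∃ D : Fin d → H1 P.Ω,
      (∀ j, fn (D j) =ᵐ[volume.restrict P.Ω] fun x => wgrad φ x j) ∧
      √(‖φ.1.1‖ ^ 2 + ‖φ.1.2‖ ^ 2 + ∑ j, ‖(D j).1.2‖ ^ 2) ≤ C * (‖f‖ + 1)

/-- `∇(zᵢ Φ + pᵢ(u))` with `pᵢ(u) = ∑ⱼ aᵢⱼ uⱼ`. -/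
noncomputable def driftGrad (P : Data d n) (u : Fin n → H1 P.Ω) (Φ : H1 P.Ω) (i : Fin n)
    (x : E d) : E d :=
  P.z i • wgrad Φ x + ∑ j, P.a i j • wgrad (u j) x

/-- `-Jᵢ = uᵢ ∇wᵢ = σ ∇uᵢ + zᵢ uᵢ ∇Φ + uᵢ ∇pᵢ(u)`. -/
noncomputable def negFlux (P : Data d n) (u : Fin n → H1 P.Ω) (Φ : H1 P.Ω) (i : Fin n)
    (x : E d) : E d :=
  P.σ • wgrad (u i) x + fn (u i) x • driftGrad P u Φ i x

/-- A weak solution `(u, Φ)` on `(0, T)`. Besides `u` and `Φ`, the fields record `√uᵢ`,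
`∂ₜuᵢ` and the representative of `uᵢ` that is continuous on `[0, T]` with values in
`W^{1,4}(Ω)'`; all three are determined by `u`. -/
structure WeakSolution (P : Data d n) where
  u : Fin n → ℝ → H1 P.Ω
  Φ : ℝ → H1 P.Ω
  sqrtU : Fin n → ℝ → H1 P.Ω
  dtu : Fin n → ℝ → W14Dual P.Ω
  rep : Fin n → ℝ → W14Dual P.Ω
  u_memLp : ∀ i, MemLp (u i) 2 (volume.restrict (Ioo 0 P.T))
  Φ_memLp : MemLp Φ 2 (volume.restrict (Ioo 0 P.T))
  sqrtU_memLp : ∀ i, MemLp (sqrtU i) 2 (volume.restrict (Ioo 0 P.T))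
  dtu_memLp : ∀ i, MemLp (dtu i) 2 (volume.restrict (Ioo 0 P.T))
  u_nonneg : ∀ i, ∀ᵐ t ∂(volume.restrict (Ioo 0 P.T)), ∀ᵐ x ∂(volume.restrict P.Ω),
    0 ≤ fn (u i t) x
  sqrtU_eq : ∀ i, ∀ᵐ t ∂(volume.restrict (Ioo 0 P.T)), ∀ᵐ x ∂(volume.restrict P.Ω),
    fn (sqrtU i t) x = √(fn (u i t) x)
  /- `dtu i` is the distributional time derivative of `u i` -/
  dtu_eq : ∀ i, ∀ η : ℝ → ℝ, ContDiff ℝ ∞ η → HasCompactSupport η → tsupport η ⊆ Ioo 0 P.T →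
    ∀ φ : W1 P.Ω 4,
      ∫ t in Ioo 0 P.T, deriv η t * ∫ x in P.Ω, fn (u i t) x * fn φ x
        = - ∫ t in Ioo 0 P.T, η t * dtu i t φ
  /- `∂ₜuᵢ + div Jᵢ = 0` with the no-flux condition -/
  equation : ∀ i, ∀ᵐ t ∂(volume.restrict (Ioo 0 P.T)), ∀ φ : W1 P.Ω 4,
    dtu i t φ + ∫ x in P.Ω, ⟪negFlux P (fun j => u j t) (Φ t) i x, wgrad φ x⟫_ℝ = 0
  poisson : ∀ᵐ t ∂(volume.restrict (Ioo 0 P.T)),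
    IsPotential P (charge P fun i => fn (u i t)) (Φ t)
  /- the initial data are attained in `W^{1,4}(Ω)'` -/
  rep_continuous : ∀ i, ContinuousOn (rep i) (Icc 0 P.T)
  rep_eq : ∀ i, ∀ᵐ t ∂(volume.restrict (Ioo 0 P.T)), ∀ φ : W1 P.Ω 4,
    rep i t φ = ∫ x in P.Ω, fn (u i t) x * fn φ x
  initial : ∀ i, ∀ φ : W1 P.Ω 4, rep i 0 φ = ∫ x in P.Ω, P.u0 i x * fn φ x

/-- The Boltzmann--Rao entropy of the densities `u` with potential `Φ`. -/
noncomputable def entropyBR (P : Data d n) (u : Fin n → E d → ℝ) (Φ : H1 P.Ω) : ℝ :=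
  ∫ x in P.Ω,
    (P.σ * ∑ i, u i x * (Real.log (u i x) - 1)
      + 1 / 2 * ‖wgrad Φ x - wgrad P.ΦD x‖ ^ 2
      + 1 / 2 * ∑ i, ∑ j, P.a i j * u i x * u j x
      + ∑ i, P.z i * u i x * fn P.ΦD x)

/-- The field `√uᵢ ∇wᵢ = 2σ ∇√uᵢ + √uᵢ ∇(zᵢ Φ + pᵢ(u))`, where `wᵢ = σ log uᵢ + zᵢ Φ + pᵢ(u)`
on `{uᵢ > 0}`; it vanishes a.e. on `{uᵢ = 0}`. -/
noncomputable def weightedEntropyGrad {P : Data d n} (S : WeakSolution P) (i : Fin n) (t : ℝ)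
    (x : E d) : E d :=
  (2 * P.σ) • wgrad (S.sqrtU i t) x
    + fn (S.sqrtU i t) x • driftGrad P (fun j => S.u j t) (S.Φ t) i x

/-- The entropy inequality
`H_BR(u(t)) + ∑ᵢ ∫₀ᵗ ∫_Ω uᵢ |∇wᵢ|² dx ds ≤ H_BR(u⁰)` for a.e. `t`. The left-hand side being
finite, `G i = √uᵢ ∇wᵢ` is in `L²(0,T; L²(Ω))`; `Φ⁰` is the potential of the initial charge. -/
def EntropyInequality {P : Data d n} (S : WeakSolution P) : Prop :=
  ∃ (G : Fin n → ℝ → Lp (E d) 2 (volume.restrict P.Ω)) (Φ0 : H1 P.Ω),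
    (∀ i, MemLp (G i) 2 (volume.restrict (Ioo 0 P.T))) ∧
    (∀ i, ∀ᵐ t ∂(volume.restrict (Ioo 0 P.T)),
      G i t =ᵐ[volume.restrict P.Ω] weightedEntropyGrad S i t) ∧
    IsPotential P (charge P P.u0) Φ0 ∧
    ∀ᵐ t ∂(volume.restrict (Ioo 0 P.T)),
      entropyBR P (fun i => fn (S.u i t)) (S.Φ t)
        + ∑ i, ∫ s in Ioo 0 t, ∫ x in P.Ω, ‖G i s x‖ ^ 2
      ≤ entropyBR P P.u0 Φ0

/-- A strong solution: a weak solution with `∇uᵢ, ∇Φ ∈ L^∞(Ω × (0,T))`. -/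
def IsStrong {P : Data d n} (S : WeakSolution P) : Prop :=
  ∃ M : ℝ, ∀ᵐ t ∂(volume.restrict (Ioo 0 P.T)), ∀ᵐ x ∂(volume.restrict P.Ω),
    (∀ i, ‖wgrad (S.u i t) x‖ ≤ M) ∧ ‖wgrad (S.Φ t) x‖ ≤ M

end StericPNP

/-! The two solutions are compared through a regularized relative entropy. For ε > 0 let R_ε(t) be
the integral over Ω of σ ∑ᵢ (uᵢ log uᵢ − uᵢ − uᵢ log(ūᵢ+ε) + ūᵢ + ε) + ½|∇(Φ−Φ̄)|² + ½ (u−ū)·a(u−ū).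
Only ū ≥ 0 is known, with no positive lower bound, so log ū and 1/ū are replaced by log(ū+ε) and
1/(ū+ε). The logarithmic part is nonnegative and `a` is positive definite, hence R_ε controls ‖u−ū‖²
in L² uniformly in ε.

Up to a constant of order ε, R_ε equals H_BR(u) plus a term `cross` that is affine in (u, ∇Φ) for
fixed (ū, ∇Φ̄) (`entropyBR_add_cross`). The entropy inequality controls H_BR(u). The evolution of
`cross` comes from the two equations: formally, that of uᵢ is tested with zᵢΦ̄ + pᵢ(ū) + σ log(ūᵢ+ε)
(`testU`), and that of ūᵢ with zᵢ(Φ−Φ̄) + pᵢ(u−ū) + σuᵢ/(ūᵢ+ε) − σ (`testB`).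

These test functions have no time derivative, so the computation is made between two times. In
`crossDensity_twoPoint` the chain rule becomes an inequality: if ū is taken at the later time in
both test functions, and u at the earlier one in the second, the discretization errors have a
favourable sign, by concavity of log and positivity of the quadratic forms. Integrating over pairs
(r, r+h) and letting h → 0 turns the fluxes into time averages that converge
(`ae_c_sub_initial_le`). Integrability just suffices: the flux of u is only in L¹, but the gradient
of `testU` is bounded because ∇ū and ∇Φ̄ are; the flux of ū and the gradient of `testB` are both in
L². The start at time 0 uses that ū attains u⁰ strongly in L² (`exists_l2_sub_initial_le`).

It remains to bound, pointwise in space-time, the flux terms minus ∑ uᵢ|∇wᵢ|² by a multiple of the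
relative entropy density plus ε (`exists_dissipation_le`). Completing a square leaves −σ∑⟨∇(uᵢ−ūᵢ),
∇pᵢ(u−ū)⟩, which is coercive and absorbs all errors containing ∇(u−ū). The regularization costs
(ε/(ūᵢ+ε))² uᵢ, which the relative entropy controls up to O(ε) (`sq_mul_le_relEntropy`).

For equal initial data R_ε starts at O(ε), so Grönwall gives R_ε ≤ Cε with C independent of ε, and ε
→ 0 yields u = ū. The potentials then agree by `IsPotential.unique`, and the continuous
representatives agree on [0,T] because they agree almost everywhere. -/

namespace StericPNP

/-! ### Continuity of translations in mean -/

section Translation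

variable {V F : Type*} [NormedAddCommGroup V] [MeasurableSpace V] [BorelSpace V]
  [SecondCountableTopology V] [NormedAddCommGroup F] {p : ℝ≥0∞} {μ : Measure V}

/-- Translations form a continuous family in `C(V, V)`, and for p < ∞ composing a fixed L^p class
with a measure-preserving map depends continuously on the map. -/
theorem tendsto_eLpNorm_translate [μ.IsAddRightInvariant] [μ.InnerRegularCompactLTTop]
    [IsLocallyFiniteMeasure μ] (hp1 : 1 ≤ p) (hp : p ≠ ⊤) {g : V → F} (hg : MemLp g p μ) :
    Tendsto (fun z => eLpNorm (fun y => g (y + z) - g y) p μ) (𝓝 0) (𝓝 0) := by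
  have : Fact (1 ≤ p) := ⟨hp1⟩
  let τ : V → C(V, V) := fun z => ⟨fun y => y + z, by fun_prop⟩
  have hτm : ∀ z, MeasurePreserving (τ z) μ μ := fun z => measurePreserving_add_right μ z
  have hτ : Continuous τ :=
    ContinuousMap.continuous_of_continuous_uncurry _
      (show Continuous fun q : V × V => q.2 + q.1 by fun_prop)
  have hcont : Continuous fun z => Lp.compMeasurePreserving (τ z) (hτm z) hg.toLp :=
    Continuous.compMeasurePreservingLp continuous_const hτ hτm hp
  have h0 := (tendsto_iff_edist_tendsto_0.1 (hcont.tendsto 0))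
  refine h0.congr fun z => ?_
  rw [Lp.edist_def]
  refine eLpNorm_congr_ae ?_
  have hτz : ∀ z, (Lp.compMeasurePreserving (τ z) (hτm z) hg.toLp : V → F)
      =ᵐ[μ] fun y => g (y + z) := fun z =>
    (Lp.coeFn_compMeasurePreserving _ (hτm z)).trans
      ((hτm z).quasiMeasurePreserving.ae_eq_comp hg.coeFn_toLp)
  filter_upwards [hτz z, hτz 0] with y h1 h2
  rw [Pi.sub_apply, h1, h2, add_zero]

/-- The mean of the translates of `g` under a probability measure is at most as far from `g` as
the translates are. -/
theorem eLpNorm_average_translate_sub_le [NormedSpace ℝ F] [CompleteSpace F]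
    [SFinite μ] [μ.IsAddRightInvariant] (hp1 : 1 ≤ p) (hp : p ≠ ⊤) {g : V → F}
    (hg : MemLp g p μ) (hgm : StronglyMeasurable g) (κ : Measure V) [IsProbabilityMeasure κ]
    {δ : ℝ≥0∞} (hδ : ∀ᵐ z ∂κ, eLpNorm (fun y => g (y + z) - g y) p μ ≤ δ) :
    eLpNorm (fun y => (∫ z, g (y + z) ∂κ) - g y) p μ ≤ δ := by
  have hp0 : p ≠ 0 := (one_pos.trans_le hp1).ne'
  have hpr : 0 < p.toReal := ENNReal.toReal_pos hp0 hp
  have hmeas : StronglyMeasurable fun q : V × V => g (q.1 + q.2) - g q.1 :=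
    (hgm.comp_measurable (measurable_fst.add measurable_snd)).sub
      (hgm.comp_measurable measurable_fst)
  -- Jensen's inequality at fixed y, in the form L¹ ≤ L^p on a probability space; Tonelli then
  -- exchanges y and z.
  have key : ∀ y, ‖(∫ z, g (y + z) ∂κ) - g y‖ₑ ^ p.toReal
      ≤ ∫⁻ z, ‖g (y + z) - g y‖ₑ ^ p.toReal ∂κ := by
    intro y
    have hm : AEStronglyMeasurable (fun z => g (y + z) - g y) κ :=
      (hmeas.comp_measurable measurable_prodMk_left).aestronglyMeasurable
    by_cases hi : Integrable (fun z => g (y + z)) κ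
    · have h1 : (∫ z, g (y + z) ∂κ) - g y = ∫ z, (g (y + z) - g y) ∂κ := by
        rw [integral_sub hi (integrable_const _)]; simp
      rw [h1]
      have h2 : ‖∫ z, (g (y + z) - g y) ∂κ‖ₑ ≤ eLpNorm (fun z => g (y + z) - g y) p κ := by
        refine (enorm_integral_le_lintegral_enorm _).trans ?_
        rw [← eLpNorm_one_eq_lintegral_enorm]
        exact eLpNorm_le_eLpNorm_of_exponent_le hp1 hm
      calc _ ≤ (eLpNorm (fun z => g (y + z) - g y) p κ) ^ p.toReal :=
            ENNReal.rpow_le_rpow h2 hpr.le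
        _ = _ := by
            rw [eLpNorm_eq_lintegral_rpow_enorm_toReal hp0 hp, ← ENNReal.rpow_mul,
              one_div_mul_cancel hpr.ne', ENNReal.rpow_one]
    -- Here the Bochner integral takes its default value 0, so the bound must come from the
    -- right-hand side being infinite: a finite L^p norm would imply integrability.
    · have hn : ¬ Integrable (fun z => g (y + z) - g y) κ := by
        intro h
        apply hi
        exact (h.add (integrable_const (g y))).congr (.of_forall fun z => by simp)
      have hinf : eLpNorm (fun z => g (y + z) - g y) p κ = ⊤ := by
        by_contra hne
        exact hn (MemLp.integrable hp1 ⟨hm, lt_top_iff_ne_top.2 hne⟩)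
      have : ∫⁻ z, ‖g (y + z) - g y‖ₑ ^ p.toReal ∂κ = ⊤ := by
        rw [eLpNorm_eq_lintegral_rpow_enorm_toReal hp0 hp] at hinf
        by_contra hne
        exact (ENNReal.rpow_lt_top_of_nonneg (by positivity) hne).ne hinf
      rw [this]; exact le_top
  rw [eLpNorm_eq_lintegral_rpow_enorm_toReal hp0 hp]
  have h3 : ∫⁻ y, ‖(∫ z, g (y + z) ∂κ) - g y‖ₑ ^ p.toReal ∂μ ≤ δ ^ p.toReal := by
    calc _ ≤ ∫⁻ y, ∫⁻ z, ‖g (y + z) - g y‖ₑ ^ p.toReal ∂κ ∂μ := lintegral_mono key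
      _ = ∫⁻ z, ∫⁻ y, ‖g (y + z) - g y‖ₑ ^ p.toReal ∂μ ∂κ :=
          lintegral_lintegral_swap (hmeas.enorm.pow_const _).aemeasurable
      _ ≤ ∫⁻ _, δ ^ p.toReal ∂κ := by
          refine lintegral_mono_ae ?_
          filter_upwards [hδ] with z hz
          rw [eLpNorm_eq_lintegral_rpow_enorm_toReal hp0 hp] at hz
          have := ENNReal.rpow_le_rpow hz hpr.le
          rwa [← ENNReal.rpow_mul, one_div_mul_cancel hpr.ne', ENNReal.rpow_one] at this
      _ = δ ^ p.toReal := by simp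
  calc _ ≤ (δ ^ p.toReal) ^ (1 / p.toReal) := ENNReal.rpow_le_rpow h3 (by positivity)
    _ = δ := by rw [← ENNReal.rpow_mul, mul_one_div_cancel hpr.ne', ENNReal.rpow_one]

/-- Only the concentration of `κ n` at 0 matters. This serves both smoothings of the proof:
mollification in space, with κ a shifted bump, and averaging in time, with κ uniform on a short
segment of the time axis. -/
theorem tendsto_eLpNorm_average_translate [NormedSpace ℝ F] [CompleteSpace F]
    [SFinite μ] [μ.IsAddRightInvariant] [μ.InnerRegularCompactLTTop]
    [IsLocallyFiniteMeasure μ] (hp1 : 1 ≤ p) (hp : p ≠ ⊤) {g : V → F}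
    (hg : MemLp g p μ) (hgm : StronglyMeasurable g) {κ : ℕ → Measure V}
    (hκ : ∀ n, IsProbabilityMeasure (κ n)) {R : ℕ → ℝ} (hR : Tendsto R atTop (𝓝 0))
    (hκR : ∀ n, ∀ᵐ z ∂(κ n), ‖z‖ ≤ R n) :
    Tendsto (fun n => eLpNorm (fun y => (∫ z, g (y + z) ∂(κ n)) - g y) p μ) atTop (𝓝 0) := by
  have h := tendsto_eLpNorm_translate hp1 hp hg
  rw [ENNReal.tendsto_nhds_zero] at h ⊢
  intro δ hδ
  obtain ⟨r, hr, hball⟩ := Metric.eventually_nhds_iff.1 (h δ hδ)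
  filter_upwards [hR.eventually (gt_mem_nhds hr)] with n hn
  refine eLpNorm_average_translate_sub_le hp1 hp hg hgm (κ n) ?_
  filter_upwards [hκR n] with z hz
  exact hball (by simpa using hz.trans_lt hn)

end Translation

end StericPNP

namespace StericPNP

/-! ### Mollification -/

section Mollify

variable {d : ℕ} {F : Type*} [NormedAddCommGroup F] [NormedSpace ℝ F] [CompleteSpace F]

/-- The mollification of `f` by a normalized bump function. -/
noncomputable def mollify (φ : ContDiffBump (0 : E d)) (f : E d → F) (x : E d) : F :=
  ∫ t, φ.normed volume (x - t) • f t

theorem mollify_eq_convolution (φ : ContDiffBump (0 : E d)) (f : E d → F) :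
    mollify φ f = convolution f (φ.normed volume) (ContinuousLinearMap.lsmul ℝ ℝ).flip volume :=
  rfl

theorem contDiff_mollify (φ : ContDiffBump (0 : E d)) {f : E d → F}
    (hf : LocallyIntegrable f volume) : ContDiff ℝ ∞ (mollify φ f) := by
  rw [mollify_eq_convolution]
  exact φ.hasCompactSupport_normed.contDiff_convolution_right _ hf φ.contDiff_normed

/-- The translated mollification is a mean of translates. -/
theorem mollify_add_eq_average (φ : ContDiffBump (0 : E d)) {f : E d → F}
    (hf : StronglyMeasurable f) (a x : E d) :
    mollify φ f (x + a) = ∫ z, f (x + z) ∂((volume.withDensity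
      fun t => ENNReal.ofReal (φ.normed volume t)).map fun t => a - t) := by
  rw [integral_map (f := fun z => f (x + z)) (by fun_prop)
    (hf.comp_measurable (by fun_prop)).aestronglyMeasurable,
    integral_withDensity_eq_integral_toReal_smul
      (φ.contDiff_normed (n := 0)).continuous.measurable.ennreal_ofReal (by simp)]
  rw [mollify, ← integral_sub_left_eq_self _ volume (x + a)]
  refine integral_congr_ae (.of_forall fun t => ?_)
  simp only [ENNReal.toReal_ofReal (φ.nonneg_normed t), add_sub_assoc]
  congr 2
  abel

/-- The averaging measure lives in a ball of radius `‖a n‖ + rOut`, so a vanishing shift does no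
harm. The shift is what will move the mollified point away from the boundary. -/
theorem tendsto_mollify_add {f : E d → F} (hf : MemLp f 2 volume) (hfm : StronglyMeasurable f)
    {φ : ℕ → ContDiffBump (0 : E d)} (hφ : Tendsto (fun n => (φ n).rOut) atTop (𝓝 0))
    {a : ℕ → E d} (ha : Tendsto a atTop (𝓝 0)) :
    Tendsto (fun n => eLpNorm (fun x => mollify (φ n) f (x + a n) - f x) 2 volume)
      atTop (𝓝 0) := by
  simp_rw [fun n x => mollify_add_eq_average (φ n) hfm (a n) x]
  have hpr : ∀ n, IsProbabilityMeasure ((volume : Measure (E d)).withDensity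
      fun t => ENNReal.ofReal ((φ n).normed volume t)) := fun n => ⟨by
    rw [withDensity_apply _ MeasurableSet.univ, Measure.restrict_univ,
      ← ofReal_integral_eq_lintegral_ofReal (φ n).integrable_normed
        (.of_forall (φ n).nonneg_normed), (φ n).integral_normed, ENNReal.ofReal_one]⟩
  refine tendsto_eLpNorm_average_translate (R := fun n => ‖a n‖ + (φ n).rOut) (by norm_num)
    (by norm_num) hf hfm (fun n => ?_) ?_ fun n => ?_
  · have := hpr n
    exact Measure.isProbabilityMeasure_map (by fun_prop)
  · simpa using ha.norm.add hφ
  · rw [ae_map_iff (by fun_prop) (measurableSet_le (by fun_prop) (by fun_prop)),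
      ae_withDensity_iff ((φ n).contDiff_normed (n := 0)).continuous.measurable.ennreal_ofReal]
    refine .of_forall fun t ht => ?_
    have : t ∈ Function.support ((φ n).normed volume) := by
      intro h0; simp [h0] at ht
    rw [(φ n).support_normed_eq, Metric.mem_ball, dist_zero_right] at this
    exact (norm_sub_le _ _).trans (by linarith)

/-- If the closed ball around x lies in Ω, the kernel t ↦ k(x − t) is an admissible test function,
and the definition of the weak gradient for it is the claim. The zero extension of f is not seen
from such a point. -/
theorem gradient_mollify {Ω : Set (E d)} (hΩ : MeasurableSet Ω) {f : E d → ℝ} {G : E d → E d}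
    (h : HasWeakGradient Ω f G)
    (hf : LocallyIntegrable (Ω.indicator f) volume)
    (hG : LocallyIntegrable (Ω.indicator G) volume)
    (φ : ContDiffBump (0 : E d)) {x : E d} (hx : Metric.closedBall x φ.rOut ⊆ Ω) :
    ∇ (mollify φ (Ω.indicator f)) x = mollify φ (Ω.indicator G) x := by
  set k := φ.normed volume with hk
  have hkd : ContDiff ℝ ∞ k := φ.contDiff_normed
  have hkc : HasCompactSupport k := φ.hasCompactSupport_normed
  have hder := hkc.hasFDerivAt_convolution_right (ContinuousLinearMap.lsmul ℝ ℝ).flip hf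
    (hkd.of_le (by simp)) x
  set θ : E d → ℝ := fun t => k (x - t) with hθ
  have hθd : ContDiff ℝ ∞ θ := hkd.comp (contDiff_const.sub contDiff_id)
  have hθs : tsupport θ ⊆ Metric.closedBall x φ.rOut := by
    refine closure_minimal (fun t ht => ?_) Metric.isClosed_closedBall
    have h1 : x - t ∈ Function.support k := ht
    rw [hk, φ.support_normed_eq, Metric.mem_ball, dist_zero_right] at h1
    rw [Metric.mem_closedBall, dist_comm, dist_eq_norm]
    exact h1.le
  have hθc : HasCompactSupport θ :=
    HasCompactSupport.of_support_subset_isCompact (isCompact_closedBall x φ.rOut)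
      ((subset_tsupport θ).trans hθs)
  have hw := h θ hθd hθc (hθs.trans hx)
  have hgθ : ∀ t, ∇ θ t = - ∇ k (x - t) := by
    intro t
    have h1 : HasFDerivAt θ ((fderiv ℝ k (x - t)).comp (-(ContinuousLinearMap.id ℝ (E d)))) t := by
      have h2 : HasFDerivAt (fun t : E d => x - t) (-(ContinuousLinearMap.id ℝ (E d))) t :=
        (hasFDerivAt_id t).const_sub x
      exact ((hkd.differentiable (by simp)) (x - t)).hasFDerivAt.comp t h2
    rw [gradient, h1.fderiv, gradient, ← map_neg]
    congr 1
    ext; simp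
  have h1 : mollify φ (Ω.indicator G) x = ∫ t in Ω, θ t • G t := by
    rw [mollify, ← integral_indicator hΩ]
    refine integral_congr_ae (.of_forall fun t => ?_)
    by_cases ht : t ∈ Ω <;> simp [ht, hθ, hk]
  have h2 : ∫ t in Ω, f t • ∇ θ t = - ∫ t, Ω.indicator f t • ∇ k (x - t) := by
    rw [← integral_indicator hΩ, ← integral_neg]
    refine integral_congr_ae (.of_forall fun t => ?_)
    by_cases ht : t ∈ Ω <;> simp [ht, hgθ]
  rw [h2, neg_inj, ← h1] at hw
  rw [← hw]
  have hint : Integrable (fun t => Ω.indicator f t • ∇ k (x - t)) volume := by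
    have h3 : Continuous (∇ θ) := (InnerProductSpace.toDual ℝ (E d)).symm.continuous.comp
      (hθd.continuous_fderiv (by simp))
    have h4 : HasCompactSupport (∇ θ) :=
      (hθc.fderiv (𝕜 := ℝ)).comp_left (g := (InnerProductSpace.toDual ℝ (E d)).symm) (map_zero _)
    exact (hf.integrable_smul_right_of_hasCompactSupport h3 h4).neg.congr
      (.of_forall fun t => by simp [hgθ])
  refine ext_inner_right ℝ fun e => ?_
  rw [inner_gradient_left, real_inner_comm, ← integral_inner hint, mollify_eq_convolution,
    hder.fderiv, convolution_precompR_apply _ hf (hkc.fderiv (𝕜 := ℝ))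
      (hkd.continuous_fderiv (by simp)), convolution_def]
  refine integral_congr_ae (.of_forall fun t => ?_)
  simp only [ContinuousLinearMap.flip_apply, ContinuousLinearMap.lsmul_apply, inner_smul_right,
    smul_eq_mul]
  rw [real_inner_comm, inner_gradient_left, mul_comm]

end Mollify

end StericPNP

namespace StericPNP

/-! ### Density of smooth functions in `H¹` -/

section Density

variable {d : ℕ}

/-- A domain with Lipschitz boundary has the uniform interior cone property. -/
theorem HasLipschitzBoundary.exists_cone {Ω : Set (E d)} (hΩ : IsOpen Ω)
    (hL : HasLipschitzBoundary Ω) {x : E d} (hx : x ∈ closure Ω) :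
    ∃ ρ > 0, ∃ c > 0, ∃ (e : E d), ∃ δ₀ > 0, ∀ δ : ℝ, 0 < δ → δ < δ₀ →
      ∀ y ∈ Ω ∩ Metric.ball x ρ, Metric.closedBall (y + δ • e) (c * δ) ⊆ Ω := by
  by_cases hxΩ : x ∈ Ω
  · obtain ⟨r, hr, hball⟩ := Metric.isOpen_iff.1 hΩ x hxΩ
    -- At an interior point no direction is needed: with e = 0 the cone degenerates to small balls
    -- around the points themselves.
    refine ⟨r / 2, by positivity, 1, one_pos, 0, r / 2, by positivity, ?_⟩
    intro δ _ hδ y hy z hz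
    apply hball
    have h1 : dist y x < r / 2 := hy.2
    have h2 : dist z y ≤ δ := by simpa using hz
    rw [Metric.mem_ball]
    linarith [dist_triangle z y x]
  · have hxf : x ∈ frontier Ω := by rw [hΩ.frontier_eq]; exact ⟨hx, hxΩ⟩
    obtain ⟨e, he, K, γ, hγ, r, hr, hgraph⟩ := hL x hxf
    have hK : (0 : ℝ) ≤ K := K.2
    -- Moving by δe gains height δ. A perturbation of size cδ loses at most cδ of height and raises
    -- the graph by at most 2Kcδ, the orthogonal component being bounded by twice the perturbation.
    -- The opening c makes (2K+1)c < 1.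
    refine ⟨r / 2, by positivity, 1 / (2 * (K + 1)), by positivity, e, r / 4, by positivity, ?_⟩
    intro δ hδ0 hδ y hy z hz
    set c : ℝ := 1 / (2 * (K + 1)) with hc
    have hcK : c * (2 * (K + 1)) = 1 := by rw [hc]; field_simp
    have hc0 : 0 < c := by rw [hc]; positivity
    have hc2 : c ≤ 1 / 2 := by nlinarith
    have hyb : dist y x < r / 2 := hy.2
    have hw : ‖z - (y + δ • e)‖ ≤ c * δ := by simpa [dist_eq_norm] using hz
    set w := z - (y + δ • e) with hwdef
    have hz' : z = y + δ • e + w := by rw [hwdef]; abel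
    have hyx : y ∈ Metric.ball x r := by rw [Metric.mem_ball]; linarith
    have hcδ : c * δ ≤ δ / 2 := by nlinarith
    have hzx : z ∈ Metric.ball x r := by
      rw [Metric.mem_ball, dist_eq_norm]
      have h1 : z - x = (y - x) + (δ • e + w) := by rw [hz']; abel
      have h2 : ‖δ • e‖ = δ := by rw [norm_smul, he, mul_one, Real.norm_of_nonneg hδ0.le]
      have h3 : ‖y - x‖ < r / 2 := by rwa [← dist_eq_norm]
      rw [h1]
      linarith [norm_add_le (y - x) (δ • e + w), norm_add_le (δ • e) w]
    rw [hgraph z hzx]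
    have hy1 := (hgraph y hyx).1 hy.1
    have hee : ⟪e, e⟫_ℝ = 1 := by rw [real_inner_self_eq_norm_sq, he]; norm_num
    have hez : ⟪e, z⟫_ℝ = ⟪e, y⟫_ℝ + δ + ⟪e, w⟫_ℝ := by
      rw [hz', inner_add_right, inner_add_right, inner_smul_right, hee, mul_one]
    have hew : |⟪e, w⟫_ℝ| ≤ ‖w‖ := by
      simpa [he] using abs_real_inner_le_norm e w
    have hdiff : z - ⟪e, z⟫_ℝ • e - (y - ⟪e, y⟫_ℝ • e) = w - ⟪e, w⟫_ℝ • e := by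
      rw [hez, hz']; module
    have hlip := hγ.dist_le_mul (z - ⟪e, z⟫_ℝ • e) (y - ⟪e, y⟫_ℝ • e)
    rw [dist_eq_norm, dist_eq_norm, hdiff] at hlip
    have h5 : ‖w - ⟪e, w⟫_ℝ • e‖ ≤ 2 * ‖w‖ := by
      refine (norm_sub_le _ _).trans ?_
      rw [norm_smul, he, Real.norm_eq_abs]; linarith
    have h6 := le_abs_self (γ (z - ⟪e, z⟫_ℝ • e) - γ (y - ⟪e, y⟫_ℝ • e))
    rw [← Real.norm_eq_abs] at h6
    have h7 : (K : ℝ) * ‖w - ⟪e, w⟫_ℝ • e‖ ≤ K * (2 * (c * δ)) :=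
      mul_le_mul_of_nonneg_left (h5.trans (by linarith)) hK
    have h8 : K * (2 * (c * δ)) + c * δ < δ := by nlinarith [mul_pos hc0 hδ0]
    have := (abs_le.1 hew).1
    linarith

theorem gradient_comp_add_right (f : E d → ℝ) (a y : E d) :
    ∇ (fun x => f (x + a)) y = ∇ f (y + a) := by
  simp only [gradient, fderiv_comp_add_right]

theorem eLpNorm_restrict_le_of_norm_le {F F' : Type*} [NormedAddCommGroup F]
    [NormedAddCommGroup F'] {Ω U : Set (E d)} (hU : MeasurableSet U) {g : E d → F} {h : E d → F'}
    {C : ℝ} (hgh : ∀ x ∈ Ω, x ∈ U → ‖g x‖ ≤ C * ‖h x‖) (h0 : ∀ x, x ∉ U → g x = 0)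
    (hΩ : MeasurableSet Ω) :
    eLpNorm g 2 (volume.restrict Ω)
      ≤ ENNReal.ofReal C * eLpNorm h 2 (volume.restrict (Ω ∩ U)) := by
  have h1 : g = U.indicator g := by
    ext x
    by_cases hx : x ∈ U <;> simp [hx, h0]
  rw [h1, eLpNorm_indicator_eq_eLpNorm_restrict hU, Measure.restrict_restrict hU, inter_comm]
  refine eLpNorm_le_mul_eLpNorm_of_ae_le_mul ?_ 2
  filter_upwards [ae_restrict_mem (hΩ.inter hU)] with x hx
  exact hgh x hx.1 hx.2

/-- Extend v by zero, mollify at radius cδ and evaluate at x + δe. By the cone condition the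
mollifier then only sees Ω, so the jump of the extension across the boundary produces no gradient.
-/
theorem exists_contDiff_approx_of_cone {Ω : Set (E d)} (hΩ : IsOpen Ω) {v : E d → ℝ}
    {G : E d → E d} (hvm : StronglyMeasurable v) (hGm : StronglyMeasurable G)
    (hv : MemLp v 2 (volume.restrict Ω)) (hG : MemLp G 2 (volume.restrict Ω))
    (h : HasWeakGradient Ω v G) {U : Set (E d)} {c δ₀ : ℝ} (hc : 0 < c) (hδ₀ : 0 < δ₀) {e : E d}
    (hcone : ∀ δ : ℝ, 0 < δ → δ < δ₀ → ∀ y ∈ Ω ∩ U,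
      Metric.closedBall (y + δ • e) (c * δ) ⊆ Ω) (hU : IsOpen U) :
    ∃ w : ℕ → E d → ℝ, (∀ k, ContDiff ℝ ∞ (w k)) ∧
      Tendsto (fun k => eLpNorm (w k - v) 2 (volume.restrict (Ω ∩ U))) atTop (𝓝 0) ∧
      Tendsto (fun k => eLpNorm (∇ (w k) - G) 2 (volume.restrict (Ω ∩ U))) atTop (𝓝 0) := by
  -- The 2 keeps every δ strictly below δ₀, including n = 0.
  let δ : ℕ → ℝ := fun n => δ₀ / (n + 2)
  have hδ0 : ∀ n, 0 < δ n := fun n => by positivity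
  have hδ1 : ∀ n, δ n < δ₀ := fun n => by
    rw [div_lt_iff₀ (by positivity)]
    nlinarith [(Nat.cast_nonneg n : (0 : ℝ) ≤ n)]
  have hδt : Tendsto δ atTop (𝓝 0) := by
    have := (tendsto_const_div_atTop_nhds_zero_nat δ₀).comp (tendsto_add_atTop_nat 2)
    refine this.congr fun n => ?_
    simp [δ]
  let φ : ℕ → ContDiffBump (0 : E d) := fun n =>
    ⟨c * δ n / 2, c * δ n, by have := hδ0 n; positivity, by
      have := mul_pos hc (hδ0 n); linarith⟩
  have hφ : Tendsto (fun n => (φ n).rOut) atTop (𝓝 0) := by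
    simpa using hδt.const_mul c
  have ha : Tendsto (fun n => δ n • e) atTop (𝓝 0) := by simpa using hδt.smul_const e
  have hΩm := hΩ.measurableSet
  have hv' : MemLp (Ω.indicator v) 2 volume := (memLp_indicator_iff_restrict hΩm).2 hv
  have hG' : MemLp (Ω.indicator G) 2 volume := (memLp_indicator_iff_restrict hΩm).2 hG
  have hvl := hv'.locallyIntegrable (by norm_num)
  have hGl := hG'.locallyIntegrable (by norm_num)
  have tv := tendsto_mollify_add hv' (hvm.indicator hΩm) hφ ha
  have tG := tendsto_mollify_add hG' (hGm.indicator hΩm) hφ ha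
  refine ⟨fun n x => mollify (φ n) (Ω.indicator v) (x + δ n • e), fun n =>
    (contDiff_mollify (φ n) hvl).comp (contDiff_id.add contDiff_const), ?_, ?_⟩
  · refine tendsto_of_tendsto_of_tendsto_of_le_of_le tendsto_const_nhds tv
      (fun _ => zero_le) fun n => ?_
    refine (eLpNorm_congr_ae ?_).le.trans (eLpNorm_mono_measure _ Measure.restrict_le_self)
    filter_upwards [ae_restrict_mem (hΩm.inter hU.measurableSet)] with x hx
    simp [hx.1]
  · refine tendsto_of_tendsto_of_tendsto_of_le_of_le tendsto_const_nhds tG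
      (fun _ => zero_le) fun n => ?_
    refine (eLpNorm_congr_ae ?_).le.trans (eLpNorm_mono_measure _ Measure.restrict_le_self)
    filter_upwards [ae_restrict_mem (hΩm.inter hU.measurableSet)] with x hx
    rw [Pi.sub_apply, gradient_comp_add_right,
      gradient_mollify hΩm h hvl hGl (φ n) (hcone _ (hδ0 n) (hδ1 n) x hx)]
    simp [hx.1]

theorem gradient_fun_mul {f g : E d → ℝ} {x : E d} (hf : DifferentiableAt ℝ f x)
    (hg : DifferentiableAt ℝ g x) :
    ∇ (fun y => f y * g y) x = f x • ∇ g x + g x • ∇ f x := by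
  simp only [gradient, fderiv_fun_mul hf hg, map_add, map_smul]

theorem gradient_fun_sum {ι : Type*} (s : Finset ι) {f : ι → E d → ℝ} {x : E d}
    (hf : ∀ i ∈ s, DifferentiableAt ℝ (f i) x) :
    ∇ (fun y => ∑ i ∈ s, f i y) x = ∑ i ∈ s, ∇ (f i) x := by
  simp only [gradient, fderiv_fun_sum hf, map_sum]

/-- On a bounded Lipschitz domain, smooth functions are dense in `H¹`. -/
theorem exists_contDiff_approx {Ω : Set (E d)} (hΩ : IsOpen Ω) (hb : Bornology.IsBounded Ω)
    (hL : HasLipschitzBoundary Ω) (v : H1 Ω) :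
    ∃ w : ℕ → E d → ℝ, (∀ k, ContDiff ℝ ∞ (w k)) ∧ (∀ k, HasCompactSupport (w k)) ∧
      Tendsto (fun k => eLpNorm (w k - fn v) 2 (volume.restrict Ω)) atTop (𝓝 0) ∧
      Tendsto (fun k => eLpNorm (∇ (w k) - wgrad v) 2 (volume.restrict Ω)) atTop (𝓝 0) := by
  have hΩm := hΩ.measurableSet
  have hcpt : IsCompact (closure Ω) := hb.isCompact_closure
  have hvm : StronglyMeasurable (fn v) := Lp.stronglyMeasurable _
  have hGm : StronglyMeasurable (wgrad v) := Lp.stronglyMeasurable _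
  choose! ρ hρ c hc e δ₀ hδ₀ hcone using fun x (hx : x ∈ closure Ω) => hL.exists_cone hΩ hx
  obtain ⟨t, ht, hcov⟩ := hcpt.elim_nhds_subcover (fun x => Metric.ball x (ρ x))
    fun x hx => Metric.ball_mem_nhds x (hρ x hx)
  let U : t → Set (E d) := fun x => Metric.ball x.1 (ρ x.1)
  have hUo : ∀ x, IsOpen (U x) := fun _ => Metric.isOpen_ball
  obtain ⟨ζ, hζ⟩ := SmoothPartitionOfUnity.exists_isSubordinate (modelWithCornersSelf ℝ (E d))
    isClosed_closure U hUo (by simpa [U, iUnion_subtype] using hcov)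
  have hζd : ∀ j, ContDiff ℝ ∞ (ζ j) := fun j => (ζ j).contMDiff.contDiff
  have hζc : ∀ j, HasCompactSupport (ζ j) := fun j =>
    HasCompactSupport.of_support_subset_isCompact (isCompact_closedBall j.1 (ρ j.1))
      ((subset_tsupport _).trans ((hζ j).trans Metric.ball_subset_closedBall))
  have hζ1 : ∀ j x, ‖ζ j x‖ ≤ 1 := fun j x => by
    rw [Real.norm_of_nonneg (ζ.nonneg j x)]; exact ζ.le_one j x
  have hsum : ∀ x ∈ closure Ω, ∑ j, ζ j x = 1 := fun x hx => by
    rw [← finsum_eq_sum_of_fintype]; exact ζ.sum_eq_one hx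
  have hgc : ∀ j, Continuous (∇ (ζ j : E d → ℝ)) := fun j =>
    (InnerProductSpace.toDual ℝ (E d)).symm.continuous.comp
      ((hζd j).continuous_fderiv (by simp))
  have hgcs : ∀ j, HasCompactSupport (∇ (ζ j : E d → ℝ)) := fun j =>
    ((hζc j).fderiv (𝕜 := ℝ)).comp_left (g := (InnerProductSpace.toDual ℝ (E d)).symm)
      (map_zero _)
  have hbd : ∀ j, ∃ C, ∀ x, ‖∇ (ζ j : E d → ℝ) x‖ ≤ C := fun j =>
    (hgcs j).exists_bound_of_continuous (hgc j)
  choose C hC using hbd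
  have hzero : ∀ j x, x ∉ U j → ζ j x = 0 := fun j x hx =>
    image_eq_zero_of_notMem_tsupport fun h => hx (hζ j h)
  have hgzero : ∀ j x, x ∉ U j → ∇ (ζ j : E d → ℝ) x = 0 := fun j x hx => by
    have : fderiv ℝ (ζ j) x = 0 := by
      by_contra hne
      exact hx (hζ j (support_fderiv_subset ℝ hne))
    simp [gradient, this]
  -- Since ∑ ζⱼ = 1 near x, the terms v∇ζⱼ cancel, and ∇ζⱼ multiplies only the errors wⱼ − v.
  have hgsum : ∀ x ∈ Ω, ∑ j, ∇ (ζ j : E d → ℝ) x = 0 := by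
    intro x hx
    rw [← gradient_fun_sum Finset.univ fun j _ => (hζd j).differentiable (by simp) x]
    have : (fun y => ∑ j, ζ j y) =ᶠ[𝓝 x] fun _ => 1 := by
      filter_upwards [hΩ.mem_nhds hx] with y hy using hsum y (subset_closure hy)
    rw [this.gradient_eq, gradient_fun_const]
  have happrox := fun j : t => exists_contDiff_approx_of_cone hΩ hvm hGm (Lp.memLp v.1.1)
    (Lp.memLp v.1.2) v.2 (hc _ (ht j.1 j.2)) (hδ₀ _ (ht j.1 j.2)) (hcone _ (ht j.1 j.2)) (hUo j)
  choose w hwd hwv hwG using happrox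
  have hwdiff : ∀ j k, Differentiable ℝ (w j k) := fun j k => (hwd j k).differentiable (by simp)
  have hζdiff : ∀ j, Differentiable ℝ (ζ j) := fun j => (hζd j).differentiable (by simp)
  have hgw : ∀ j k, Continuous (∇ (w j k)) := fun j k =>
    (InnerProductSpace.toDual ℝ (E d)).symm.continuous.comp
      ((hwd j k).continuous_fderiv (by simp))
  refine ⟨fun k x => ∑ j, ζ j x * w j k x, fun k => ContDiff.sum fun j _ =>
    (hζd j).mul (hwd j k), fun k => ?_, ?_, ?_⟩
  · have : IsCompact (⋃ j : t, Metric.closedBall j.1 (ρ j.1)) :=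
      isCompact_iUnion fun j => isCompact_closedBall _ _
    refine HasCompactSupport.of_support_subset_isCompact this fun x hx => ?_
    by_contra hne
    apply hx
    refine Finset.sum_eq_zero fun j _ => ?_
    rw [hzero j x fun h => hne (mem_iUnion.2 ⟨j, Metric.ball_subset_closedBall h⟩), zero_mul]
  · have hle : ∀ k, eLpNorm ((fun x => ∑ j, ζ j x * w j k x) - fn v) 2 (volume.restrict Ω)
        ≤ ∑ j, ENNReal.ofReal 1 * eLpNorm (w j k - fn v) 2 (volume.restrict (Ω ∩ U j)) := by
      intro k
      have h1 : (fun x => ∑ j, ζ j x * w j k x) - fn v =ᵐ[volume.restrict Ω]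
          ∑ j, fun x => ζ j x * (w j k x - fn v x) := by
        filter_upwards [ae_restrict_mem hΩm] with x hx
        simp only [Pi.sub_apply, Finset.sum_apply, mul_sub, Finset.sum_sub_distrib]
        rw [← Finset.sum_mul, hsum x (subset_closure hx), one_mul]
      rw [eLpNorm_congr_ae h1]
      refine (eLpNorm_sum_le (fun j _ => ?_) (by norm_num)).trans
        (Finset.sum_le_sum fun j _ => ?_)
      · exact (((hζd j).continuous.stronglyMeasurable).mul
          ((hwd j k).continuous.stronglyMeasurable.sub hvm)).aestronglyMeasurable
      · refine eLpNorm_restrict_le_of_norm_le (hUo j).measurableSet (fun x _ _ => ?_)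
          (fun x hx => by rw [hzero j x hx, zero_mul]) hΩm
        rw [norm_mul]
        exact mul_le_mul_of_nonneg_right (hζ1 j x) (norm_nonneg _)
    refine tendsto_of_tendsto_of_tendsto_of_le_of_le tendsto_const_nhds ?_
      (fun _ => zero_le) hle
    rw [show (0 : ℝ≥0∞) = ∑ j : t, ENNReal.ofReal 1 * 0 by simp]
    exact tendsto_finsetSum _ fun j _ => ENNReal.Tendsto.const_mul (hwv j) (by simp)
  · have hle : ∀ k, eLpNorm (∇ (fun x => ∑ j, ζ j x * w j k x) - wgrad v) 2 (volume.restrict Ω)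
        ≤ ∑ j, (ENNReal.ofReal 1 * eLpNorm (∇ (w j k) - wgrad v) 2 (volume.restrict (Ω ∩ U j)) +
          ENNReal.ofReal (C j) * eLpNorm (w j k - fn v) 2 (volume.restrict (Ω ∩ U j))) := by
      intro k
      have h1 : ∇ (fun x => ∑ j, ζ j x * w j k x) - wgrad v =ᵐ[volume.restrict Ω]
          ∑ j, ((fun x => ζ j x • (∇ (w j k) x - wgrad v x)) +
            fun x => (w j k x - fn v x) • ∇ (ζ j : E d → ℝ) x) := by
        filter_upwards [ae_restrict_mem hΩm] with x hx
        simp only [Pi.sub_apply, Finset.sum_apply, Pi.add_apply, smul_sub, sub_smul,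
          Finset.sum_add_distrib, Finset.sum_sub_distrib]
        rw [← Finset.sum_smul, hsum x (subset_closure hx), one_smul, ← Finset.smul_sum,
          hgsum x hx, smul_zero, sub_zero,
          gradient_fun_sum Finset.univ (f := fun j x => ζ j x * w j k x)
            fun j _ => (hζdiff j x).mul (hwdiff j k x)]
        simp_rw [gradient_fun_mul (hζdiff _ x) (hwdiff _ k x), Finset.sum_add_distrib]
        abel
      rw [eLpNorm_congr_ae h1]
      have m1 : ∀ j, AEStronglyMeasurable (fun x => ζ j x • (∇ (w j k) x - wgrad v x))
          (volume.restrict Ω) := fun j =>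
        ((hζd j).continuous.stronglyMeasurable.smul
          ((hgw j k).stronglyMeasurable.sub hGm)).aestronglyMeasurable
      have m2 : ∀ j, AEStronglyMeasurable (fun x => (w j k x - fn v x) • ∇ (ζ j : E d → ℝ) x)
          (volume.restrict Ω) := fun j =>
        (((hwd j k).continuous.stronglyMeasurable.sub hvm).smul
          (hgc j).stronglyMeasurable).aestronglyMeasurable
      refine (eLpNorm_sum_le (fun j _ => (m1 j).add (m2 j)) (by norm_num)).trans
        (Finset.sum_le_sum fun j _ => ?_)
      refine (eLpNorm_add_le (m1 j) (m2 j) (by norm_num)).trans (add_le_add ?_ ?_)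
      · refine eLpNorm_restrict_le_of_norm_le (hUo j).measurableSet (fun x _ _ => ?_)
          (fun x hx => by rw [hzero j x hx, zero_smul]) hΩm
        rw [norm_smul]
        exact mul_le_mul_of_nonneg_right (hζ1 j x) (norm_nonneg _)
      · refine eLpNorm_restrict_le_of_norm_le (hUo j).measurableSet (fun x _ _ => ?_)
          (fun x hx => by rw [hgzero j x hx, smul_zero]) hΩm
        rw [norm_smul, mul_comm]
        exact mul_le_mul_of_nonneg_right (hC j x) (norm_nonneg _)
    refine tendsto_of_tendsto_of_tendsto_of_le_of_le tendsto_const_nhds ?_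
      (fun _ => zero_le) hle
    rw [show (0 : ℝ≥0∞) = ∑ j : t, (ENNReal.ofReal 1 * 0 + ENNReal.ofReal (C j) * 0) by simp]
    exact tendsto_finsetSum _ fun j _ =>
      (ENNReal.Tendsto.const_mul (hwG j) (by simp)).add
        (ENNReal.Tendsto.const_mul (hwv j) (by simp))

end Density

end StericPNP

namespace StericPNP

/-! ### Limits of products; stability of weak gradients -/

section Limits

variable {α F G H : Type*} [MeasurableSpace α] {μ : Measure α} [NormedAddCommGroup F]
  [NormedSpace ℝ F] [NormedAddCommGroup G] [NormedSpace ℝ G] [NormedAddCommGroup H]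
  [NormedSpace ℝ H] {p q : ℝ≥0∞}

theorem eLpNorm_bilin_le [p.HolderTriple q 1] (B : F →L[ℝ] G →L[ℝ] H) {f : α → F} {g : α → G}
    (hf : AEStronglyMeasurable f μ) (hg : AEStronglyMeasurable g μ) :
    eLpNorm (fun x => B (f x) (g x)) 1 μ ≤ ‖B‖₊ * (eLpNorm f p μ * eLpNorm g q μ) := by
  rw [← mul_assoc]
  exact eLpNorm_le_eLpNorm_mul_eLpNorm_of_nnnorm hf hg (fun x y => B x y) ‖B‖₊
    (.of_forall fun x => B.le_opNorm₂ (f x) (g x))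

/-- Hölder applied to B(fₙ−f₀, gₙ) + B(f₀, gₙ−g₀). Stating it for a bounded bilinear map covers
products, scalar multiples and inner products at once. -/
theorem tendsto_eLpNorm_bilin [p.HolderTriple q 1] (hp : 1 ≤ p) (hq : 1 ≤ q)
    (B : F →L[ℝ] G →L[ℝ] H) {f : ℕ → α → F}
    {f₀ : α → F} {g : ℕ → α → G} {g₀ : α → G} (hf : ∀ n, AEStronglyMeasurable (f n) μ)
    (hg : ∀ n, AEStronglyMeasurable (g n) μ) (hf₀ : MemLp f₀ p μ) (hg₀ : MemLp g₀ q μ)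
    (hfl : Tendsto (fun n => eLpNorm (f n - f₀) p μ) atTop (𝓝 0))
    (hgl : Tendsto (fun n => eLpNorm (g n - g₀) q μ) atTop (𝓝 0)) :
    Tendsto (fun n => eLpNorm ((fun x => B (f n x) (g n x)) - fun x => B (f₀ x) (g₀ x)) 1 μ)
      atTop (𝓝 0) := by
  have hle : ∀ n, eLpNorm ((fun x => B (f n x) (g n x)) - fun x => B (f₀ x) (g₀ x)) 1 μ ≤
      ‖B‖₊ * (eLpNorm (f n - f₀) p μ * (eLpNorm (g n - g₀) q μ + eLpNorm g₀ q μ)) +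
        ‖B‖₊ * (eLpNorm f₀ p μ * eLpNorm (g n - g₀) q μ) := by
    intro n
    have h1 : ((fun x => B (f n x) (g n x)) - fun x => B (f₀ x) (g₀ x)) =
        (fun x => B ((f n - f₀) x) (g n x)) + fun x => B (f₀ x) ((g n - g₀) x) := by
      ext x; simp
    have hfs := (hf n).sub hf₀.1
    have hgs := (hg n).sub hg₀.1
    have m1 : AEStronglyMeasurable (fun x => B ((f n - f₀) x) (g n x)) μ :=
      B.aestronglyMeasurable_comp₂ hfs (hg n)
    have m2 : AEStronglyMeasurable (fun x => B (f₀ x) ((g n - g₀) x)) μ :=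
      B.aestronglyMeasurable_comp₂ hf₀.1 hgs
    rw [h1]
    refine (eLpNorm_add_le m1 m2 le_rfl).trans (add_le_add ?_ ?_)
    · refine (eLpNorm_bilin_le (p := p) (q := q) B hfs (hg n)).trans ?_
      gcongr
      calc eLpNorm (g n) q μ = eLpNorm ((g n - g₀) + g₀) q μ := by rw [sub_add_cancel]
        _ ≤ _ := eLpNorm_add_le hgs hg₀.1 hq
    · exact eLpNorm_bilin_le B hf₀.1 hgs
  refine tendsto_of_tendsto_of_tendsto_of_le_of_le tendsto_const_nhds ?_ (fun _ => zero_le) hle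
  have e1 : Tendsto (fun n => ‖B‖₊ * (eLpNorm (f n - f₀) p μ *
      (eLpNorm (g n - g₀) q μ + eLpNorm g₀ q μ))) atTop (𝓝 (‖B‖₊ * (0 * (0 + eLpNorm g₀ q μ)))) :=
    ENNReal.Tendsto.const_mul (ENNReal.Tendsto.mul hfl (Or.inr (by simpa using hg₀.2.ne))
      (hgl.add tendsto_const_nhds) (Or.inr (by simp))) (Or.inr (by simp))
  have e2 : Tendsto (fun n => ‖B‖₊ * (eLpNorm f₀ p μ * eLpNorm (g n - g₀) q μ)) atTop
      (𝓝 (‖B‖₊ * (eLpNorm f₀ p μ * 0))) :=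
    ENNReal.Tendsto.const_mul (ENNReal.Tendsto.const_mul hgl (Or.inr hf₀.2.ne))
      (Or.inr (by simp))
  simpa using e1.add e2

/-- A product of an `L^p`-convergent sequence with a dominated a.e. convergent one converges
in `L¹`. -/
theorem tendsto_eLpNorm_bilin_of_dominated [p.HolderTriple q 1] (hp : 1 ≤ p)
    (B : F →L[ℝ] G →L[ℝ] H) {f : ℕ → α → F}
    {f₀ : α → F} {g : ℕ → α → G} {g₀ : α → G} (hf : ∀ n, AEStronglyMeasurable (f n) μ)
    (hg : ∀ n, AEStronglyMeasurable (g n) μ) (hf₀ : MemLp f₀ p μ)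
    (hfl : Tendsto (fun n => eLpNorm (f n - f₀) p μ) atTop (𝓝 0))
    {D : α → ℝ} (hD : MemLp D q μ) (hgD : ∀ n, ∀ᵐ x ∂μ, ‖g n x‖ ≤ D x)
    (hgl : ∀ᵐ x ∂μ, Tendsto (fun n => g n x) atTop (𝓝 (g₀ x))) :
    Tendsto (fun n => eLpNorm ((fun x => B (f n x) (g n x)) - fun x => B (f₀ x) (g₀ x)) 1 μ)
      atTop (𝓝 0) := by
  have hg₀m : AEStronglyMeasurable g₀ μ := aestronglyMeasurable_of_tendsto_ae _ hg hgl
  have hle : ∀ n, eLpNorm ((fun x => B (f n x) (g n x)) - fun x => B (f₀ x) (g₀ x)) 1 μ ≤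
      ‖B‖₊ * (eLpNorm (f n - f₀) p μ * eLpNorm D q μ) +
        eLpNorm ((fun x => B (f₀ x) (g n x)) - fun x => B (f₀ x) (g₀ x)) 1 μ := by
    intro n
    have h1 : ((fun x => B (f n x) (g n x)) - fun x => B (f₀ x) (g₀ x)) =
        (fun x => B ((f n - f₀) x) (g n x)) +
          ((fun x => B (f₀ x) (g n x)) - fun x => B (f₀ x) (g₀ x)) := by
      ext x; simp
    have hfs := (hf n).sub hf₀.1
    have m1 : AEStronglyMeasurable (fun x => B ((f n - f₀) x) (g n x)) μ :=
      B.aestronglyMeasurable_comp₂ hfs (hg n)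
    rw [h1]
    refine (eLpNorm_add_le m1 ((B.aestronglyMeasurable_comp₂ hf₀.1 (hg n)).sub
      (B.aestronglyMeasurable_comp₂ hf₀.1 hg₀m)) le_rfl).trans (add_le_add ?_ le_rfl)
    refine (eLpNorm_bilin_le (p := p) (q := q) B hfs (hg n)).trans ?_
    gcongr
    exact eLpNorm_mono_ae_real (hgD n)
  refine tendsto_of_tendsto_of_tendsto_of_le_of_le tendsto_const_nhds ?_ (fun _ => zero_le) hle
  have e1 : Tendsto (fun n => ‖B‖₊ * (eLpNorm (f n - f₀) p μ * eLpNorm D q μ)) atTop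
      (𝓝 (‖B‖₊ * (0 * eLpNorm D q μ))) :=
    ENNReal.Tendsto.const_mul (ENNReal.Tendsto.mul_const hfl (Or.inr hD.2.ne)) (Or.inr (by simp))
  have hbi : Integrable (fun x => ‖B‖ * (‖f₀ x‖ * D x)) μ :=
    (memLp_one_iff_integrable.1 (hD.mul hf₀.norm)).const_mul _
  -- With the first factor frozen at f₀, dominated convergence applies. No convergence of `g n` in
  -- L^q is needed, which is essential for q = ∞.
  have e2 : Tendsto (fun n => eLpNorm ((fun x => B (f₀ x) (g n x)) - fun x => B (f₀ x) (g₀ x))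
      1 μ) atTop (𝓝 0) := by
    simp_rw [eLpNorm_one_eq_lintegral_enorm]
    have := tendsto_lintegral_norm_of_dominated_convergence (μ := μ)
      (F := fun n x => B (f₀ x) (g n x)) (f := fun x => B (f₀ x) (g₀ x))
      (fun n => B.aestronglyMeasurable_comp₂ hf₀.1 (hg n)) hbi.2 (fun n => by
        filter_upwards [hgD n] with x hx
        calc _ ≤ ‖B‖ * ‖f₀ x‖ * ‖g n x‖ := B.le_opNorm₂ _ _
          _ ≤ ‖B‖ * (‖f₀ x‖ * D x) := by
            rw [mul_assoc]; gcongr) (by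
        filter_upwards [hgl] with x hx
        exact ((B (f₀ x)).continuous.tendsto _).comp hx)
    simpa only [ofReal_norm, Pi.sub_apply] using this
  simpa using e1.add e2

theorem tendsto_eLpNorm_of_le_of_finite [IsFiniteMeasure μ] (hpq : p ≤ q) {f : ℕ → α → F}
    (hf : ∀ n, AEStronglyMeasurable (f n) μ)
    (h : Tendsto (fun n => eLpNorm (f n) q μ) atTop (𝓝 0)) (hp : 1 ≤ p) (hq : q ≠ ⊤) :
    Tendsto (fun n => eLpNorm (f n) p μ) atTop (𝓝 0) := by
  refine tendsto_of_tendsto_of_tendsto_of_le_of_le tendsto_const_nhds ?_ (fun _ => zero_le)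
    fun n => eLpNorm_le_eLpNorm_mul_rpow_measure_univ hpq (hf n)
  have hpr : 0 < p.toReal := ENNReal.toReal_pos (one_pos.trans_le hp).ne' (ne_top_of_le_ne_top hq hpq)
  have hle : p.toReal ≤ q.toReal := ENNReal.toReal_mono hq hpq
  have hne : (μ univ) ^ (1 / p.toReal - 1 / q.toReal) ≠ ⊤ :=
    (ENNReal.rpow_lt_top_of_nonneg (by
      rw [sub_nonneg]; exact one_div_le_one_div_of_le hpr hle) (measure_ne_top _ _)).ne
  simpa using ENNReal.Tendsto.mul_const h (Or.inr hne)

theorem exists_subseq_tendsto_ae (hp : p ≠ 0) {f : ℕ → α → F} {g : α → F}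
    (hf : ∀ n, AEStronglyMeasurable (f n) μ) (hg : AEStronglyMeasurable g μ)
    (h : Tendsto (fun n => eLpNorm (f n - g) p μ) atTop (𝓝 0)) :
    ∃ ns : ℕ → ℕ, StrictMono ns ∧ ∀ᵐ x ∂μ, Tendsto (fun i => f (ns i) x) atTop (𝓝 (g x)) :=
  (tendstoInMeasure_of_tendsto_eLpNorm hp hf hg h).exists_seq_tendsto_ae

end Limits

section Calculus

variable {d : ℕ} {Ω : Set (E d)}

theorem HasWeakGradient.congr {f f' : E d → ℝ} {G G' : E d → E d} (h : HasWeakGradient Ω f G)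
    (hf : f =ᵐ[volume.restrict Ω] f') (hG : G =ᵐ[volume.restrict Ω] G') :
    HasWeakGradient Ω f' G' := by
  intro φ h1 h2 h3
  rw [← integral_congr_ae (f := fun x => f x • ∇ φ x) (g := fun x => f' x • ∇ φ x) (hf.mono fun x hx => by simp only [hx]),
    ← integral_congr_ae (f := fun x => φ x • G x) (g := fun x => φ x • G' x) (hG.mono fun x hx => by simp only [hx])]
  exact h φ h1 h2 h3

theorem continuous_gradient {f : E d → ℝ} (hf : ContDiff ℝ 1 f) : Continuous (∇ f) :=
  (InnerProductSpace.toDual ℝ (E d)).symm.continuous.comp (hf.continuous_fderiv (by simp))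

theorem hasCompactSupport_gradient {f : E d → ℝ} (hf : HasCompactSupport f) :
    HasCompactSupport (∇ f) :=
  (hf.fderiv (𝕜 := ℝ)).comp_left (g := (InnerProductSpace.toDual ℝ (E d)).symm) (map_zero _)

theorem support_gradient_subset (f : E d → ℝ) : Function.support (∇ f) ⊆ tsupport f := by
  intro x hx
  apply support_fderiv_subset ℝ
  intro h0
  exact hx (by simp [gradient, h0])

/-- The test function and its gradient vanish off Ω, so both integrals run over the whole space; Ω
may be arbitrary and classical integration by parts applies. -/
theorem hasWeakGradient_of_contDiff {f : E d → ℝ} (hf : ContDiff ℝ 1 f) :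
    HasWeakGradient Ω f (∇ f) := by
  intro φ hφ hc hs
  have hφ1 : ContDiff ℝ 1 φ := hφ.of_le (by simp)
  have hz : ∀ x, x ∉ Ω → φ x = 0 := fun x hx => image_eq_zero_of_notMem_tsupport fun h => hx (hs h)
  have hz' : ∀ x, x ∉ Ω → ∇ φ x = 0 := fun x hx => by
    by_contra hne
    exact hx (hs (support_gradient_subset φ hne))
  rw [setIntegral_eq_integral_of_forall_compl_eq_zero fun x hx => by rw [hz' x hx, smul_zero],
    setIntegral_eq_integral_of_forall_compl_eq_zero fun x hx => by rw [hz x hx, zero_smul]]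
  have i1 : Integrable (fun x => f x • ∇ φ x) volume :=
    (hf.continuous.smul (continuous_gradient hφ1)).integrable_of_hasCompactSupport
      (hasCompactSupport_gradient hc).smul_left
  have i2 : Integrable (fun x => φ x • ∇ f x) volume :=
    (hφ1.continuous.smul (continuous_gradient hf)).integrable_of_hasCompactSupport hc.smul_right
  refine ext_inner_left ℝ fun e => ?_
  rw [inner_neg_right, ← integral_inner i1, ← integral_inner i2]
  have j1 := i1.const_inner (𝕜 := ℝ) e
  have j2 := i2.const_inner (𝕜 := ℝ) e
  have k1 : ∀ x, ⟪e, f x • ∇ φ x⟫_ℝ = f x * fderiv ℝ φ x e := fun x => by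
    rw [inner_smul_right, real_inner_comm, inner_gradient_left]
  have k2 : ∀ x, ⟪e, φ x • ∇ f x⟫_ℝ = fderiv ℝ f x e * φ x := fun x => by
    rw [inner_smul_right, real_inner_comm, inner_gradient_left, mul_comm]
  simp only [k1, k2] at j1 j2 ⊢
  refine integral_mul_fderiv_eq_neg_fderiv_mul_of_integrable j2 j1 ?_
    (fun x _ => (hf.differentiable (by simp)) x) (fun x _ => (hφ1.differentiable (by simp)) x)
  exact (hf.continuous.mul hφ1.continuous).integrable_of_hasCompactSupport hc.mul_left

/-- Test functions have bounded values and gradients, so L¹ convergence suffices. This matters for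
the product rule, where the limit gradient is only a sum of products of L² functions. -/
theorem hasWeakGradient_of_tendsto {f : ℕ → E d → ℝ} {G : ℕ → E d → E d} {f₀ : E d → ℝ}
    {G₀ : E d → E d} (h : ∀ n, HasWeakGradient Ω (f n) (G n))
    (hf : ∀ n, AEStronglyMeasurable (f n) (volume.restrict Ω))
    (hG : ∀ n, AEStronglyMeasurable (G n) (volume.restrict Ω))
    (hf₀ : MemLp f₀ 1 (volume.restrict Ω)) (hG₀ : MemLp G₀ 1 (volume.restrict Ω))
    (hfl : Tendsto (fun n => eLpNorm (f n - f₀) 1 (volume.restrict Ω)) atTop (𝓝 0))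
    (hGl : Tendsto (fun n => eLpNorm (G n - G₀) 1 (volume.restrict Ω)) atTop (𝓝 0)) :
    HasWeakGradient Ω f₀ G₀ := by
  intro φ hφ hc hs
  have hφ1 : ContDiff ℝ 1 φ := hφ.of_le (by simp)
  have m1 : MemLp (∇ φ) ⊤ (volume.restrict Ω) :=
    (continuous_gradient hφ1).memLp_top_of_hasCompactSupport (hasCompactSupport_gradient hc) _
  have m2 : MemLp φ ⊤ (volume.restrict Ω) := hφ1.continuous.memLp_top_of_hasCompactSupport hc _
  have t1 := tendsto_eLpNorm_bilin (p := 1) (q := ⊤) le_rfl (by simp)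
    (ContinuousLinearMap.lsmul ℝ ℝ (E := E d)) hf (fun _ => m1.1) hf₀ m1 hfl
    (by simp)
  have t2 := tendsto_eLpNorm_bilin (p := 1) (q := ⊤) le_rfl (by simp)
    (ContinuousLinearMap.lsmul ℝ ℝ (E := E d)).flip hG (fun _ => m2.1) hG₀ m2 hGl
    (by simp)
  have ev : ∀ {X : Type} [NormedAddCommGroup X] {u : ℕ → E d → X} {u₀ : E d → X},
      (∀ n, AEStronglyMeasurable (u n) (volume.restrict Ω)) → MemLp u₀ 1 (volume.restrict Ω) →
      Tendsto (fun n => eLpNorm (u n - u₀) 1 (volume.restrict Ω)) atTop (𝓝 0) →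
      ∀ᶠ n in atTop, Integrable (u n) (volume.restrict Ω) := by
    intro X _ u u₀ hu hu₀ ht
    filter_upwards [ht.eventually (gt_mem_nhds one_pos)] with n hn
    have : MemLp (u n - u₀) 1 (volume.restrict Ω) := ⟨(hu n).sub hu₀.1, hn.trans (by simp)⟩
    have := this.add hu₀
    rw [sub_add_cancel] at this
    exact memLp_one_iff_integrable.1 this
  have a1 := fun n => (ContinuousLinearMap.lsmul ℝ ℝ (E := E d)).aestronglyMeasurable_comp₂
    (hf n) m1.1
  have a2 := fun n => (ContinuousLinearMap.lsmul ℝ ℝ (E := E d)).flip.aestronglyMeasurable_comp₂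
    (hG n) m2.1
  have b1 : MemLp (fun x => f₀ x • ∇ φ x) 1 (volume.restrict Ω) := m1.smul hf₀
  have b2 : MemLp (fun x => φ x • G₀ x) 1 (volume.restrict Ω) := hG₀.smul m2
  have l1 := tendsto_integral_of_L1' _ b1.1 (ev a1 b1 t1) t1
  have l2 := tendsto_integral_of_L1' _ b2.1 (ev a2 b2 t2) t2
  refine tendsto_nhds_unique (l1.congr fun n => ?_) l2.neg
  exact h n φ hφ hc hs

end Calculus

end StericPNP

namespace StericPNP

/-! ### Elements of `W^{1,p}`; chain and product rules -/

section SobolevElements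

variable {d : ℕ} {Ω : Set (E d)} {p : ℝ≥0∞} [Fact (1 ≤ p)]

theorem fn_memLp (v : W1 Ω p) : MemLp (fn v) p (volume.restrict Ω) := Lp.memLp v.1.1

theorem wgrad_memLp (v : W1 Ω p) : MemLp (wgrad v) p (volume.restrict Ω) := Lp.memLp v.1.2

theorem fn_add (v w : W1 Ω p) : fn (v + w) =ᵐ[volume.restrict Ω] fn v + fn w :=
  Lp.coeFn_add v.1.1 w.1.1

theorem wgrad_add (v w : W1 Ω p) : wgrad (v + w) =ᵐ[volume.restrict Ω] wgrad v + wgrad w :=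
  Lp.coeFn_add v.1.2 w.1.2

theorem fn_sub (v w : W1 Ω p) : fn (v - w) =ᵐ[volume.restrict Ω] fn v - fn w :=
  Lp.coeFn_sub v.1.1 w.1.1

theorem wgrad_sub (v w : W1 Ω p) : wgrad (v - w) =ᵐ[volume.restrict Ω] wgrad v - wgrad w :=
  Lp.coeFn_sub v.1.2 w.1.2

theorem fn_smul (c : ℝ) (v : W1 Ω p) : fn (c • v) =ᵐ[volume.restrict Ω] c • fn v :=
  Lp.coeFn_smul c v.1.1

theorem wgrad_smul (c : ℝ) (v : W1 Ω p) : wgrad (c • v) =ᵐ[volume.restrict Ω] c • wgrad v :=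
  Lp.coeFn_smul c v.1.2

theorem exists_W1 {f : E d → ℝ} {G : E d → E d} (hf : MemLp f p (volume.restrict Ω))
    (hG : MemLp G p (volume.restrict Ω)) (h : HasWeakGradient Ω f G) :
    ∃ v : W1 Ω p, fn v =ᵐ[volume.restrict Ω] f ∧ wgrad v =ᵐ[volume.restrict Ω] G :=
  ⟨⟨(hf.toLp, hG.toLp), h.congr hf.coeFn_toLp.symm hG.coeFn_toLp.symm⟩,
    hf.coeFn_toLp, hG.coeFn_toLp⟩

theorem hasWeakGradient_fn (v : W1 Ω p) : HasWeakGradient Ω (fn v) (wgrad v) := v.2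

theorem exists_W1_of_contDiff {f : E d → ℝ} (hf : ContDiff ℝ 1 f) (hc : HasCompactSupport f) :
    ∃ v : W1 Ω p, fn v =ᵐ[volume.restrict Ω] f ∧ wgrad v =ᵐ[volume.restrict Ω] ∇ f :=
  exists_W1 (hf.continuous.memLp_of_hasCompactSupport hc)
    ((continuous_gradient hf).memLp_of_hasCompactSupport (hasCompactSupport_gradient hc))
    (hasWeakGradient_of_contDiff hf)

theorem exists_W1_const [IsFiniteMeasure (volume.restrict Ω)] (c : ℝ) :
    ∃ v : W1 Ω p, fn v =ᵐ[volume.restrict Ω] (fun _ => c) ∧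
      wgrad v =ᵐ[volume.restrict Ω] fun _ => 0 :=
  exists_W1 (memLp_const c) MemLp.zero (by
    have h := hasWeakGradient_of_contDiff (Ω := Ω) (contDiff_const (c := c) (n := 1))
    have h0 : ∇ (fun _ : E d => c) = fun _ => 0 := by ext1 x; exact gradient_fun_const x c
    rwa [h0] at h)

/-- The fundamental lemma of the calculus of variations for G − G'. It identifies ∇u with 2√u ∇√u
below. -/
theorem HasWeakGradient.unique {f : E d → ℝ} {G G' : E d → E d} (hΩ : IsOpen Ω)
    (hG : Integrable G (volume.restrict Ω)) (hG' : Integrable G' (volume.restrict Ω))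
    (h : HasWeakGradient Ω f G) (h' : HasWeakGradient Ω f G') : G =ᵐ[volume.restrict Ω] G' := by
  have hl : LocallyIntegrableOn (fun x => G x - G' x) Ω volume :=
    IntegrableOn.locallyIntegrableOn (hG.sub hG')
  have := hΩ.ae_eq_zero_of_integral_contDiff_smul_eq_zero hl fun φ hφ hc hs => by
    have hz : ∀ x, x ∉ Ω → φ x = 0 := fun x hx =>
      image_eq_zero_of_notMem_tsupport fun h => hx (hs h)
    have m2 : MemLp φ ⊤ (volume.restrict Ω) := hφ.continuous.memLp_top_of_hasCompactSupport hc _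
    have i1 : Integrable (fun x => φ x • G x) (volume.restrict Ω) := by
      rw [← memLp_one_iff_integrable] at hG ⊢; exact hG.smul m2
    have i2 : Integrable (fun x => φ x • G' x) (volume.restrict Ω) := by
      rw [← memLp_one_iff_integrable] at hG' ⊢; exact hG'.smul m2
    rw [← setIntegral_eq_integral_of_forall_compl_eq_zero (s := Ω)
      fun x hx => by rw [hz x hx, zero_smul]]
    simp_rw [smul_sub]
    rw [integral_sub i1 i2, sub_eq_zero, ← neg_inj, ← h φ hφ hc hs, ← h' φ hφ hc hs]
  rw [EventuallyEq, ae_restrict_iff' hΩ.measurableSet]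
  filter_upwards [this] with x hx hxΩ using sub_eq_zero.1 (hx hxΩ)

end SobolevElements

section ChainRule

variable {d : ℕ} {Ω : Set (E d)}

theorem isFiniteMeasure_restrict_of_isBounded (hb : Bornology.IsBounded Ω) :
    IsFiniteMeasure ((volume : Measure (E d)).restrict Ω) :=
  ⟨by rw [Measure.restrict_apply_univ]; exact hb.measure_lt_top⟩

theorem exists_contDiff_approx_ae (hΩ : IsOpen Ω) (hb : Bornology.IsBounded Ω)
    (hL : HasLipschitzBoundary Ω) (v : H1 Ω) :
    ∃ w : ℕ → E d → ℝ, (∀ k, ContDiff ℝ ∞ (w k)) ∧ (∀ k, HasCompactSupport (w k)) ∧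
      Tendsto (fun k => eLpNorm (w k - fn v) 2 (volume.restrict Ω)) atTop (𝓝 0) ∧
      Tendsto (fun k => eLpNorm (∇ (w k) - wgrad v) 2 (volume.restrict Ω)) atTop (𝓝 0) ∧
      ∀ᵐ x ∂(volume.restrict Ω), Tendsto (fun k => w k x) atTop (𝓝 (fn v x)) := by
  obtain ⟨w, h1, h2, h3, h4⟩ := exists_contDiff_approx hΩ hb hL v
  obtain ⟨ns, hns, hae⟩ := exists_subseq_tendsto_ae (by norm_num)
    (fun k => (h1 k).continuous.aestronglyMeasurable) (fn_memLp v).1 h3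
  exact ⟨fun k => w (ns k), fun k => h1 _, fun k => h2 _, h3.comp hns.tendsto_atTop,
    h4.comp hns.tendsto_atTop, hae⟩

theorem gradient_comp {g : ℝ → ℝ} {f : E d → ℝ} {x : E d} (hg : DifferentiableAt ℝ g (f x))
    (hf : DifferentiableAt ℝ f x) : ∇ (fun y => g (f y)) x = deriv g (f x) • ∇ f x := by
  have h := hg.hasDerivAt.comp_hasFDerivAt x hf.hasFDerivAt
  have h2 : fderiv ℝ (fun y => g (f y)) x = deriv g (f x) • fderiv ℝ f x := h.fderiv
  rw [gradient, h2, map_smul, gradient]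

/-- The chain rule for weak gradients. -/
theorem hasWeakGradient_comp (hΩ : IsOpen Ω) (hb : Bornology.IsBounded Ω)
    (hL : HasLipschitzBoundary Ω) (v : H1 Ω) {g : ℝ → ℝ} (hg : ContDiff ℝ 1 g) {K : ℝ}
    (hK : ∀ s, |deriv g s| ≤ K) :
    MemLp (fun x => g (fn v x)) 2 (volume.restrict Ω) ∧
    MemLp (fun x => deriv g (fn v x) • wgrad v x) 2 (volume.restrict Ω) ∧
    HasWeakGradient Ω (fun x => g (fn v x)) (fun x => deriv g (fn v x) • wgrad v x) := by
  have hfin := isFiniteMeasure_restrict_of_isBounded hb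
  have hK0 : 0 ≤ K := (abs_nonneg _).trans (hK 0)
  have hgd : Differentiable ℝ g := hg.differentiable (by simp)
  have hg' : Continuous (deriv g) := hg.continuous_deriv (by simp)
  have hlip : ∀ s t, |g s - g t| ≤ K * |s - t| := fun s t => by
    have := Convex.norm_image_sub_le_of_norm_deriv_le (f := g) (s := univ) (C := K)
      (fun x _ => hgd x) (fun x _ => hK x) convex_univ (mem_univ t) (mem_univ s)
    simpa using this
  have hm1 : AEStronglyMeasurable (fun x => g (fn v x)) (volume.restrict Ω) :=
    hg.continuous.comp_aestronglyMeasurable (fn_memLp v).1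
  have hgm : ∀ {f : E d → ℝ}, AEStronglyMeasurable f (volume.restrict Ω) →
      AEStronglyMeasurable (fun x => deriv g (f x)) (volume.restrict Ω) := fun hf =>
    hg'.comp_aestronglyMeasurable hf
  have M1 : MemLp (fun x => g (fn v x)) 2 (volume.restrict Ω) := by
    have h0 : MemLp (fun x => g (fn v x) - g 0) 2 (volume.restrict Ω) :=
      (fn_memLp v).of_le_mul (c := K) (hm1.sub aestronglyMeasurable_const)
        (.of_forall fun x => by simpa using hlip (fn v x) 0)
    exact (h0.add (memLp_const (g 0))).ae_eq (.of_forall fun x => by simp)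
  have M2 : MemLp (fun x => deriv g (fn v x) • wgrad v x) 2 (volume.restrict Ω) :=
    (wgrad_memLp v).of_le_mul (c := K) ((hgm (fn_memLp v).1).smul (wgrad_memLp v).1)
      (.of_forall fun x => by
        rw [norm_smul]; exact mul_le_mul_of_nonneg_right (hK _) (norm_nonneg _))
  refine ⟨M1, M2, ?_⟩
  obtain ⟨w, hw1, -, hw3, hw4, hw5⟩ := exists_contDiff_approx_ae hΩ hb hL v
  have hw1' : ∀ k, ContDiff ℝ 1 (w k) := fun k => (hw1 k).of_le (by simp)
  have hgr : ∀ k, ∇ (fun y => g (w k y)) = fun x => deriv g (w k x) • ∇ (w k) x := fun k => by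
    ext1 x; exact gradient_comp (hgd _) ((hw1' k).differentiable (by simp) x)
  refine hasWeakGradient_of_tendsto (f := fun k x => g (w k x))
    (G := fun k x => deriv g (w k x) • ∇ (w k) x)
    (fun k => (hgr k) ▸ hasWeakGradient_of_contDiff (hg.comp (hw1' k)))
    (fun k => (hg.comp (hw1' k)).continuous.aestronglyMeasurable)
    (fun k => ((hg'.comp (hw1' k).continuous).smul
      (continuous_gradient (hw1' k))).aestronglyMeasurable)
    (M1.mono_exponent (by norm_num)) (M2.mono_exponent (by norm_num)) ?_ ?_
  · have t1 := tendsto_eLpNorm_of_le_of_finite (p := 1) (q := 2) (by norm_num)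
      (fun k => ((hw1' k).continuous.aestronglyMeasurable.sub (fn_memLp v).1)) hw3 le_rfl
      (by norm_num)
    refine tendsto_of_tendsto_of_tendsto_of_le_of_le tendsto_const_nhds ?_ (fun _ => zero_le)
      fun k => eLpNorm_le_mul_eLpNorm_of_ae_le_mul (c := K) (g := w k - fn v)
        (.of_forall fun x => hlip _ _) 1
    simpa using ENNReal.Tendsto.const_mul t1 (Or.inr ENNReal.ofReal_ne_top)
  · exact tendsto_eLpNorm_bilin_of_dominated (p := 2) (q := 2) (by norm_num)
      (ContinuousLinearMap.lsmul ℝ ℝ (E := E d)).flip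
      (fun k => (continuous_gradient (hw1' k)).aestronglyMeasurable)
      (fun k => (hg'.comp (hw1' k).continuous).aestronglyMeasurable) (wgrad_memLp v) hw4
      (memLp_const K) (fun k => .of_forall fun x => hK _)
      (hw5.mono fun x hx => (hg'.tendsto _).comp hx)

/-- The product rule for weak gradients. -/
theorem hasWeakGradient_mul (hΩ : IsOpen Ω) (hb : Bornology.IsBounded Ω)
    (hL : HasLipschitzBoundary Ω) (v w : H1 Ω) :
    HasWeakGradient Ω (fun x => fn v x * fn w x)
      (fun x => fn v x • wgrad w x + fn w x • wgrad v x) := by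
  obtain ⟨f, hf1, -, hf3, hf4⟩ := exists_contDiff_approx hΩ hb hL v
  obtain ⟨g, hg1, -, hg3, hg4⟩ := exists_contDiff_approx hΩ hb hL w
  have hf1' : ∀ k, ContDiff ℝ 1 (f k) := fun k => (hf1 k).of_le (by simp)
  have hg1' : ∀ k, ContDiff ℝ 1 (g k) := fun k => (hg1 k).of_le (by simp)
  have hgr : ∀ k, ∇ (fun y => f k y * g k y) =
      fun x => f k x • ∇ (g k) x + g k x • ∇ (f k) x := fun k => by
    ext1 x
    exact gradient_fun_mul ((hf1' k).differentiable (by simp) x)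
      ((hg1' k).differentiable (by simp) x)
  have cf := fun k => (hf1' k).continuous.aestronglyMeasurable (μ := volume.restrict Ω)
  have cg := fun k => (hg1' k).continuous.aestronglyMeasurable (μ := volume.restrict Ω)
  have cf' := fun k => (continuous_gradient (hf1' k)).aestronglyMeasurable (μ := volume.restrict Ω)
  have cg' := fun k => (continuous_gradient (hg1' k)).aestronglyMeasurable (μ := volume.restrict Ω)
  have n1 : MemLp (fun x => fn v x • wgrad w x) 1 (volume.restrict Ω) :=
    (wgrad_memLp w).smul (fn_memLp v)
  have n2 : MemLp (fun x => fn w x • wgrad v x) 1 (volume.restrict Ω) :=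
    (wgrad_memLp v).smul (fn_memLp w)
  refine hasWeakGradient_of_tendsto (f := fun k x => f k x * g k x)
    (G := fun k x => f k x • ∇ (g k) x + g k x • ∇ (f k) x)
    (fun k => (hgr k) ▸ hasWeakGradient_of_contDiff ((hf1' k).mul (hg1' k)))
    (fun k => (cf k).mul (cg k)) (fun k => ((cf k).smul (cg' k)).add ((cg k).smul (cf' k)))
    ((fn_memLp w).mul (fn_memLp v)) (n1.add n2) ?_ ?_
  · exact tendsto_eLpNorm_bilin (p := 2) (q := 2) (by norm_num) (by norm_num)
      (ContinuousLinearMap.mul ℝ ℝ) cf cg (fn_memLp v) (fn_memLp w) hf3 hg3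
  · have t1 := tendsto_eLpNorm_bilin (p := 2) (q := 2) (by norm_num) (by norm_num)
      (ContinuousLinearMap.lsmul ℝ ℝ (E := E d)) cf cg' (fn_memLp v) (wgrad_memLp w) hf3 hg4
    have t2 := tendsto_eLpNorm_bilin (p := 2) (q := 2) (by norm_num) (by norm_num)
      (ContinuousLinearMap.lsmul ℝ ℝ (E := E d)) cg cf' (fn_memLp w) (wgrad_memLp v) hg3 hf4
    refine tendsto_of_tendsto_of_tendsto_of_le_of_le tendsto_const_nhds
      (by simpa using t1.add t2) (fun _ => zero_le) fun k => ?_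
    refine le_trans (le_of_eq ?_) (eLpNorm_add_le (((cf k).smul (cg' k)).sub n1.1)
      (((cg k).smul (cf' k)).sub n2.1) le_rfl)
    congr 1
    ext1 x
    simp only [Pi.sub_apply, Pi.add_apply, Pi.smul_apply']
    abel

end ChainRule

end StericPNP

namespace StericPNP

/-! ### Weak time derivatives and joint representatives -/

section TimeDerivative

/-- A smooth step rising from 0 to 1 across [s, s + 1/m]; its derivative is an approximate Dirac
mass just to the right of s. -/
theorem deriv_smoothStep_props (s : ℝ) {m : ℝ} (hm : 0 < m) :
    let ψ : ℝ → ℝ := fun τ => Real.smoothTransition (m * (τ - s))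
    ContDiff ℝ ∞ ψ ∧ (∀ τ, 0 ≤ deriv ψ τ) ∧ (∀ τ, τ ∉ Icc s (s + 1 / m) → deriv ψ τ = 0) ∧
      (∀ τ ≤ s, ψ τ = 0) ∧ (∀ τ, s + 1 / m ≤ τ → ψ τ = 1) := by
  intro ψ
  have hψ : ContDiff ℝ ∞ ψ :=
    Real.smoothTransition.contDiff.comp (contDiff_const.mul (contDiff_id.sub contDiff_const))
  have hmono : Monotone ψ := fun a b hab =>
    Real.smoothTransition.monotone (by
      have : a - s ≤ b - s := by linarith
      exact mul_le_mul_of_nonneg_left this hm.le)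
  have h0 : ∀ τ ≤ s, ψ τ = 0 := fun τ hτ =>
    Real.smoothTransition.zero_of_nonpos (mul_nonpos_of_nonneg_of_nonpos hm.le (by linarith))
  have h1 : ∀ τ, s + 1 / m ≤ τ → ψ τ = 1 := fun τ hτ =>
    Real.smoothTransition.one_of_one_le (by
      have : 1 / m ≤ τ - s := by linarith
      rwa [div_le_iff₀' hm] at this)
  refine ⟨hψ, fun τ => hmono.deriv_nonneg, fun τ hτ => ?_, h0, h1⟩
  rw [mem_Icc, not_and_or, not_le, not_le] at hτ
  rcases hτ with hτ | hτ
  · have : ψ =ᶠ[𝓝 τ] fun _ => 0 := by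
      filter_upwards [Iio_mem_nhds hτ] with x hx using h0 x (le_of_lt hx)
    rw [this.deriv_eq]; simp
  · have : ψ =ᶠ[𝓝 τ] fun _ => 1 := by
      filter_upwards [Ioi_mem_nhds hτ] with x hx using h1 x (le_of_lt hx)
    rw [this.deriv_eq]; simp

theorem tendsto_integral_deriv_smoothStep {g : ℝ → ℝ} {T s : ℝ} (hs : s ∈ Ioo 0 T)
    (hg : ContinuousOn g (Icc 0 T)) :
    Tendsto (fun n : ℕ => ∫ τ in Ioo 0 T,
      deriv (fun τ => Real.smoothTransition ((n + 1 : ℝ) * (τ - s))) τ * g τ) atTop (𝓝 (g s)) := by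
  have hT : 0 ≤ T := (hs.1.trans hs.2).le
  rw [Metric.tendsto_nhds]
  intro ε hε
  have hgs : ContinuousAt g s := hg.continuousAt (Icc_mem_nhds hs.1 hs.2)
  obtain ⟨δ, hδ, hball⟩ := Metric.continuousAt_iff.1 hgs (ε / 2) (by positivity)
  have hlim : Tendsto (fun n : ℕ => (1 : ℝ) / (n + 1)) atTop (𝓝 0) :=
    tendsto_one_div_add_atTop_nhds_zero_nat
  filter_upwards [hlim.eventually (gt_mem_nhds hδ),
    hlim.eventually (gt_mem_nhds (sub_pos.2 hs.2))] with n hn1 hn2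
  have hm : (0 : ℝ) < n + 1 := by positivity
  obtain ⟨hψ, hnn, hz, h0, h1⟩ := deriv_smoothStep_props s hm
  set ψ : ℝ → ℝ := fun τ => Real.smoothTransition ((n + 1 : ℝ) * (τ - s)) with hψdef
  have hψ' : Continuous (deriv ψ) := hψ.continuous_deriv (by simp)
  have hint : ∫ τ in Ioo 0 T, deriv ψ τ = 1 := by
    rw [← integral_Ioc_eq_integral_Ioo, ← intervalIntegral.integral_of_le hT,
      intervalIntegral.integral_deriv_eq_sub
        (fun x _ => hψ.differentiable (by simp) x) (hψ'.intervalIntegrable _ _),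
      h1 T (by linarith), h0 0 hs.1.le, sub_zero]
  have i1 : IntegrableOn (deriv ψ) (Ioo 0 T) :=
    (hψ'.integrableOn_Icc (a := 0) (b := T)).mono_set Ioo_subset_Icc_self
  have i2 : IntegrableOn (fun τ => deriv ψ τ * g τ) (Ioo 0 T) :=
    ((hψ'.continuousOn.mul hg).integrableOn_Icc).mono_set Ioo_subset_Icc_self
  have heq : (∫ τ in Ioo 0 T, deriv ψ τ * g τ) - g s
      = ∫ τ in Ioo 0 T, deriv ψ τ * (g τ - g s) := by
    simp_rw [mul_sub]
    rw [integral_sub i2 (i1.mul_const _), integral_mul_const, hint, one_mul]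
  rw [Real.dist_eq, heq, ← Real.norm_eq_abs]
  refine lt_of_le_of_lt (norm_integral_le_of_norm_le (i1.mul_const (ε / 2)) ?_) ?_
  · refine .of_forall fun τ => ?_
    rw [norm_mul, Real.norm_of_nonneg (hnn τ)]
    by_cases hτ : τ ∈ Icc s (s + 1 / ((n : ℝ) + 1))
    · refine mul_le_mul_of_nonneg_left ?_ (hnn τ)
      have : dist τ s < δ := by
        rw [Real.dist_eq, abs_of_nonneg (by linarith [hτ.1])]; linarith [hτ.2]
      exact (hball this).le
    · rw [hz τ hτ]; simp
  · rw [integral_mul_const, hint]; linarith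

/-- A continuous function with integrable weak derivative is the primitive of the latter. -/
theorem sub_eq_integral_of_weakDeriv {g D : ℝ → ℝ} {T : ℝ} (hg : ContinuousOn g (Icc 0 T))
    (hD : IntegrableOn D (Ioo 0 T))
    (h : ∀ η : ℝ → ℝ, ContDiff ℝ ∞ η → HasCompactSupport η → tsupport η ⊆ Ioo 0 T →
      ∫ t in Ioo 0 T, deriv η t * g t = - ∫ t in Ioo 0 T, η t * D t)
    {s t : ℝ} (hs : 0 ≤ s) (hst : s ≤ t) (ht : t ≤ T) : g t - g s = ∫ r in Ioo s t, D r := by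
  have hinner : ∀ s t : ℝ, 0 < s → s < t → t < T → g t - g s = ∫ r in Ioo s t, D r := by
    intro s t hs hst ht
    have l1 := tendsto_integral_deriv_smoothStep ⟨hs, hst.trans ht⟩ hg
    have l2 := tendsto_integral_deriv_smoothStep ⟨hs.trans hst, ht⟩ hg
    -- The test function approximates the indicator of (s, t], while its derivative samples g at s
    -- and, with opposite sign, at t.
    let η : ℕ → ℝ → ℝ := fun n τ => Real.smoothTransition ((n + 1 : ℝ) * (τ - s)) -
      Real.smoothTransition ((n + 1 : ℝ) * (τ - t))
    have l3 : Tendsto (fun n => ∫ τ in Ioo 0 T, η n τ * D τ) atTop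
        (𝓝 (∫ τ in Ioo 0 T, (Ioc s t).indicator D τ)) := by
      refine tendsto_integral_of_dominated_convergence (fun τ => ‖D τ‖)
        (fun n => ?_) hD.norm (fun n => ?_) ?_
      · exact (Continuous.aestronglyMeasurable (by
          have := Real.smoothTransition.continuous
          fun_prop)).mul hD.aestronglyMeasurable
      · refine .of_forall fun τ => ?_
        rw [norm_mul]
        refine mul_le_of_le_one_left (norm_nonneg _) ?_
        rw [Real.norm_eq_abs, abs_le]
        have a1 := Real.smoothTransition.nonneg ((n + 1 : ℝ) * (τ - s))
        have a2 := Real.smoothTransition.le_one ((n + 1 : ℝ) * (τ - s))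
        have a3 := Real.smoothTransition.nonneg ((n + 1 : ℝ) * (τ - t))
        have a4 := Real.smoothTransition.le_one ((n + 1 : ℝ) * (τ - t))
        constructor <;> simp only [η] <;> linarith
      · refine .of_forall fun τ => ?_
        have hstep : ∀ a : ℝ, Tendsto (fun n : ℕ => Real.smoothTransition ((n + 1 : ℝ) * (τ - a)))
            atTop (𝓝 (if a < τ then 1 else 0)) := by
          intro a
          split_ifs with ha
          · refine tendsto_const_nhds.congr' ?_
            have hlim : Tendsto (fun n : ℕ => (1 : ℝ) / (n + 1)) atTop (𝓝 0) :=
              tendsto_one_div_add_atTop_nhds_zero_nat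
            filter_upwards [hlim.eventually (gt_mem_nhds (sub_pos.2 ha))] with n hn
            refine (Real.smoothTransition.one_of_one_le ?_).symm
            rw [div_lt_iff₀' (by positivity)] at hn
            exact hn.le
          · refine tendsto_const_nhds.congr fun n => ?_
            exact (Real.smoothTransition.zero_of_nonpos (mul_nonpos_of_nonneg_of_nonpos
              (by positivity) (by linarith))).symm
        have := ((hstep s).sub (hstep t)).mul_const (D τ)
        convert this using 2
        by_cases h1 : s < τ <;> by_cases h2 : t < τ
        · simp [h1, h2]
        · simp [h1, h2, not_lt.1 h2]
        · exact absurd (hst.trans h2) h1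
        · simp [h1, h2]
    have l4 : Tendsto (fun n : ℕ => - ∫ τ in Ioo 0 T, η n τ * D τ) atTop (𝓝 (g s - g t)) := by
      refine (l1.sub l2).congr' ?_
      have hlim : Tendsto (fun n : ℕ => (1 : ℝ) / (n + 1)) atTop (𝓝 0) :=
        tendsto_one_div_add_atTop_nhds_zero_nat
      filter_upwards [hlim.eventually (gt_mem_nhds (sub_pos.2 ht))] with n hn
      have hm : (0 : ℝ) < n + 1 := by positivity
      obtain ⟨hψ, -, -, h0, h1⟩ := deriv_smoothStep_props s hm
      obtain ⟨hψ', -, -, h0', h1'⟩ := deriv_smoothStep_props t hm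
      have hsupp : tsupport (η n) ⊆ Icc s (t + 1 / ((n : ℝ) + 1)) := by
        refine closure_minimal (fun τ hτ => ?_) isClosed_Icc
        by_contra hne
        rw [mem_Icc, not_and_or, not_le, not_le] at hne
        apply hτ
        rcases hne with hne | hne
        · exact sub_eq_zero.2 ((h0 τ hne.le).trans (h0' τ (by linarith)).symm)
        · exact sub_eq_zero.2 ((h1 τ (by linarith)).trans (h1' τ hne.le).symm)
      rw [← h (η n) (hψ.sub hψ') (HasCompactSupport.of_support_subset_isCompact isCompact_Icc
        ((subset_tsupport _).trans hsupp)) (hsupp.trans (Icc_subset_Ioo hs (by linarith)))]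
      have c1 : IntegrableOn (fun τ => deriv (fun τ => Real.smoothTransition
          ((n + 1 : ℝ) * (τ - s))) τ * g τ) (Ioo 0 T) :=
        (((hψ.continuous_deriv (by simp)).continuousOn.mul hg).integrableOn_Icc).mono_set
          Ioo_subset_Icc_self
      have c2 : IntegrableOn (fun τ => deriv (fun τ => Real.smoothTransition
          ((n + 1 : ℝ) * (τ - t))) τ * g τ) (Ioo 0 T) :=
        (((hψ'.continuous_deriv (by simp)).continuousOn.mul hg).integrableOn_Icc).mono_set
          Ioo_subset_Icc_self
      rw [← integral_sub c1 c2]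
      refine integral_congr_ae (.of_forall fun τ => ?_)
      have : deriv (η n) τ = deriv (fun τ => Real.smoothTransition ((n + 1 : ℝ) * (τ - s))) τ -
          deriv (fun τ => Real.smoothTransition ((n + 1 : ℝ) * (τ - t))) τ :=
        deriv_fun_sub (hψ.differentiable (by simp) τ) (hψ'.differentiable (by simp) τ)
      simp only [this, sub_mul]
    have hlast := tendsto_nhds_unique l4 l3.neg
    rw [integral_indicator measurableSet_Ioc, Measure.restrict_restrict measurableSet_Ioc,
      inter_eq_self_of_subset_left
        (show Ioc s t ⊆ Ioo 0 T from fun x hx => ⟨hs.trans hx.1, hx.2.trans_lt ht⟩),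
      integral_Ioc_eq_integral_Ioo] at hlast
    linarith
  rcases hst.eq_or_lt with rfl | hst'
  · simp
  have hT : 0 < T := hs.trans_lt (hst'.trans_le ht)
  have hii : IntegrableOn D (Icc 0 T) := (integrableOn_Icc_iff_integrableOn_Ioo).2 hD
  have hprim : ContinuousOn (fun x => ∫ r in (0 : ℝ)..x, D r) (Icc 0 T) := by
    have := intervalIntegral.continuousOn_primitive_interval (a := 0) (b := T) (f := D)
      (by rwa [uIcc_of_le hT.le])
    rwa [uIcc_of_le hT.le] at this
  set k : ℝ → ℝ := fun x => g x - ∫ r in (0 : ℝ)..x, D r with hk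
  have hkc : ContinuousOn k (Icc 0 T) := hg.sub hprim
  have hsplit : ∀ a b, 0 ≤ a → a ≤ b → b ≤ T →
      (∫ r in (0 : ℝ)..b, D r) - (∫ r in (0 : ℝ)..a, D r) = ∫ r in Ioo a b, D r := by
    intro a b ha hab hb
    have ii : ∀ c d, c ∈ Icc 0 T → d ∈ Icc 0 T → IntervalIntegrable D volume c d := fun c d hc hd =>
      (hii.mono_set (uIcc_subset_Icc hc hd)).intervalIntegrable
    have h0 : (0 : ℝ) ∈ Icc 0 T := ⟨le_rfl, hT.le⟩
    rw [intervalIntegral.integral_interval_sub_left (ii _ _ h0 ⟨ha.trans hab, hb⟩)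
      (ii _ _ h0 ⟨ha, hab.trans hb⟩), intervalIntegral.integral_of_le hab,
      integral_Ioc_eq_integral_Ioo]
  -- Test functions only reach interior times. Continuity of g minus its primitive extends the
  -- identity to the closed interval, so that s = 0, where the initial datum sits, is allowed.
  have hconst : EqOn k (fun _ => k (T / 2)) (Icc 0 T) := by
    have hio : EqOn k (fun _ => k (T / 2)) (Ioo 0 T) := by
      have key : ∀ a b, 0 < a → a < b → b < T → k a = k b := by
        intro a b ha hab hb
        have h1 := hinner a b ha hab hb
        have h2 := hsplit a b ha.le hab.le hb.le
        simp only [hk]; linarith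
      intro x hx
      rcases lt_trichotomy x (T / 2) with hlt | heq | hgt
      · exact key x (T / 2) hx.1 hlt (by linarith)
      · rw [heq]
      · exact (key (T / 2) x (by linarith) hgt hx.2).symm
    exact hio.of_subset_closure hkc continuousOn_const Ioo_subset_Icc_self
      (by rw [closure_Ioo hT.ne])
  have e1 := hconst (⟨hs, hst.trans ht⟩ : s ∈ Icc 0 T)
  have e2 := hconst (⟨hs.trans hst, ht⟩ : t ∈ Icc 0 T)
  have e3 := hsplit s t hs hst ht
  simp only [hk] at e1 e2
  linarith

theorem integrable_apply_of_memLp {α X : Type*} [MeasurableSpace α] {ν : Measure α}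
    [IsFiniteMeasure ν] [NormedAddCommGroup X] [NormedSpace ℝ X] {f : α → X →L[ℝ] ℝ}
    (hf : MemLp f 2 ν) (φ : X) : Integrable (fun r => f r φ) ν :=
  (hf.integrable (by norm_num)).apply_continuousLinearMap φ

/-- The distributional derivative becomes an equation integrated over any subinterval of [0,T],
including those starting at 0, because `rep` is continuous there. -/
theorem WeakSolution.rep_sub_rep {d n : ℕ} {P : Data d n} (S : WeakSolution P)
    (i : Fin n) (φ : W1 P.Ω 4) {s t : ℝ} (hs : 0 ≤ s) (hst : s ≤ t) (ht : t ≤ P.T) :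
    S.rep i t φ - S.rep i s φ = ∫ r in Ioo s t, S.dtu i r φ := by
  have hint : IntegrableOn (fun r => S.dtu i r φ) (Ioo 0 P.T) :=
    integrable_apply_of_memLp (S.dtu_memLp i) φ
  refine sub_eq_integral_of_weakDeriv (g := fun t => S.rep i t φ)
    ((S.rep_continuous i).clm_apply continuousOn_const) hint (fun η h1 h2 h3 => ?_) hs hst ht
  rw [← S.dtu_eq i η h1 h2 h3 φ]
  refine integral_congr_ae ?_
  filter_upwards [S.rep_eq i] with t ht
  simp only [ht φ]

end TimeDerivative

section JointRepresentation

variable {d : ℕ} {F : Type*} [NormedAddCommGroup F] [NormedSpace ℝ F] [CompleteSpace F]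
  [SecondCountableTopology F] {p : ℝ≥0∞}

/-- A measurable map into `L^p` comes from a jointly measurable function. -/
theorem exists_joint_representative [Fact (1 ≤ p)] {μ : Measure (E d)}
    {ν : Measure ℝ} {g : ℝ → Lp F p μ} (hg : AEStronglyMeasurable g ν) :
    ∃ f : ℝ × E d → F, StronglyMeasurable f ∧ ∀ᵐ t ∂ν, g t =ᵐ[μ] fun x => f (t, x) := by
  have hp1 : (1 : ℝ≥0∞) ≤ p := Fact.out
  obtain ⟨g', hg', hgg'⟩ := hg
  let K := closure (range g')
  have hsep : TopologicalSpace.IsSeparable K := hg'.isSeparable_range.closure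
  obtain ⟨c, hcc, hcK⟩ := hsep
  have hcne : c.Nonempty := by
    by_contra h
    rw [not_nonempty_iff_eq_empty] at h
    rw [h, closure_empty] at hcK
    exact hcK (subset_closure (mem_range_self 0))
  obtain ⟨D, hD⟩ := hcc.exists_eq_range hcne
  have hex : ∀ (k : ℕ) (t : ℝ), ∃ m, dist (D m) (g' t) < (1 / 2 : ℝ) ^ k := by
    intro k t
    have : g' t ∈ closure c := hcK (subset_closure (mem_range_self t))
    rw [hD] at this
    obtain ⟨_, ⟨m, rfl⟩, hm⟩ := Metric.mem_closure_iff.1 this ((1 / 2 : ℝ) ^ k) (by positivity)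
    exact ⟨m, by rwa [dist_comm]⟩
  classical
  -- The first member of a dense sequence within 2⁻ᵏ of g'(t). The resulting approximations take
  -- countably many values in L^p, so each is jointly measurable.
  let N : ℕ → ℝ → ℕ := fun k t => Nat.find (hex k t)
  have hNm : ∀ k, Measurable (N k) := fun k => measurable_find _ fun m =>
    (stronglyMeasurable_const.dist hg').measurableSet_lt stronglyMeasurable_const
  let f : ℕ → ℝ × E d → F := fun k q => D (N k q.1) q.2
  have hf : ∀ k, StronglyMeasurable (f k) := by
    intro k
    have h1 : StronglyMeasurable fun q : ℕ × E d => (D q.1 : E d → F) q.2 := by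
      borelize F
      exact (measurable_from_prod_countable_right fun m =>
        (Lp.stronglyMeasurable (D m)).measurable).stronglyMeasurable
    exact h1.comp_measurable (((hNm k).comp measurable_fst).prodMk measurable_snd)
  -- `limUnder` is defined and measurable everywhere; it is the true limit wherever one exists.
  refine ⟨fun q => limUnder atTop fun k => f k q, StronglyMeasurable.limUnder hf, ?_⟩
  filter_upwards [hgg'] with t ht
  rw [ht]
  have hdist : ∀ k, eLpNorm (fun x => f k (t, x) - g' t x) p μ ≤ ENNReal.ofReal ((1 / 2) ^ k) := by
    intro k
    have h1 : dist (D (N k t)) (g' t) < (1 / 2 : ℝ) ^ k := Nat.find_spec (hex k t)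
    have h2 : edist (D (N k t)) (g' t) ≤ ENNReal.ofReal ((1 / 2) ^ k) := by
      rw [edist_dist]; exact ENNReal.ofReal_le_ofReal h1.le
    rwa [Lp.edist_def] at h2
  have hdm : ∀ k, AEStronglyMeasurable (fun x => f k (t, x)) μ := fun k =>
    ((hf k).comp_measurable measurable_prodMk_left).aestronglyMeasurable
  have hpow : ∀ k : ℕ, ENNReal.ofReal ((1 / 2) ^ k) = (2⁻¹ : ℝ≥0∞) ^ k := fun k => by
    rw [ENNReal.ofReal_pow (by norm_num), one_div, ENNReal.ofReal_inv_of_pos two_pos,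
      ENNReal.ofReal_ofNat]
  -- Two approximations of index at least m differ by at most 2·2⁻ᵐ; the factor 4 gives the strict
  -- inequality required.
  have hlim := Lp.ae_tendsto_of_cauchy_eLpNorm hdm hp1 (B := fun k => 4 * (2⁻¹ : ℝ≥0∞) ^ k)
    (by
      rw [ENNReal.tsum_mul_left, ENNReal.tsum_geometric]
      simp
      exact ENNReal.mul_ne_top (by simp) (by simp)) fun m a b ha hb => by
    have h1 : (fun x => f a (t, x)) - (fun x => f b (t, x)) =
        (fun x => f a (t, x) - g' t x) - fun x => f b (t, x) - g' t x := by
      ext x; simp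
    rw [h1]
    refine lt_of_le_of_lt (eLpNorm_sub_le ((hdm a).sub (Lp.aestronglyMeasurable _))
      ((hdm b).sub (Lp.aestronglyMeasurable _)) hp1) ?_
    have hle : ∀ c, m ≤ c → eLpNorm (fun x => f c (t, x) - g' t x) p μ ≤ (2⁻¹ : ℝ≥0∞) ^ m :=
      fun c hc => (hdist c).trans ((hpow c).le.trans
        (pow_le_pow_right_of_le_one' (by simp) hc))
    have h0 : (2⁻¹ : ℝ≥0∞) ^ m ≠ 0 := by simp
    have h2 : (2⁻¹ : ℝ≥0∞) ^ m ≠ ⊤ := ENNReal.pow_ne_top (by simp)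
    calc _ ≤ (2⁻¹ : ℝ≥0∞) ^ m + (2⁻¹ : ℝ≥0∞) ^ m := add_le_add (hle a ha) (hle b hb)
      _ = 2 * (2⁻¹ : ℝ≥0∞) ^ m := (two_mul _).symm
      _ < 4 * (2⁻¹ : ℝ≥0∞) ^ m := by
        rw [ENNReal.mul_lt_mul_iff_left h0 h2]; norm_num
  have h0 : Tendsto (fun k => eLpNorm ((fun x => f k (t, x)) - (g' t : E d → F)) p μ) atTop (𝓝 0) := by
    refine tendsto_of_tendsto_of_tendsto_of_le_of_le tendsto_const_nhds ?_ (fun _ => zero_le) hdist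
    simp_rw [hpow]
    exact ENNReal.tendsto_pow_atTop_nhds_zero_of_lt_one (by simp)
  obtain ⟨ns, hns, hae⟩ := exists_subseq_tendsto_ae (one_pos.trans_le hp1).ne' hdm
    (Lp.aestronglyMeasurable _) h0
  filter_upwards [hlim, hae] with x ⟨l, hl⟩ hx
  rw [tendsto_nhds_unique hx (hl.comp hns.tendsto_atTop)]
  exact hl.limUnder_eq.symm

end JointRepresentation

end StericPNP

namespace StericPNP

/-! ### Space-time representatives of a weak solution -/

section JointMemLp

variable {d : ℕ} {F : Type*} [NormedAddCommGroup F]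

theorem memLp_two_of_joint {μ : Measure (E d)} {ν : Measure ℝ} [SFinite μ] [SFinite ν]
    {g : ℝ → Lp F 2 μ} (hg : MemLp g 2 ν) {f : ℝ × E d → F} (hf : StronglyMeasurable f)
    (h : ∀ᵐ t ∂ν, g t =ᵐ[μ] fun x => f (t, x)) : MemLp f 2 (ν.prod μ) := by
  refine ⟨hf.aestronglyMeasurable, ?_⟩
  have h2 := hg.2
  rw [eLpNorm_lt_top_iff_lintegral_rpow_enorm_lt_top two_ne_zero ENNReal.ofNat_ne_top] at h2 ⊢
  rw [lintegral_prod _ (hf.enorm.pow_const _).aemeasurable]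
  refine lt_of_le_of_lt (le_of_eq (lintegral_congr_ae ?_)) h2
  filter_upwards [h] with t ht
  have h3 : eLpNorm (fun x => f (t, x)) 2 μ = ‖g t‖ₑ := by
    rw [Lp.enorm_def]; exact eLpNorm_congr_ae ht.symm
  rw [← h3, eLpNorm_eq_lintegral_rpow_enorm_toReal two_ne_zero ENNReal.ofNat_ne_top,
    ← ENNReal.rpow_mul]
  simp

theorem exists_joint_H1 {Ω : Set (E d)} {ν : Measure ℝ} [SFinite ν] {v : ℝ → H1 Ω}
    (hv : MemLp v 2 ν) :
    ∃ (f : ℝ × E d → ℝ) (G : ℝ × E d → E d), StronglyMeasurable f ∧ StronglyMeasurable G ∧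
      MemLp f 2 (ν.prod (volume.restrict Ω)) ∧ MemLp G 2 (ν.prod (volume.restrict Ω)) ∧
      (∀ᵐ t ∂ν, fn (v t) =ᵐ[volume.restrict Ω] fun x => f (t, x)) ∧
      ∀ᵐ t ∂ν, wgrad (v t) =ᵐ[volume.restrict Ω] fun x => G (t, x) := by
  have h1 : MemLp (fun t => (v t).1.1) 2 ν :=
    ((ContinuousLinearMap.fst ℝ (Lp ℝ 2 (volume.restrict Ω)) (Lp (E d) 2 (volume.restrict Ω))).comp
      (W1 Ω 2).subtypeL).comp_memLp' hv
  have h2 : MemLp (fun t => (v t).1.2) 2 ν :=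
    ((ContinuousLinearMap.snd ℝ (Lp ℝ 2 (volume.restrict Ω)) (Lp (E d) 2 (volume.restrict Ω))).comp
      (W1 Ω 2).subtypeL).comp_memLp' hv
  obtain ⟨f, hf, hf'⟩ := exists_joint_representative h1.1
  obtain ⟨G, hG, hG'⟩ := exists_joint_representative h2.1
  exact ⟨f, G, hf, hG, memLp_two_of_joint h1 hf hf', memLp_two_of_joint h2 hG hG', hf', hG'⟩

end JointMemLp

variable {d n : ℕ} {P : Data d n}

/-- The space-time cylinder. -/
def Data.cyl (P : Data d n) : Set (ℝ × E d) := Ioo 0 P.T ×ˢ P.Ω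

theorem volume_restrict_cyl : (volume : Measure (ℝ × E d)).restrict P.cyl =
    (volume.restrict (Ioo 0 P.T)).prod (volume.restrict P.Ω) := by
  rw [Measure.volume_eq_prod, Data.cyl, Measure.prod_restrict]

/-- Jointly measurable representatives of `√uᵢ`, `∇√uᵢ` and `∇Φ`, extended by zero. -/
structure JointRep (S : WeakSolution P) where
  s : Fin n → ℝ × E d → ℝ
  g : Fin n → ℝ × E d → E d
  V : ℝ × E d → E d
  s_meas : ∀ i, StronglyMeasurable (s i)
  g_meas : ∀ i, StronglyMeasurable (g i)
  V_meas : StronglyMeasurable V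
  s_nonneg : ∀ i q, 0 ≤ s i q
  s_zero : ∀ i, ∀ q ∉ P.cyl, s i q = 0
  g_zero : ∀ i, ∀ q ∉ P.cyl, g i q = 0
  V_zero : ∀ q ∉ P.cyl, V q = 0
  u_memLp : ∀ i, MemLp (fun q => s i q ^ 2) 2 volume
  U_memLp : ∀ i, MemLp (fun q => (2 * s i q) • g i q) 2 volume
  V_memLp : MemLp V 2 volume
  sqrt_eq : ∀ i, ∀ᵐ t ∂(volume.restrict (Ioo 0 P.T)),
    fn (S.sqrtU i t) =ᵐ[volume.restrict P.Ω] fun x => s i (t, x)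
  sqrt_grad_eq : ∀ i, ∀ᵐ t ∂(volume.restrict (Ioo 0 P.T)),
    wgrad (S.sqrtU i t) =ᵐ[volume.restrict P.Ω] fun x => g i (t, x)
  u_eq : ∀ i, ∀ᵐ t ∂(volume.restrict (Ioo 0 P.T)),
    fn (S.u i t) =ᵐ[volume.restrict P.Ω] fun x => s i (t, x) ^ 2
  u_grad_eq : ∀ i, ∀ᵐ t ∂(volume.restrict (Ioo 0 P.T)),
    wgrad (S.u i t) =ᵐ[volume.restrict P.Ω] fun x => (2 * s i (t, x)) • g i (t, x)
  V_eq : ∀ᵐ t ∂(volume.restrict (Ioo 0 P.T)),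
    wgrad (S.Φ t) =ᵐ[volume.restrict P.Ω] fun x => V (t, x)

/-- By the product rule s² has the weak gradient 2s∇s, a priori only in L¹, and weak gradients are
unique. This ties ∇u to ∇√u, in which the entropy dissipation is written. -/
theorem wgrad_eq_of_sq (hΩ : IsOpen P.Ω) (hb : Bornology.IsBounded P.Ω)
    (hL : HasLipschitzBoundary P.Ω) (u s : H1 P.Ω)
    (h : ∀ᵐ x ∂(volume.restrict P.Ω), fn u x = fn s x ^ 2) :
    wgrad u =ᵐ[volume.restrict P.Ω] fun x => (2 * fn s x) • wgrad s x := by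
  have := isFiniteMeasure_restrict_of_isBounded hb
  have h1 := hasWeakGradient_mul hΩ hb hL s s
  have h2 : HasWeakGradient P.Ω (fun x => fn s x * fn s x) (wgrad u) :=
    (hasWeakGradient_fn u).congr (by filter_upwards [h] with x hx; rw [hx, sq]) .rfl
  have hint : Integrable (fun x => fn s x • wgrad s x) (volume.restrict P.Ω) :=
    memLp_one_iff_integrable.1 ((wgrad_memLp s).smul (fn_memLp s))
  have h3 := HasWeakGradient.unique hΩ ((wgrad_memLp u).integrable (by norm_num))
    (hint.add hint) h2 h1
  filter_upwards [h3] with x hx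
  rw [hx, two_mul, add_smul]; rfl

theorem memLp_volume_of_zero {F : Type*} [NormedAddCommGroup F] (hΩ : IsOpen P.Ω)
    {f : ℝ × E d → F} {p : ℝ≥0∞} (hz : ∀ q ∉ P.cyl, f q = 0)
    (h : MemLp f p ((volume.restrict (Ioo 0 P.T)).prod (volume.restrict P.Ω))) :
    MemLp f p volume := by
  have hm : MeasurableSet P.cyl := measurableSet_Ioo.prod hΩ.measurableSet
  rw [← volume_restrict_cyl] at h
  have h2 := (memLp_indicator_iff_restrict hm).2 h
  rwa [indicator_eq_self.2 fun q hq => by_contra fun hne => hq (hz q hne)] at h2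

/-- Densities and their gradients are built from representatives s of √u and g of ∇√u as s² and
2s·g, so the algebra of the dissipation holds at every space-time point. Their square integrability
is inherited from u ∈ L²(0,T;H¹). Extension by zero makes time translations harmless. -/
theorem exists_jointRep (hΩ : IsOpen P.Ω) (hb : Bornology.IsBounded P.Ω)
    (hL : HasLipschitzBoundary P.Ω) (S : WeakSolution P) : Nonempty (JointRep S) := by
  choose s0 g0 hs0 hg0 _ _ es0 eg0 using fun i => exists_joint_H1 (S.sqrtU_memLp i)
  choose u0 U0 hu0 hU0 lu0 lU0 eu0 eU0 using fun i => exists_joint_H1 (S.u_memLp i)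
  obtain ⟨φ0, V0, -, hV0, -, lV0, -, eV0⟩ := exists_joint_H1 S.Φ_memLp
  have hm : MeasurableSet P.cyl := measurableSet_Ioo.prod hΩ.measurableSet
  have hin : ∀ t ∈ Ioo 0 P.T, ∀ᵐ x ∂(volume.restrict P.Ω), (t, x) ∈ P.cyl := fun t ht => by
    filter_upwards [ae_restrict_mem hΩ.measurableSet] with x hx using ⟨ht, hx⟩
  -- The maximum gives nonnegativity everywhere and changes `s0` only on a null set, since `s0`
  -- represents a square root.
  let s : Fin n → ℝ × E d → ℝ := fun i => P.cyl.indicator fun q => max (s0 i q) 0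
  let g : Fin n → ℝ × E d → E d := fun i => P.cyl.indicator (g0 i)
  let V : ℝ × E d → E d := P.cyl.indicator V0
  have ms : ∀ i, StronglyMeasurable (s i) := fun i =>
    ((hs0 i).sup stronglyMeasurable_const).indicator hm
  have mg : ∀ i, StronglyMeasurable (g i) := fun i => (hg0 i).indicator hm
  have zs : ∀ i, ∀ q ∉ P.cyl, s i q = 0 := fun i q hq => indicator_of_notMem hq _
  have e1 : ∀ i, ∀ᵐ t ∂(volume.restrict (Ioo 0 P.T)),
      fn (S.sqrtU i t) =ᵐ[volume.restrict P.Ω] fun x => s i (t, x) := fun i => by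
    filter_upwards [es0 i, S.sqrtU_eq i, ae_restrict_mem measurableSet_Ioo] with t h1 h2 ht
    filter_upwards [h1, h2, hin t ht] with x h3 h4 h5
    simp only [s, indicator_of_mem h5]
    rw [← h3, h4, max_eq_left (Real.sqrt_nonneg _)]
  have e2 : ∀ i, ∀ᵐ t ∂(volume.restrict (Ioo 0 P.T)),
      wgrad (S.sqrtU i t) =ᵐ[volume.restrict P.Ω] fun x => g i (t, x) := fun i => by
    filter_upwards [eg0 i, ae_restrict_mem measurableSet_Ioo] with t h1 ht
    filter_upwards [h1, hin t ht] with x h3 h5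
    simp only [g, indicator_of_mem h5, h3]
  have e0 : ∀ i, ∀ᵐ t ∂(volume.restrict (Ioo 0 P.T)), ∀ᵐ x ∂(volume.restrict P.Ω),
      fn (S.u i t) x = fn (S.sqrtU i t) x ^ 2 := fun i => by
    filter_upwards [S.sqrtU_eq i, S.u_nonneg i] with t h1 h2
    filter_upwards [h1, h2] with x h3 h4
    rw [h3, Real.sq_sqrt h4]
  have e3 : ∀ i, ∀ᵐ t ∂(volume.restrict (Ioo 0 P.T)),
      fn (S.u i t) =ᵐ[volume.restrict P.Ω] fun x => s i (t, x) ^ 2 := fun i => by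
    filter_upwards [e0 i, e1 i] with t h1 h2
    filter_upwards [h1, h2] with x h3 h4
    rw [h3, h4]
  have e4 : ∀ i, ∀ᵐ t ∂(volume.restrict (Ioo 0 P.T)),
      wgrad (S.u i t) =ᵐ[volume.restrict P.Ω] fun x => (2 * s i (t, x)) • g i (t, x) := fun i => by
    filter_upwards [e0 i, e1 i, e2 i] with t h0 h1 h2
    filter_upwards [wgrad_eq_of_sq hΩ hb hL _ _ h0, h1, h2] with x h3 h4 h5
    rw [h3, h4, h5]
  refine ⟨⟨s, g, V, ms, mg, hV0.indicator hm, fun i q => indicator_nonneg (fun q _ => le_max_right _ _) q,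
    zs, fun i q hq => indicator_of_notMem hq _, fun q hq => indicator_of_notMem hq _,
    fun i => ?_, fun i => ?_, ?_, e1, e2, e3, e4, ?_⟩⟩
  · refine memLp_volume_of_zero hΩ (fun q hq => by simp [zs i q hq]) ((lu0 i).ae_eq ?_)
    refine (Measure.ae_prod_iff_ae_ae (p := fun q => u0 i q = s i q ^ 2)
      (measurableSet_eq_fun (hu0 i).measurable ((ms i).measurable.pow_const 2))).2 ?_
    filter_upwards [eu0 i, e3 i] with t h1 h2
    filter_upwards [h1, h2] with x h3 h4
    rw [← h3, h4]
  · refine memLp_volume_of_zero hΩ (fun q hq => by simp [zs i q hq]) ((lU0 i).ae_eq ?_)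
    refine (Measure.ae_prod_iff_ae_ae (p := fun q => U0 i q = (2 * s i q) • g i q)
      (measurableSet_eq_fun (hU0 i).measurable
        (((ms i).measurable.const_mul 2).smul (mg i).measurable))).2 ?_
    filter_upwards [eU0 i, e4 i] with t h1 h2
    filter_upwards [h1, h2] with x h3 h4
    rw [← h3, h4]
  · rw [memLp_indicator_iff_restrict hm, volume_restrict_cyl]
    exact lV0
  · filter_upwards [eV0, ae_restrict_mem measurableSet_Ioo] with t h1 ht
    filter_upwards [h1, hin t ht] with x h3 h5
    simp only [V, indicator_of_mem h5, h3]

/-- The representative of a strong solution can be chosen with everywhere bounded gradients. -/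
theorem JointRep.exists_bounded {S : WeakSolution P} (J : JointRep S)
    (h : IsStrong S) :
    ∃ (J' : JointRep S) (M : ℝ), 0 ≤ M ∧ (∀ q, ‖J'.V q‖ ≤ M) ∧
      ∀ i q, ‖(2 * J'.s i q) • J'.g i q‖ ≤ M := by
  obtain ⟨M, hM⟩ := h
  -- All representatives are set to zero off A. Cutting s and g simultaneously cuts s² and 2s·g in
  -- the same way, so the relations between them survive.
  let A : Set (ℝ × E d) := {q | ‖J.V q‖ ≤ M} ∩ ⋂ i, {q | ‖(2 * J.s i q) • J.g i q‖ ≤ M}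
  have hA : MeasurableSet A := by
    refine (measurableSet_le J.V_meas.norm.measurable measurable_const).inter
      (MeasurableSet.iInter fun i => measurableSet_le
        (((J.s_meas i).const_mul 2).smul (J.g_meas i)).norm.measurable measurable_const)
  have hae : ∀ᵐ t ∂(volume.restrict (Ioo 0 P.T)), ∀ᵐ x ∂(volume.restrict P.Ω), (t, x) ∈ A := by
    filter_upwards [hM, J.V_eq, ae_all_iff.2 J.u_grad_eq] with t h1 h2 h3
    filter_upwards [h1, h2, ae_all_iff.2 h3] with x h4 h5 h6
    refine ⟨?_, mem_iInter.2 fun i => ?_⟩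
    · rw [mem_ofPred_eq, ← h5]; exact h4.2
    · rw [mem_ofPred_eq, ← h6 i]; exact h4.1 i
  have ind : ∀ {F : Type} [Zero F] (f : ℝ × E d → F), ∀ q ∉ P.cyl, f q = 0 → A.indicator f q = 0 :=
    fun f q _ h => by classical rw [indicator_apply]; split_ifs <;> simp [h]
  have u2 : ∀ i, (fun q => A.indicator (J.s i) q ^ 2) = A.indicator fun q => J.s i q ^ 2 := by
    intro i; ext q; by_cases hq : q ∈ A <;> simp [hq]
  have U2 : ∀ i, (fun q => (2 * A.indicator (J.s i) q) • A.indicator (J.g i) q) =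
      A.indicator fun q => (2 * J.s i q) • J.g i q := by
    intro i; ext1 q; by_cases hq : q ∈ A <;> simp [hq]
  refine ⟨⟨fun i => A.indicator (J.s i), fun i => A.indicator (J.g i), A.indicator J.V,
    fun i => (J.s_meas i).indicator hA, fun i => (J.g_meas i).indicator hA,
    J.V_meas.indicator hA, fun i q => indicator_nonneg (fun q _ => J.s_nonneg i q) q,
    fun i q hq => ind _ q hq (J.s_zero i q hq), fun i q hq => ind _ q hq (J.g_zero i q hq),
    fun q hq => ind _ q hq (J.V_zero q hq), fun i => ?_, fun i => ?_, J.V_memLp.indicator hA,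
    fun i => ?_, fun i => ?_, fun i => ?_, fun i => ?_, ?_⟩, max M 0, le_max_right _ _,
    fun q => ?_, fun i q => ?_⟩
  · rw [u2]; exact (J.u_memLp i).indicator hA
  · rw [U2]; exact (J.U_memLp i).indicator hA
  · filter_upwards [hae, J.sqrt_eq i] with t h1 h2
    filter_upwards [h1, h2] with x h3 h4
    rw [indicator_of_mem h3, h4]
  · filter_upwards [hae, J.sqrt_grad_eq i] with t h1 h2
    filter_upwards [h1, h2] with x h3 h4
    rw [indicator_of_mem h3, h4]
  · filter_upwards [hae, J.u_eq i] with t h1 h2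
    filter_upwards [h1, h2] with x h3 h4
    rw [indicator_of_mem h3, h4]
  · filter_upwards [hae, J.u_grad_eq i] with t h1 h2
    filter_upwards [h1, h2] with x h3 h4
    rw [indicator_of_mem h3, indicator_of_mem h3, h4]
  · filter_upwards [hae, J.V_eq] with t h1 h2
    filter_upwards [h1, h2] with x h3 h4
    rw [indicator_of_mem h3, h4]
  · by_cases hq : q ∈ A
    · simp only [indicator_of_mem hq]; exact hq.1.trans (le_max_left _ _)
    · simp only [indicator_of_notMem hq]; simp
  · by_cases hq : q ∈ A
    · simp only [indicator_of_mem hq]; exact (mem_iInter.1 hq.2 i).trans (le_max_left _ _)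
    · simp only [indicator_of_notMem hq]; simp

namespace JointRep

variable {S : WeakSolution P} (J : JointRep S)

/-- The representative of `uᵢ`. -/
def u (i : Fin n) (q : ℝ × E d) : ℝ := J.s i q ^ 2

/-- The representative of `∇uᵢ`. -/
def U (i : Fin n) (q : ℝ × E d) : E d := (2 * J.s i q) • J.g i q

/-- The representative of `∇(zᵢ Φ + pᵢ(u))`. -/
def drift (i : Fin n) (q : ℝ × E d) : E d := P.z i • J.V q + ∑ j, P.a i j • J.U j q

/-- The representative of the negative flux. -/
def F (i : Fin n) (q : ℝ × E d) : E d := P.σ • J.U i q + J.u i q • J.drift i q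

theorem u_nonneg (i : Fin n) (q : ℝ × E d) : 0 ≤ J.u i q := sq_nonneg _

theorem u_meas (i : Fin n) : StronglyMeasurable (J.u i) := (J.s_meas i).pow 2

theorem U_meas (i : Fin n) : StronglyMeasurable (J.U i) :=
  ((J.s_meas i).const_mul 2).smul (J.g_meas i)

theorem drift_meas (i : Fin n) : StronglyMeasurable (J.drift i) :=
  (J.V_meas.fun_const_smul (P.z i)).add
    (Finset.stronglyMeasurable_fun_sum _ fun j _ => (J.U_meas j).fun_const_smul (P.a i j))

theorem F_meas (i : Fin n) : StronglyMeasurable (J.F i) :=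
  ((J.U_meas i).fun_const_smul P.σ).add ((J.u_meas i).smul (J.drift_meas i))

theorem memLp_u (i : Fin n) : MemLp (J.u i) 2 volume := J.u_memLp i

theorem memLp_U (i : Fin n) : MemLp (J.U i) 2 volume := J.U_memLp i

theorem drift_memLp (i : Fin n) : MemLp (J.drift i) 2 volume :=
  MemLp.add (f := fun q => P.z i • J.V q) (g := fun q => ∑ j, P.a i j • J.U j q)
    (J.V_memLp.const_smul (P.z i))
    (memLp_finsetSum _ fun j _ => (J.memLp_U j).const_smul (P.a i j))

theorem u_zero (i : Fin n) (q : ℝ × E d) (hq : q ∉ P.cyl) : J.u i q = 0 := by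
  simp [u, J.s_zero i q hq]

theorem U_zero (i : Fin n) (q : ℝ × E d) (hq : q ∉ P.cyl) : J.U i q = 0 := by
  simp [U, J.s_zero i q hq]

theorem F_zero (i : Fin n) (q : ℝ × E d) (hq : q ∉ P.cyl) : J.F i q = 0 := by
  simp [F, J.u_zero i q hq, J.U_zero i q hq]

/-- The term u·∇(zΦ + p(u)) is a product of two L² functions, so the flux of a weak solution is only
integrable. Hence its equation may only be tested with functions of bounded gradient. -/
theorem F_memLp_one (hb : Bornology.IsBounded P.Ω) (hΩ : IsOpen P.Ω) (i : Fin n) :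
    MemLp (J.F i) 1 volume := by
  have := isFiniteMeasure_restrict_of_isBounded hb
  refine memLp_volume_of_zero hΩ (J.F_zero i) ?_
  rw [← volume_restrict_cyl]
  refine MemLp.add ?_ (((J.drift_memLp i).smul (J.memLp_u i)).restrict P.cyl)
  have : IsFiniteMeasure ((volume : Measure (ℝ × E d)).restrict P.cyl) := by
    rw [volume_restrict_cyl]; infer_instance
  exact (((J.memLp_U i).const_smul P.σ).restrict P.cyl).mono_exponent (by norm_num)

/-- Bounded gradients make the drift bounded, so the flux of a strong solution is in L² and its
equation accepts every H¹ test function. -/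
theorem F_memLp_two {M : ℝ} (hV : ∀ q, ‖J.V q‖ ≤ M) (hU : ∀ i q, ‖J.U i q‖ ≤ M) (i : Fin n) :
    MemLp (J.F i) 2 volume := by
  refine MemLp.add ((J.memLp_U i).const_smul P.σ) ?_
  refine MemLp.of_le_mul (c := ‖P.z i‖ * M + ∑ j, ‖P.a i j‖ * M) (J.memLp_u i)
    ((J.u_meas i).smul (J.drift_meas i)).aestronglyMeasurable (.of_forall fun q => ?_)
  rw [norm_smul, mul_comm]
  refine mul_le_mul_of_nonneg_right ((norm_add_le _ _).trans (add_le_add ?_ ?_)) (norm_nonneg _)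
  · rw [norm_smul]; exact mul_le_mul_of_nonneg_left (hV q) (norm_nonneg _)
  · refine (norm_sum_le _ _).trans (Finset.sum_le_sum fun j _ => ?_)
    rw [norm_smul]; exact mul_le_mul_of_nonneg_left (hU j q) (norm_nonneg _)

theorem negFlux_eq (i : Fin n) : ∀ᵐ t ∂(volume.restrict (Ioo 0 P.T)),
    negFlux P (fun j => S.u j t) (S.Φ t) i =ᵐ[volume.restrict P.Ω] fun x => J.F i (t, x) := by
  filter_upwards [J.V_eq, ae_all_iff.2 J.u_eq, ae_all_iff.2 J.u_grad_eq] with t h1 h2 h3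
  filter_upwards [h1, ae_all_iff.2 h2, ae_all_iff.2 h3] with x h4 h5 h6
  simp only [negFlux, driftGrad, F, drift, u, U, h4, h5, h6]

end JointRep

end StericPNP

namespace StericPNP

/-! ### The integrated equation -/

theorem tendsto_eLpNorm_comp_snd {α β G : Type*} [MeasurableSpace α] [MeasurableSpace β]
    [NormedAddCommGroup G] {ν : Measure α} [IsFiniteMeasure ν] {μ : Measure β} [SFinite μ]
    {p : ℝ≥0∞} {f : ℕ → β → G} (hf : ∀ k, AEStronglyMeasurable (f k) μ)
    (h : Tendsto (fun k => eLpNorm (f k) p μ) atTop (𝓝 0)) :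
    Tendsto (fun k => eLpNorm (fun q : α × β => f k q.2) p (ν.prod μ)) atTop (𝓝 0) := by
  have hfin : ν univ ^ (1 / p).toReal ≠ ⊤ :=
    ENNReal.rpow_ne_top_of_nonneg ENNReal.toReal_nonneg (measure_ne_top _ _)
  have h2 := ENNReal.Tendsto.const_mul h (Or.inr hfin)
  rw [mul_zero] at h2
  refine tendsto_of_tendsto_of_tendsto_of_le_of_le tendsto_const_nhds h2
    (fun _ => zero_le) fun k => ?_
  have h3 := eLpNorm_smul_measure_le (ν univ) (f k) p μ
  rw [smul_eq_mul] at h3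
  refine le_trans (le_of_eq ?_) h3
  rw [← Measure.map_snd_prod, eLpNorm_map_measure _ measurable_snd.aemeasurable]
  · rfl
  · rw [Measure.map_snd_prod]; exact (hf k).smul_measure _

theorem tendsto_integral_of_tendsto_eLpNorm {α : Type*} [MeasurableSpace α] {μ : Measure α}
    {f : ℕ → α → ℝ} {g : α → ℝ} (hg : Integrable g μ) (hf : ∀ k, AEStronglyMeasurable (f k) μ)
    (h : Tendsto (fun k => eLpNorm (f k - g) 1 μ) atTop (𝓝 0)) :
    Tendsto (fun k => ∫ x, f k x ∂μ) atTop (𝓝 (∫ x, g x ∂μ)) := by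
  have hev : ∀ᶠ k in atTop, Integrable (f k) μ := by
    filter_upwards [h.eventually (gt_mem_nhds ENNReal.zero_lt_top)] with k hk
    have h1 : Integrable (f k - g) μ :=
      memLp_one_iff_integrable.1 ⟨(hf k).sub hg.1, hk⟩
    simpa using h1.add hg
  exact tendsto_integral_of_L1' g hg.1 hev h

theorem integrable_inner_of_memLp {α G : Type*} [MeasurableSpace α] {μ : Measure α}
    [NormedAddCommGroup G] [InnerProductSpace ℝ G] {f g : α → G} (hf : MemLp f 2 μ)
    (hg : MemLp g 2 μ) : Integrable (fun x => ⟪f x, g x⟫_ℝ) μ :=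
  (hf.norm.integrable_mul hg.norm).mono' (hf.1.inner hg.1)
    (.of_forall fun x => norm_inner_le_norm _ _)

theorem tendsto_integral_inner_of_memLp {α G : Type*} [MeasurableSpace α] {μ : Measure α}
    [NormedAddCommGroup G] [InnerProductSpace ℝ G] {f : α → G} {g : ℕ → α → G}
    {g₀ : α → G} (hf : MemLp f 2 μ) (hg : ∀ k, MemLp (g k) 2 μ) (hg₀ : MemLp g₀ 2 μ)
    (h : Tendsto (fun k => eLpNorm (g k - g₀) 2 μ) atTop (𝓝 0)) :
    Tendsto (fun k => ∫ x, ⟪f x, g k x⟫_ℝ ∂μ) atTop (𝓝 (∫ x, ⟪f x, g₀ x⟫_ℝ ∂μ)) := by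
  refine tendsto_integral_of_tendsto_eLpNorm (integrable_inner_of_memLp hf hg₀)
    (fun k => hf.1.inner (hg k).1) ?_
  have h0 : Tendsto (fun _ : ℕ => eLpNorm (f - f) 2 μ) atTop (𝓝 0) := by simp
  exact tendsto_eLpNorm_bilin (p := 2) (q := 2) (by norm_num) (by norm_num)
    (innerSL ℝ) (fun _ => hf.1) (fun k => (hg k).1) hf hg₀ h0 h

/-- A smooth truncation of the identity: bounded by k+1, dominated by |s|, with derivative
cos(s/(k+1)) of modulus at most 1 tending to 1. -/
theorem tendsto_nat_mul_sin_div (s : ℝ) :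
    Tendsto (fun k : ℕ => (k + 1 : ℝ) * Real.sin (s / (k + 1))) atTop (𝓝 s) := by
  have h0 : Tendsto (fun k : ℕ => s / ((k : ℝ) + 1)) atTop (𝓝 0) := by
    simpa [div_eq_mul_inv] using (tendsto_one_div_add_atTop_nhds_zero_nat (𝕜 := ℝ)).const_mul s
  have h1 : Tendsto (fun k : ℕ => s * Real.sinc (s / (k + 1))) atTop (𝓝 (s * 1)) := by
    have := (Real.continuous_sinc.tendsto 0).comp h0
    rw [Real.sinc_zero] at this
    exact this.const_mul s
  rw [mul_one] at h1
  refine h1.congr fun k => ?_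
  have hk : (k + 1 : ℝ) ≠ 0 := by positivity
  rcases eq_or_ne s 0 with rfl | hs
  · simp
  · rw [Real.sinc_of_ne_zero (div_ne_zero hs hk)]; field_simp

variable {d n : ℕ} {P : Data d n}

/-- `w` is the density of species `i` at time `t`, including `t = 0`. -/
def WeakSolution.IsTrace (S : WeakSolution P) (i : Fin n) (t : ℝ) (w : E d → ℝ) : Prop :=
  MemLp w 2 (volume.restrict P.Ω) ∧ ∀ φ : W1 P.Ω 4, S.rep i t φ = ∫ x in P.Ω, w x * fn φ x

namespace JointRep

variable {S : WeakSolution P} (J : JointRep S)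

theorem integral_trace_sub_of_W14 {i : Fin n} {r r' : ℝ} (hr : 0 ≤ r)
    (hrr : r ≤ r') (hr' : r' ≤ P.T) {w w' : E d → ℝ} (hw : S.IsTrace i r w)
    (hw' : S.IsTrace i r' w') (φ : W1 P.Ω 4)
    (hint : Integrable (fun q : ℝ × E d => ⟪J.F i q, wgrad φ q.2⟫_ℝ)
      ((volume.restrict (Ioo r r')).prod (volume.restrict P.Ω))) :
    (∫ x in P.Ω, w' x * fn φ x) - ∫ x in P.Ω, w x * fn φ x =
      - ∫ q, ⟪J.F i q, wgrad φ q.2⟫_ℝ ∂((volume.restrict (Ioo r r')).prod (volume.restrict P.Ω)) := by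
  rw [← hw.2 φ, ← hw'.2 φ, S.rep_sub_rep i φ hr hrr hr', integral_prod _ hint, ← integral_neg]
  refine integral_congr_ae ?_
  have hsub : Ioo r r' ⊆ Ioo 0 P.T := Ioo_subset_Ioo hr hr'
  filter_upwards [ae_restrict_of_ae_restrict_of_subset hsub (S.equation i),
    ae_restrict_of_ae_restrict_of_subset hsub (J.negFlux_eq i)] with t h1 h2
  have h3 := h1 φ
  have h4 : ∫ x in P.Ω, ⟪negFlux P (fun j => S.u j t) (S.Φ t) i x, wgrad φ x⟫_ℝ =
      ∫ x in P.Ω, ⟪J.F i (t, x), wgrad φ x⟫_ℝ := integral_congr_ae (by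
    filter_upwards [h2] with x hx; rw [hx])
  rw [h4] at h3
  linarith

/-- The truncation (k+1) sin(ψ/(k+1)) has bounded values and gradient, so it is a test function in
W^{1,4}. Values and gradients are dominated by |ψ| and by M, so dominated convergence removes the
truncation even though the flux is only in L¹. -/
theorem integral_trace_sub_of_bounded (hΩ : IsOpen P.Ω) (hb : Bornology.IsBounded P.Ω)
    (hL : HasLipschitzBoundary P.Ω) {i : Fin n} {r r' : ℝ} (hr : 0 ≤ r)
    (hrr : r ≤ r') (hr' : r' ≤ P.T) {w w' : E d → ℝ} (hw : S.IsTrace i r w)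
    (hw' : S.IsTrace i r' w') (ψ : H1 P.Ω) {M : ℝ}
    (hM : ∀ᵐ x ∂(volume.restrict P.Ω), ‖wgrad ψ x‖ ≤ M) :
    (∫ x in P.Ω, (w' x - w x) * fn ψ x) =
      - ∫ q, ⟪J.F i q, wgrad ψ q.2⟫_ℝ ∂((volume.restrict (Ioo r r')).prod (volume.restrict P.Ω)) := by
  have := isFiniteMeasure_restrict_of_isBounded hb
  set μ := (volume.restrict (Ioo r r')).prod (volume.restrict P.Ω) with hμ
  have hF : Integrable (J.F i) μ := by
    rw [hμ, Measure.prod_restrict, ← Measure.volume_eq_prod]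
    exact (memLp_one_iff_integrable.1 (J.F_memLp_one hb hΩ i)).restrict
  have hsnd : ∀ {p : E d → Prop}, (∀ᵐ x ∂(volume.restrict P.Ω), p x) → ∀ᵐ q ∂μ, p q.2 :=
    fun h => Measure.quasiMeasurePreserving_snd.ae h
  have hchain : ∀ k : ℕ, _ := fun k => hasWeakGradient_comp hΩ hb hL ψ
    (g := fun s => (k + 1 : ℝ) * Real.sin (s / (k + 1))) (K := 1)
    (contDiff_const.mul (Real.contDiff_sin.comp (contDiff_id.div_const _)))
    (fun s => by
      have hk : (k + 1 : ℝ) ≠ 0 := by positivity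
      have : HasDerivAt (fun s : ℝ => (k + 1 : ℝ) * Real.sin (s / (k + 1)))
          ((k + 1 : ℝ) * (Real.cos (s / (k + 1)) * (1 / (k + 1)))) s :=
        (((hasDerivAt_id s).div_const _).sin).const_mul _
      rw [this.deriv]
      field_simp
      exact Real.abs_cos_le_one _)
  have hderiv : ∀ (k : ℕ) (s : ℝ), deriv (fun s : ℝ => (k + 1 : ℝ) * Real.sin (s / (k + 1))) s =
      Real.cos (s / (k + 1)) := fun k s => by
    have hk : (k + 1 : ℝ) ≠ 0 := by positivity
    have : HasDerivAt (fun s : ℝ => (k + 1 : ℝ) * Real.sin (s / (k + 1)))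
        ((k + 1 : ℝ) * (Real.cos (s / (k + 1)) * (1 / (k + 1)))) s :=
      (((hasDerivAt_id s).div_const _).sin).const_mul _
    rw [this.deriv]
    field_simp
  have hbd : ∀ᵐ x ∂(volume.restrict P.Ω), ∀ k : ℕ,
      ‖Real.cos (fn ψ x / (k + 1)) • wgrad ψ x‖ ≤ M := by
    filter_upwards [hM] with x hx k
    rw [norm_smul]
    exact (mul_le_of_le_one_left (norm_nonneg _) (Real.abs_cos_le_one _)).trans hx
  have hex : ∀ k : ℕ, ∃ φ : W1 P.Ω 4,
      fn φ =ᵐ[volume.restrict P.Ω] (fun x => (k + 1 : ℝ) * Real.sin (fn ψ x / (k + 1))) ∧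
      wgrad φ =ᵐ[volume.restrict P.Ω] fun x => Real.cos (fn ψ x / (k + 1)) • wgrad ψ x := by
    intro k
    obtain ⟨h1, h2, h3⟩ := hchain k
    simp only [hderiv] at h2 h3
    refine exists_W1 (MemLp.of_bound h1.1 (k + 1 : ℝ) (.of_forall fun x => ?_))
      (MemLp.of_bound h2.1 M ?_) h3
    · rw [norm_mul, Real.norm_of_nonneg (by positivity : (0 : ℝ) ≤ k + 1)]
      exact mul_le_of_le_one_right (by positivity) (Real.abs_sin_le_one _)
    · filter_upwards [hbd] with x hx using hx k
  choose φ hφ1 hφ2 using hex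
  have hgm : ∀ k, AEStronglyMeasurable (fun q : ℝ × E d => wgrad (φ k) q.2) μ :=
    fun k => (wgrad_memLp (φ k)).1.comp_snd
  have hgb : ∀ k, ∀ᵐ q ∂μ, ‖⟪J.F i q, wgrad (φ k) q.2⟫_ℝ‖ ≤ ‖J.F i q‖ * M := by
    intro k
    filter_upwards [hsnd hbd, hsnd (hφ2 k)] with q h1 h2
    refine (norm_inner_le_norm _ _).trans (mul_le_mul_of_nonneg_left ?_ (norm_nonneg _))
    rw [h2]; exact h1 k
  have hid : ∀ k, (∫ x in P.Ω, (w' x - w x) * fn (φ k) x) =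
      - ∫ q, ⟪J.F i q, wgrad (φ k) q.2⟫_ℝ ∂μ := by
    intro k
    have h4 : MemLp (fn (φ k)) 2 (volume.restrict P.Ω) := (hchain k).1.ae_eq (hφ1 k).symm
    rw [hμ, ← J.integral_trace_sub_of_W14 hr hrr hr' hw hw' (φ k)
      ((hF.norm.mul_const M).mono' (hF.1.inner (hgm k)) (hgb k)), ← integral_sub]
    · simp only [sub_mul]
    · exact hw'.1.integrable_mul h4
    · exact hw.1.integrable_mul h4
  have l1 : Tendsto (fun k => ∫ x in P.Ω, (w' x - w x) * fn (φ k) x) atTop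
      (𝓝 (∫ x in P.Ω, (w' x - w x) * fn ψ x)) := by
    have hdom : Integrable (fun x => ‖(w' x - w x) * fn ψ x‖) (volume.restrict P.Ω) :=
      (MemLp.integrable_mul (hw'.1.sub hw.1) (fn_memLp ψ)).norm
    refine tendsto_integral_of_dominated_convergence _
      (fun k => (hw'.1.1.sub hw.1.1).mul (fn_memLp (φ k)).1) hdom (fun k => ?_) ?_
    · filter_upwards [hφ1 k] with x hx
      rw [norm_mul, norm_mul]
      refine mul_le_mul_of_nonneg_left ?_ (norm_nonneg _)
      have hk : (0 : ℝ) < k + 1 := by positivity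
      rw [hx, norm_mul, Real.norm_of_nonneg hk.le]
      calc (k + 1 : ℝ) * ‖Real.sin (fn ψ x / (k + 1))‖ ≤ (k + 1) * |fn ψ x / (k + 1)| :=
            mul_le_mul_of_nonneg_left Real.abs_sin_le_abs hk.le
        _ = ‖fn ψ x‖ := by rw [abs_div, abs_of_pos hk, Real.norm_eq_abs]; field_simp
    · filter_upwards [ae_all_iff.2 hφ1] with x hx
      simp only [hx]
      exact (tendsto_nat_mul_sin_div _).const_mul _
  have l2 : Tendsto (fun k => ∫ q, ⟪J.F i q, wgrad (φ k) q.2⟫_ℝ ∂μ) atTop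
      (𝓝 (∫ q, ⟪J.F i q, wgrad ψ q.2⟫_ℝ ∂μ)) := by
    refine tendsto_integral_of_dominated_convergence _ (fun k => hF.1.inner (hgm k))
      (hF.norm.mul_const M) hgb ?_
    filter_upwards [hsnd (ae_all_iff.2 hφ2)] with q hq
    simp only [hq]
    refine tendsto_const_nhds.inner ?_
    have h0 : Tendsto (fun k : ℕ => fn ψ q.2 / ((k : ℝ) + 1)) atTop (𝓝 0) := by
      simpa [div_eq_mul_inv] using
        (tendsto_one_div_add_atTop_nhds_zero_nat (𝕜 := ℝ)).const_mul (fn ψ q.2)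
    have := ((Real.continuous_cos.tendsto 0).comp h0).smul_const (wgrad ψ q.2)
    rw [Real.cos_zero, one_smul] at this
    exact this
  exact tendsto_nhds_unique l1 (l2.neg.congr fun k => (hid k).symm)

/-- With a square integrable flux both sides are continuous in ψ for the H¹ norm, and compactly
supported smooth functions, which lie in W^{1,4}, approximate ψ. -/
theorem integral_trace_sub_of_memLp (hΩ : IsOpen P.Ω) (hb : Bornology.IsBounded P.Ω)
    (hL : HasLipschitzBoundary P.Ω) {i : Fin n} (hF2 : MemLp (J.F i) 2 volume)
    {r r' : ℝ} (hr : 0 ≤ r)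
    (hrr : r ≤ r') (hr' : r' ≤ P.T) {w w' : E d → ℝ} (hw : S.IsTrace i r w)
    (hw' : S.IsTrace i r' w') (ψ : H1 P.Ω) :
    (∫ x in P.Ω, (w' x - w x) * fn ψ x) =
      - ∫ q, ⟪J.F i q, wgrad ψ q.2⟫_ℝ ∂((volume.restrict (Ioo r r')).prod (volume.restrict P.Ω)) := by
  have := isFiniteMeasure_restrict_of_isBounded hb
  set μ := (volume.restrict (Ioo r r')).prod (volume.restrict P.Ω) with hμ
  have hF : MemLp (J.F i) 2 μ := by
    rw [hμ, Measure.prod_restrict, ← Measure.volume_eq_prod]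
    exact hF2.restrict _
  obtain ⟨f, hf, hfc, hf1, hf2, -⟩ := exists_contDiff_approx_ae hΩ hb hL ψ
  have hf' : ∀ k, ContDiff ℝ 1 (f k) := fun k => (hf k).of_le (by simp)
  have hfm : ∀ k, MemLp (f k) 2 (volume.restrict P.Ω) := fun k =>
    ((hf k).continuous.memLp_of_hasCompactSupport (hfc k)).restrict _
  have hgm : ∀ k, MemLp (∇ (f k)) 2 (volume.restrict P.Ω) := fun k =>
    ((continuous_gradient (hf' k)).memLp_of_hasCompactSupport
      (hasCompactSupport_gradient (hfc k))).restrict _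
  have hid : ∀ k, (∫ x in P.Ω, (w' x - w x) * f k x) = - ∫ q, ⟪J.F i q, ∇ (f k) q.2⟫_ℝ ∂μ := by
    intro k
    obtain ⟨φ, h1, h2⟩ := exists_W1_of_contDiff (Ω := P.Ω) (p := 4) (hf' k) (hfc k)
    have e1 : ∀ v : E d → ℝ, ∫ x in P.Ω, v x * fn φ x = ∫ x in P.Ω, v x * f k x := fun v =>
      integral_congr_ae (by filter_upwards [h1] with x hx; rw [hx])
    have e2 : (fun q : ℝ × E d => ⟪J.F i q, wgrad φ q.2⟫_ℝ) =ᵐ[μ]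
        fun q => ⟪J.F i q, ∇ (f k) q.2⟫_ℝ := by
      filter_upwards [Measure.quasiMeasurePreserving_snd.ae h2] with q hq
      rw [hq]
    have i2 : Integrable (fun q : ℝ × E d => ⟪J.F i q, ∇ (f k) q.2⟫_ℝ) μ :=
      integrable_inner_of_memLp hF ((hgm k).comp_snd _)
    have h5 := J.integral_trace_sub_of_W14 hr hrr hr' hw hw' φ (i2.congr e2.symm)
    rw [← hμ, integral_congr_ae e2, e1, e1] at h5
    rw [← h5, ← integral_sub]
    · simp only [sub_mul]
    · exact hw'.1.integrable_mul (hfm k)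
    · exact hw.1.integrable_mul (hfm k)
  have l1 : Tendsto (fun k => ∫ x in P.Ω, (w' x - w x) * f k x) atTop
      (𝓝 (∫ x in P.Ω, (w' x - w x) * fn ψ x)) := by
    have h1 := tendsto_integral_inner_of_memLp (hw'.1.sub hw.1) hfm (fn_memLp ψ) hf1
    simpa [mul_comm] using h1
  have l2 : Tendsto (fun k => ∫ q, ⟪J.F i q, ∇ (f k) q.2⟫_ℝ ∂μ) atTop
      (𝓝 (∫ q, ⟪J.F i q, wgrad ψ q.2⟫_ℝ ∂μ)) := by
    have m1 : ∀ k, MemLp (fun q : ℝ × E d => ∇ (f k) q.2) 2 μ := fun k => (hgm k).comp_snd _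
    have m2 : MemLp (fun q : ℝ × E d => wgrad ψ q.2) 2 μ := (wgrad_memLp ψ).comp_snd _
    have h3 := tendsto_eLpNorm_comp_snd (ν := volume.restrict (Ioo r r'))
      (f := fun k => ∇ (f k) - wgrad ψ) (fun k => ((hgm k).sub (wgrad_memLp ψ)).1) hf2
    exact tendsto_integral_inner_of_memLp (g := fun k (q : ℝ × E d) => ∇ (f k) q.2)
      (g₀ := fun q : ℝ × E d => wgrad ψ q.2) hF m1 m2 h3
  exact tendsto_nhds_unique l1 (l2.neg.congr fun k => (hid k).symm)

end JointRep

end StericPNP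

namespace StericPNP

/-! ### The interaction form and the two-point inequality -/

theorem VanishesOn.sub {d : ℕ} {Ω Γ : Set (E d)} {v w : H1 Ω} (hv : VanishesOn Γ v)
    (hw : VanishesOn Γ w) : VanishesOn Γ (v - w) := by
  obtain ⟨f, hf, hf1, hf2, hf3⟩ := hv
  obtain ⟨g, hg, hg1, hg2, hg3⟩ := hw
  have key : ∀ {G : Type} [NormedAddCommGroup G] (μ : Measure (E d)) (a b : ℕ → E d → G),
      (∀ k, AEStronglyMeasurable (a k) μ) → (∀ k, AEStronglyMeasurable (b k) μ) →
      Tendsto (fun k => eLpNorm (a k) 2 μ) atTop (𝓝 0) →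
      Tendsto (fun k => eLpNorm (b k) 2 μ) atTop (𝓝 0) →
      Tendsto (fun k => eLpNorm (a k - b k) 2 μ) atTop (𝓝 0) := by
    intro G _ μ a b ha hb la lb
    have := la.add lb
    rw [add_zero] at this
    exact tendsto_of_tendsto_of_tendsto_of_le_of_le tendsto_const_nhds this (fun _ => zero_le)
      fun k => eLpNorm_sub_le (ha k) (hb k) (by norm_num)
  have hgr : ∀ k, Continuous (∇ (f k)) := fun k => continuous_gradient ((hf k).of_le (by simp))
  have hgr' : ∀ k, Continuous (∇ (g k)) := fun k => continuous_gradient ((hg k).of_le (by simp))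
  refine ⟨fun k => f k - g k, fun k => (hf k).sub (hg k), ?_, ?_, ?_⟩
  · refine (key _ _ _ (fun k => ((hf k).continuous.aestronglyMeasurable.sub (fn_memLp v).1))
      (fun k => ((hg k).continuous.aestronglyMeasurable.sub (fn_memLp w).1)) hf1 hg1).congr
      fun k => eLpNorm_congr_ae ?_
    filter_upwards [fn_sub v w] with x hx
    simp only [Pi.sub_apply, hx]; ring
  · refine (key _ _ _ (fun k => ((hgr k).aestronglyMeasurable.sub (wgrad_memLp v).1))
      (fun k => ((hgr' k).aestronglyMeasurable.sub (wgrad_memLp w).1)) hf2 hg2).congr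
      fun k => eLpNorm_congr_ae ?_
    filter_upwards [wgrad_sub v w] with x hx
    have h1 : ∇ (f k - g k) x = ∇ (f k) x - ∇ (g k) x := by
      simp only [gradient]
      rw [fderiv_sub ((hf k).differentiable (by simp) x) ((hg k).differentiable (by simp) x),
        map_sub]
    simp only [Pi.sub_apply, hx, h1]; abel
  · exact key _ _ _ (fun k => (hf k).continuous.aestronglyMeasurable)
      (fun k => (hg k).continuous.aestronglyMeasurable) hf3 hg3

theorem VanishesOn.smul {d : ℕ} {Ω Γ : Set (E d)} {v : H1 Ω} (hv : VanishesOn Γ v) (c : ℝ) :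
    VanishesOn Γ (c • v) := by
  obtain ⟨f, hf, hf1, hf2, hf3⟩ := hv
  have key : ∀ {G : Type} [NormedAddCommGroup G] [NormedSpace ℝ G] (μ : Measure (E d))
      (a : ℕ → E d → G),
      Tendsto (fun k => eLpNorm (a k) 2 μ) atTop (𝓝 0) →
      Tendsto (fun k => eLpNorm (c • a k) 2 μ) atTop (𝓝 0) := by
    intro G _ _ μ a la
    have := ENNReal.Tendsto.const_mul (a := ‖c‖ₑ) la (Or.inr enorm_ne_top)
    simpa only [eLpNorm_const_smul, mul_zero] using this
  refine ⟨fun k => c • f k, fun k => contDiff_const.smul (hf k), ?_, ?_, key _ _ hf3⟩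
  · refine (key _ _ hf1).congr fun k => eLpNorm_congr_ae ?_
    filter_upwards [fn_smul c v] with x hx
    simp only [Pi.smul_apply, Pi.sub_apply, hx, smul_eq_mul]; ring
  · refine (key _ _ hf2).congr fun k => eLpNorm_congr_ae ?_
    filter_upwards [wgrad_smul c v] with x hx
    have h1 : ∇ (c • f k) x = c • ∇ (f k) x := by
      simp only [gradient]
      rw [fderiv_const_smul ((hf k).differentiable (by simp) x), map_smul]
    simp only [Pi.smul_apply, Pi.sub_apply, hx, h1, smul_sub]

theorem VanishesOn.add {d : ℕ} {Ω Γ : Set (E d)} {v w : H1 Ω} (hv : VanishesOn Γ v)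
    (hw : VanishesOn Γ w) : VanishesOn Γ (v + w) := by
  have h : v - (-1 : ℝ) • w = v + w := by module
  exact h ▸ hv.sub (hw.smul (-1))

variable {d n : ℕ} {P : Data d n}

/-- The bilinear form of the interaction matrix. -/
def Data.bil (P : Data d n) (x y : Fin n → ℝ) : ℝ := ∑ i, x i * ∑ j, P.a i j * y j

theorem bil_sub_left (x x' y : Fin n → ℝ) : P.bil (x - x') y = P.bil x y - P.bil x' y := by
  simp [Data.bil, sub_mul, Finset.sum_sub_distrib]

theorem bil_sub_right (x y y' : Fin n → ℝ) : P.bil x (y - y') = P.bil x y - P.bil x y' := by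
  simp [Data.bil, mul_sub, Finset.sum_sub_distrib]

theorem bil_eq (x y : Fin n → ℝ) : P.bil x y = ∑ i, ∑ j, P.a i j * x i * y j := by
  simp only [Data.bil, Finset.mul_sum]
  exact Finset.sum_congr rfl fun i _ => Finset.sum_congr rfl fun j _ => by ring

theorem bil_comm (hP : Assumptions P) (x y : Fin n → ℝ) : P.bil x y = P.bil y x := by
  rw [bil_eq, bil_eq, Finset.sum_comm]
  refine Finset.sum_congr rfl fun i _ => Finset.sum_congr rfl fun j _ => ?_
  have : P.a j i = P.a i j := by
    have := hP.a_posDef.isHermitian.apply i j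
    simpa using this
  rw [this]; ring

theorem bil_self_pos (hP : Assumptions P) {x : Fin n → ℝ} (hx : x ≠ 0) : 0 < P.bil x x := by
  have := hP.a_posDef.dotProduct_mulVec_pos hx
  simpa [dotProduct, Matrix.mulVec, Data.bil] using this

theorem bil_self_nonneg (hP : Assumptions P) (x : Fin n → ℝ) : 0 ≤ P.bil x x := by
  rcases eq_or_ne x 0 with rfl | hx
  · simp [Data.bil]
  · exact (bil_self_pos hP hx).le

theorem exists_bil_coercive (hP : Assumptions P) :
    ∃ c > 0, ∀ x : Fin n → ℝ, c * ∑ i, x i ^ 2 ≤ P.bil x x := by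
  have hcont : Continuous fun x : Fin n → ℝ => P.bil x x := by
    unfold Data.bil; fun_prop
  obtain ⟨c, hc, h⟩ : ∃ c > 0, ∀ x ∈ Metric.sphere (0 : Fin n → ℝ) 1, c ≤ P.bil x x := by
    -- The unit sphere is empty exactly when n = 0.
    rcases (Metric.sphere (0 : Fin n → ℝ) 1).eq_empty_or_nonempty with he | hne
    · exact ⟨1, one_pos, fun x hx => by simp [he] at hx⟩
    · obtain ⟨x₀, hx₀, hmin⟩ := (isCompact_sphere (0 : Fin n → ℝ) 1).exists_isMinOn hne
        hcont.continuousOn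
      refine ⟨P.bil x₀ x₀, bil_self_pos hP ?_, fun x hx => hmin hx⟩
      rintro rfl
      simp at hx₀
  have hsc : ∀ x : Fin n → ℝ, c * ‖x‖ ^ 2 ≤ P.bil x x := by
    intro x
    rcases eq_or_ne x 0 with rfl | hx
    · simp [Data.bil]
    · have hn : 0 < ‖x‖ := norm_pos_iff.2 hx
      have h1 := h (‖x‖⁻¹ • x) (by simp [norm_smul, hn.ne'])
      have h2 : P.bil (‖x‖⁻¹ • x) (‖x‖⁻¹ • x) = (‖x‖⁻¹) ^ 2 * P.bil x x := by
        rw [bil_eq, bil_eq, Finset.mul_sum]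
        refine Finset.sum_congr rfl fun i _ => ?_
        rw [Finset.mul_sum]
        refine Finset.sum_congr rfl fun j _ => ?_
        simp only [Pi.smul_apply, smul_eq_mul]; ring
      rw [h2, inv_pow, ← div_eq_inv_mul, le_div_iff₀ (by positivity)] at h1
      exact h1
  -- Passage from the sup norm to the sum of squares costs a factor n; the 1 keeps the denominator
  -- positive when n = 0.
  refine ⟨c / (n + 1), by positivity, fun x => le_trans ?_ (hsc x)⟩
  have h3 : ∑ i, x i ^ 2 ≤ n * ‖x‖ ^ 2 := by
    calc ∑ i, x i ^ 2 ≤ ∑ _i : Fin n, ‖x‖ ^ 2 := Finset.sum_le_sum fun i _ => by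
          rw [← sq_abs, ← Real.norm_eq_abs]
          exact pow_le_pow_left₀ (norm_nonneg _) (norm_le_pi_norm x i) 2
      _ = n * ‖x‖ ^ 2 := by simp
  rw [div_mul_eq_mul_div, div_le_iff₀ (by positivity)]
  calc c * ∑ i, x i ^ 2 ≤ c * (n * ‖x‖ ^ 2) := mul_le_mul_of_nonneg_left h3 hc.le
    _ ≤ c * ‖x‖ ^ 2 * (n + 1) := by nlinarith [mul_nonneg hc.le (sq_nonneg ‖x‖)]

/-- The density of the linear-in-`u` part of the regularized relative entropy. -/
noncomputable def Data.crossDensity (P : Data d n) (ε φD : ℝ) (VD : E d) (u ub : Fin n → ℝ)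
    (V Vb : E d) : ℝ :=
  -∑ i, u i * (P.z i * φD + ∑ j, P.a i j * ub j + P.σ * Real.log (ub i + ε))
    - ⟪V, Vb - VD⟫_ℝ + 1 / 2 * ‖Vb - VD‖ ^ 2 + 1 / 2 * P.bil ub ub + P.σ * ∑ i, ub i

/-- The test function for the equation of `uᵢ`. -/
noncomputable def Data.testU (P : Data d n) (ε : ℝ) (ub : Fin n → ℝ) (φb : ℝ) (i : Fin n) : ℝ :=
  P.z i * φb + ∑ j, P.a i j * ub j + P.σ * Real.log (ub i + ε)

/-- The test function for the equation of `ūᵢ`. -/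
noncomputable def Data.testB (P : Data d n) (ε : ℝ) (u ub : Fin n → ℝ) (φ φb : ℝ) (i : Fin n) : ℝ :=
  P.z i * (φ - φb) + ∑ j, P.a i j * (u j - ub j) + P.σ * (u i / (ub i + ε)) - P.σ

/-- The tangent of log at the later value b'+ε lies above the graph; multiply by u ≥ 0. This stands
in for the time derivative of u log(ū+ε) with u frozen. -/
theorem log_twoPoint {ε u b b' : ℝ} (hε : 0 < ε) (hu : 0 ≤ u) (hb : 0 ≤ b) (hb' : 0 ≤ b') :
    u * Real.log (b + ε) - u * Real.log (b' + ε) + (b' - b) * (u / (b' + ε)) ≤ 0 := by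
  have h1 : 0 < b + ε := by linarith
  have h2 : 0 < b' + ε := by linarith
  have h3 := Real.log_le_sub_one_of_pos (div_pos h1 h2)
  rw [Real.log_div h1.ne' h2.ne'] at h3
  have h4 : u * (Real.log (b + ε) - Real.log (b' + ε)) ≤ u * ((b + ε) / (b' + ε) - 1) :=
    mul_le_mul_of_nonneg_left h3 hu
  have h5 : u * ((b + ε) / (b' + ε) - 1) = - ((b' - b) * (u / (b' + ε))) := by
    field_simp; ring
  linarith

/-- Change u first, with ū already at the new time: this is exact by linearity and gives the `testU`
sum. Then change ū with u frozen: with δ = ub' − ub, expanding the squares gives the `testB` sum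
minus ½ bil(δ,δ) and ½‖Vb'−Vb‖², and minus the gap in `log_twoPoint`, all dropped. The last three
groups on the right compensate for writing φb', φ − φb' in the test functions; they will integrate
to zero. -/
theorem crossDensity_twoPoint (hP : Assumptions P) {ε φD φ φb' : ℝ} (hε : 0 < ε) {VD V V' Vb Vb' : E d}
    {u u' ub ub' : Fin n → ℝ} (hu : ∀ i, 0 ≤ u i) (hub : ∀ i, 0 ≤ ub i) (hub' : ∀ i, 0 ≤ ub' i) :
    P.crossDensity ε φD VD u' ub' V' Vb' - P.crossDensity ε φD VD u ub V Vb ≤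
      - ∑ i, (u' i - u i) * P.testU ε ub' φb' i - ∑ i, (ub' i - ub i) * P.testB ε u ub' φ φb' i
      + ((∑ i, P.z i * u' i - ∑ i, P.z i * u i) * (φb' - φD) - ⟪V' - V, Vb' - VD⟫_ℝ)
      + ((∑ i, P.z i * ub' i - ∑ i, P.z i * ub i) * (φ - φb') - ⟪Vb' - Vb, V - Vb'⟫_ℝ)
      + ⟪VD, Vb - Vb'⟫_ℝ := by
  have e1 : ∀ (x y : Fin n → ℝ) (φ : ℝ), ∑ i, x i * P.testU ε y φ i =
      (∑ i, P.z i * x i) * φ + P.bil x y + P.σ * ∑ i, x i * Real.log (y i + ε) := by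
    intro x y φ
    simp only [Data.testU, Data.bil, Finset.sum_mul, Finset.mul_sum, mul_add,
      Finset.sum_add_distrib]
    congr 1
    · congr 1
      exact Finset.sum_congr rfl fun i _ => by ring
    · exact Finset.sum_congr rfl fun i _ => by ring
  have e2 : ∀ (x : Fin n → ℝ), ∑ i, x i * P.testB ε u ub' φ φb' i =
      (∑ i, P.z i * x i) * (φ - φb') + P.bil x (u - ub')
        + P.σ * ∑ i, x i * (u i / (ub' i + ε)) - P.σ * ∑ i, x i := by
    intro x
    simp only [Data.testB, Data.bil, Finset.sum_mul, Finset.mul_sum, mul_add, mul_sub,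
      Finset.sum_add_distrib, Finset.sum_sub_distrib, Pi.sub_apply]
    congr 1
    · congr 1
      · congr 1
        rw [← Finset.sum_sub_distrib, ← Finset.sum_sub_distrib]
        exact Finset.sum_congr rfl fun i _ => by ring
      · exact Finset.sum_congr rfl fun i _ => by ring
    · exact Finset.sum_congr rfl fun i _ => by ring
  have e3 : ∀ x x' y : Fin n → ℝ, ∑ i, (x' i - x i) * y i = ∑ i, x' i * y i - ∑ i, x i * y i :=
    fun x x' y => by simp [sub_mul, Finset.sum_sub_distrib]
  have e4 : ∀ (x y : Fin n → ℝ) (V Vb : E d), P.crossDensity ε φD VD x y V Vb =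
      -∑ i, x i * P.testU ε y φD i - ⟪V, Vb - VD⟫_ℝ + 1 / 2 * ‖Vb - VD‖ ^ 2
        + 1 / 2 * P.bil y y + P.σ * ∑ i, y i := fun _ _ _ _ => rfl
  rw [e4, e4, e3, e3]
  simp only [e1, e2]
  have hlog : ∑ i, u i * Real.log (ub i + ε) - ∑ i, u i * Real.log (ub' i + ε)
      + (∑ i, ub' i * (u i / (ub' i + ε)) - ∑ i, ub i * (u i / (ub' i + ε))) ≤ 0 := by
    rw [← Finset.sum_sub_distrib, ← Finset.sum_sub_distrib, ← Finset.sum_add_distrib]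
    refine Finset.sum_nonpos fun i _ => ?_
    have := log_twoPoint hε (hu i) (hub i) (hub' i)
    linarith
  have hσ := mul_nonpos_of_nonneg_of_nonpos hP.σ_pos.le hlog
  have hquad := bil_self_nonneg hP (ub' - ub)
  have hnorm := sq_nonneg ‖Vb' - Vb‖
  rw [← real_inner_self_eq_norm_sq] at hnorm
  rw [← real_inner_self_eq_norm_sq, ← real_inner_self_eq_norm_sq]
  simp only [bil_sub_left, bil_sub_right, inner_sub_left, inner_sub_right] at hquad hnorm ⊢
  have c1 := bil_comm hP ub' ub
  have c2 := bil_comm hP u ub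
  have c3 := bil_comm hP u ub'
  have i1 := real_inner_comm Vb' Vb
  have i2 := real_inner_comm Vb VD
  have i3 := real_inner_comm Vb' VD
  have i4 := real_inner_comm V Vb
  have i5 := real_inner_comm V Vb'
  nlinarith [hσ, hquad, hnorm]

end StericPNP

namespace StericPNP

/-! ### The linear part of the relative entropy -/

variable {d n : ℕ} {P : Data d n}

section Integrability

variable {α : Type*} [MeasurableSpace α] {μ : Measure α} [IsFiniteMeasure μ]

theorem abs_log_add_le {ε b : ℝ} (hε : 0 < ε) (hb : 0 ≤ b) :
    |Real.log (b + ε)| ≤ (|Real.log ε| + ε) + b := by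
  have h1 : Real.log ε ≤ Real.log (b + ε) := Real.log_le_log hε (by linarith)
  have h2 : Real.log (b + ε) ≤ b + ε - 1 := Real.log_le_sub_one_of_pos (by linarith)
  rw [abs_le]
  constructor
  · linarith [neg_abs_le (Real.log ε)]
  · linarith [abs_nonneg (Real.log ε)]

theorem memLp_log_add {ε : ℝ} (hε : 0 < ε) {b : α → ℝ} (hb : MemLp b 2 μ)
    (h0 : ∀ᵐ x ∂μ, 0 ≤ b x) : MemLp (fun x => Real.log (b x + ε)) 2 μ := by
  refine MemLp.mono ((memLp_const (|Real.log ε| + ε)).add hb)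
    (Real.measurable_log.comp_aemeasurable
      (hb.1.aemeasurable.add_const ε)).aestronglyMeasurable ?_
  filter_upwards [h0] with x hx
  rw [Real.norm_eq_abs, Real.norm_eq_abs, Pi.add_apply, abs_of_nonneg (a := _ + b x) (by positivity)]
  exact abs_log_add_le hε hx

theorem memLp_div_add {ε : ℝ} (hε : 0 < ε) {u b : α → ℝ} (hu : MemLp u 2 μ) (hb : MemLp b 2 μ)
    (h0 : ∀ᵐ x ∂μ, 0 ≤ b x) : MemLp (fun x => u x / (b x + ε)) 2 μ := by
  refine MemLp.of_le_mul (c := 1 / ε) hu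
    (hu.1.aemeasurable.div (hb.1.aemeasurable.add_const ε)).aestronglyMeasurable ?_
  filter_upwards [h0] with x hx
  have h1 : 0 < b x + ε := by linarith
  rw [norm_div, Real.norm_of_nonneg h1.le, div_mul_eq_mul_div, one_mul]
  exact div_le_div_of_nonneg_left (norm_nonneg _) hε (by linarith)

theorem memLp_testU {ε : ℝ} (hε : 0 < ε) {b : Fin n → α → ℝ} {φ : α → ℝ}
    (hb : ∀ i, MemLp (b i) 2 μ) (h0 : ∀ i, ∀ᵐ x ∂μ, 0 ≤ b i x) (hφ : MemLp φ 2 μ) (i : Fin n) :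
    MemLp (fun x => P.testU ε (fun j => b j x) (φ x) i) 2 μ :=
  ((hφ.const_mul (P.z i)).add (memLp_finsetSum _ fun j _ => (hb j).const_mul (P.a i j))).add
    ((memLp_log_add hε (hb i) (h0 i)).const_mul P.σ)

theorem memLp_testB {ε : ℝ} (hε : 0 < ε) {u b : Fin n → α → ℝ} {φ φb : α → ℝ}
    (hu : ∀ i, MemLp (u i) 2 μ)
    (hb : ∀ i, MemLp (b i) 2 μ) (h0 : ∀ i, ∀ᵐ x ∂μ, 0 ≤ b i x) (hφ : MemLp φ 2 μ)
    (hφb : MemLp φb 2 μ) (i : Fin n) :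
    MemLp (fun x => P.testB ε (fun j => u j x) (fun j => b j x) (φ x) (φb x) i) 2 μ :=
  ((((hφ.sub hφb).const_mul (P.z i)).add
    (memLp_finsetSum _ fun j _ => ((hu j).sub (hb j)).const_mul (P.a i j))).add
    ((memLp_div_add hε (hu i) (hb i) (h0 i)).const_mul P.σ)).sub (memLp_const P.σ)

theorem integrable_bil {u b : Fin n → α → ℝ}
    (hu : ∀ i, MemLp (u i) 2 μ) (hb : ∀ i, MemLp (b i) 2 μ) :
    Integrable (fun x => P.bil (fun j => u j x) (fun j => b j x)) μ :=
  integrable_finsetSum _ fun i _ => (hu i).integrable_mul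
    (memLp_finsetSum _ fun j _ => (hb j).const_mul (P.a i j))

theorem integrable_norm_sq {G : Type*} [NormedAddCommGroup G] [InnerProductSpace ℝ G]
    {f : α → G} (hf : MemLp f 2 μ) : Integrable (fun x => ‖f x‖ ^ 2) μ := by
  have := integrable_inner_of_memLp hf hf
  simpa only [real_inner_self_eq_norm_sq] using this

theorem integrable_crossDensity {ε : ℝ} (hε : 0 < ε) {u b : Fin n → α → ℝ} {φD : α → ℝ}
    {VD V Vb : α → E d} (hu : ∀ i, MemLp (u i) 2 μ) (hb : ∀ i, MemLp (b i) 2 μ)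
    (h0 : ∀ i, ∀ᵐ x ∂μ, 0 ≤ b i x) (hφD : MemLp φD 2 μ) (hVD : MemLp VD 2 μ)
    (hV : MemLp V 2 μ) (hVb : MemLp Vb 2 μ) :
    Integrable (fun x => P.crossDensity ε (φD x) (VD x) (fun j => u j x) (fun j => b j x)
      (V x) (Vb x)) μ := by
  refine ((((Integrable.neg (integrable_finsetSum _ fun i _ =>
    (hu i).integrable_mul (memLp_testU hε hb h0 hφD i))).sub
    (integrable_inner_of_memLp hV (hVb.sub hVD))).add
    ((integrable_norm_sq (hVb.sub hVD)).const_mul _)).add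
    ((integrable_bil hb hb).const_mul _)).add
    (Integrable.const_mul (integrable_finsetSum _ fun i _ => (hb i).integrable (by norm_num)) _)

end Integrability

/-- Square integrable nonnegative densities together with their potential. -/
structure IsState (P : Data d n) (u : Fin n → E d → ℝ) (Φ : H1 P.Ω) : Prop where
  memLp : ∀ i, MemLp (u i) 2 (volume.restrict P.Ω)
  nonneg : ∀ i, ∀ᵐ x ∂(volume.restrict P.Ω), 0 ≤ u i x
  potential : IsPotential P (charge P u) Φ

theorem IsState.memLp_charge {u : Fin n → E d → ℝ} {Φ : H1 P.Ω} (h : IsState P u Φ) :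
    MemLp (charge P u) 2 (volume.restrict P.Ω) :=
  memLp_finsetSum _ fun i _ => (h.memLp i).const_mul (P.z i)

theorem IsState.vanishesOn_sub {u u' : Fin n → E d → ℝ} {Φ Φ' : H1 P.Ω} (h : IsState P u Φ)
    (h' : IsState P u' Φ') : VanishesOn P.ΓD (Φ - Φ') := by
  have := h.potential.dirichlet.sub h'.potential.dirichlet
  rwa [sub_sub_sub_cancel_right] at this

theorem IsState.poisson_sub {u u' : Fin n → E d → ℝ} {Φ Φ' : H1 P.Ω} (h : IsState P u Φ)
    (h' : IsState P u' Φ') {ψ₁ ψ₂ : H1 P.Ω} (hψ : VanishesOn P.ΓD (ψ₁ - ψ₂)) :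
    ∫ x in P.Ω, (charge P u' x - charge P u x) * (fn ψ₁ x - fn ψ₂ x) =
      ∫ x in P.Ω, ⟪wgrad Φ' x - wgrad Φ x, wgrad ψ₁ x - wgrad ψ₂ x⟫_ℝ := by
  have e1 := h.potential.poisson _ hψ
  have e2 := h'.potential.poisson _ hψ
  have m1 := h.memLp_charge.integrable_mul (fn_memLp (ψ₁ - ψ₂))
  have m2 := h'.memLp_charge.integrable_mul (fn_memLp (ψ₁ - ψ₂))
  have n1 := integrable_inner_of_memLp (wgrad_memLp Φ) (wgrad_memLp (ψ₁ - ψ₂))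
  have n2 := integrable_inner_of_memLp (wgrad_memLp Φ') (wgrad_memLp (ψ₁ - ψ₂))
  have e3 : ∫ x in P.Ω, (charge P u' x * fn (ψ₁ - ψ₂) x - charge P u x * fn (ψ₁ - ψ₂) x) =
      ∫ x in P.Ω, (⟪wgrad Φ' x, wgrad (ψ₁ - ψ₂) x⟫_ℝ - ⟪wgrad Φ x, wgrad (ψ₁ - ψ₂) x⟫_ℝ) := by
    rw [integral_sub n2 n1, e1, e2]
    exact integral_sub m2 m1
  refine (integral_congr_ae ?_).trans (e3.trans (integral_congr_ae ?_))
  · filter_upwards [fn_sub ψ₁ ψ₂] with x hx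
    rw [hx, Pi.sub_apply]; ring
  · filter_upwards [wgrad_sub ψ₁ ψ₂] with x hx
    rw [hx, Pi.sub_apply, inner_sub_left]

/-- The linear part of the regularized relative entropy. -/
noncomputable def Data.cross (P : Data d n) (ε : ℝ) (u ub : Fin n → E d → ℝ)
    (V Vb : E d → E d) : ℝ :=
  ∫ x in P.Ω, P.crossDensity ε (fn P.ΦD x) (wgrad P.ΦD x) (fun j => u j x) (fun j => ub j x)
    (V x) (Vb x)

/-- The pointwise remainders disappear by the Poisson equations: that of the increment of u tested
with Φ̄'−Φ_D, that of the increment of ū tested with Φ−Φ̄', and the harmonicity of Φ_D tested with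
Φ̄−Φ̄'. All three functions vanish on Γ_D. -/
theorem cross_twoPoint (hP : Assumptions P) {ε : ℝ} (hε : 0 < ε)
    {u ub u' ub' : Fin n → E d → ℝ} {Φ Φb Φ' Φb' : H1 P.Ω} (h : IsState P u Φ)
    (hb : IsState P ub Φb) (h' : IsState P u' Φ') (hb' : IsState P ub' Φb') :
    P.cross ε u' ub' (wgrad Φ') (wgrad Φb') - P.cross ε u ub (wgrad Φ) (wgrad Φb) ≤
      - (∑ i, ∫ x in P.Ω, (u' i x - u i x) * P.testU ε (fun j => ub' j x) (fn Φb' x) i)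
      - ∑ i, ∫ x in P.Ω, (ub' i x - ub i x) *
          P.testB ε (fun j => u j x) (fun j => ub' j x) (fn Φ x) (fn Φb' x) i := by
  have := isFiniteMeasure_restrict_of_isBounded hP.isBounded
  have iU : ∀ i, Integrable (fun x => (u' i x - u i x) *
      P.testU ε (fun j => ub' j x) (fn Φb' x) i) (volume.restrict P.Ω) := fun i =>
    MemLp.integrable_mul ((h'.memLp i).sub (h.memLp i))
      (memLp_testU hε hb'.memLp hb'.nonneg (fn_memLp _) i)
  have iB : ∀ i, Integrable (fun x => (ub' i x - ub i x) *
      P.testB ε (fun j => u j x) (fun j => ub' j x) (fn Φ x) (fn Φb' x) i)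
      (volume.restrict P.Ω) := fun i =>
    MemLp.integrable_mul ((hb'.memLp i).sub (hb.memLp i))
      (memLp_testB hε h.memLp hb'.memLp hb'.nonneg (fn_memLp _) (fn_memLp _) i)
  have i1 : Integrable (fun x => (charge P u' x - charge P u x) * (fn Φb' x - fn P.ΦD x))
      (volume.restrict P.Ω) :=
    MemLp.integrable_mul (h'.memLp_charge.sub h.memLp_charge) ((fn_memLp _).sub (fn_memLp _))
  have i2 : Integrable (fun x => ⟪wgrad Φ' x - wgrad Φ x, wgrad Φb' x - wgrad P.ΦD x⟫_ℝ)
      (volume.restrict P.Ω) :=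
    integrable_inner_of_memLp ((wgrad_memLp _).sub (wgrad_memLp _))
      ((wgrad_memLp _).sub (wgrad_memLp _))
  have i3 : Integrable (fun x => (charge P ub' x - charge P ub x) * (fn Φ x - fn Φb' x))
      (volume.restrict P.Ω) :=
    MemLp.integrable_mul (hb'.memLp_charge.sub hb.memLp_charge) ((fn_memLp _).sub (fn_memLp _))
  have i4 : Integrable (fun x => ⟪wgrad Φb' x - wgrad Φb x, wgrad Φ x - wgrad Φb' x⟫_ℝ)
      (volume.restrict P.Ω) :=
    integrable_inner_of_memLp ((wgrad_memLp _).sub (wgrad_memLp _))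
      ((wgrad_memLp _).sub (wgrad_memLp _))
  have i5 : Integrable (fun x => ⟪wgrad P.ΦD x, wgrad Φb x - wgrad Φb' x⟫_ℝ)
      (volume.restrict P.Ω) :=
    integrable_inner_of_memLp (wgrad_memLp _) ((wgrad_memLp _).sub (wgrad_memLp _))
  have p1 := h.poisson_sub h' hb'.potential.dirichlet
  have p2 := hb.poisson_sub hb' (h.vanishesOn_sub hb')
  have p3 : ∫ x in P.Ω, ⟪wgrad P.ΦD x, wgrad Φb x - wgrad Φb' x⟫_ℝ = 0 := by
    rw [← hP.ΦD_harmonic _ (hb.vanishesOn_sub hb')]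
    refine integral_congr_ae ?_
    filter_upwards [wgrad_sub Φb Φb'] with x hx
    rw [hx, Pi.sub_apply]
  have j1 := integrable_crossDensity (P := P) hε h.memLp hb.memLp hb.nonneg (fn_memLp P.ΦD)
    (wgrad_memLp P.ΦD) (wgrad_memLp Φ) (wgrad_memLp Φb)
  have j2 := integrable_crossDensity (P := P) hε h'.memLp hb'.memLp hb'.nonneg (fn_memLp P.ΦD)
    (wgrad_memLp P.ΦD) (wgrad_memLp Φ') (wgrad_memLp Φb')
  have sU := integrable_finsetSum Finset.univ fun i _ => iU i
  have sB := integrable_finsetSum Finset.univ fun i _ => iB i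
  rw [Data.cross, Data.cross, ← integral_sub j2 j1]
  refine (integral_mono_ae (j2.sub j1)
    (((((sU.neg).sub sB).add (i1.sub i2)).add (i3.sub i4)).add i5) ?_).trans (le_of_eq ?_)
  · filter_upwards [ae_all_iff.2 h.nonneg, ae_all_iff.2 hb.nonneg, ae_all_iff.2 hb'.nonneg]
      with x h1 h2 h3
    exact crossDensity_twoPoint hP hε h1 h2 h3
  · rw [integral_add' ((((sU.neg).sub sB).add (i1.sub i2)).add (i3.sub i4)) i5,
      integral_add' (((sU.neg).sub sB).add (i1.sub i2)) (i3.sub i4),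
      integral_add' ((sU.neg).sub sB) (i1.sub i2), integral_sub' (sU.neg) sB,
      integral_sub' i1 i2, integral_sub' i3 i4, p1, p2, p3]
    simp only [Pi.neg_apply]
    rw [integral_neg, integral_finsetSum _ fun i _ => iU i, integral_finsetSum _ fun i _ => iB i]
    ring

end StericPNP

namespace StericPNP

/-! ### Test functions and uniqueness of the potential -/

theorem fn_sum {d : ℕ} {Ω : Set (E d)} {p : ℝ≥0∞} [Fact (1 ≤ p)] {ι : Type*} (s : Finset ι)
    (v : ι → W1 Ω p) : fn (∑ j ∈ s, v j) =ᵐ[volume.restrict Ω] fun x => ∑ j ∈ s, fn (v j) x := by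
  classical
  induction s using Finset.induction_on with
  | empty =>
    simp only [Finset.sum_empty]
    exact Lp.coeFn_zero ℝ p (volume.restrict Ω)
  | insert a s ha ih =>
    rw [Finset.sum_insert ha]
    filter_upwards [fn_add (v a) (∑ j ∈ s, v j), ih] with x h1 h2
    rw [h1, Pi.add_apply, h2, Finset.sum_insert ha]

theorem wgrad_sum {d : ℕ} {Ω : Set (E d)} {p : ℝ≥0∞} [Fact (1 ≤ p)] {ι : Type*} (s : Finset ι)
    (v : ι → W1 Ω p) :
    wgrad (∑ j ∈ s, v j) =ᵐ[volume.restrict Ω] fun x => ∑ j ∈ s, wgrad (v j) x := by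
  classical
  induction s using Finset.induction_on with
  | empty =>
    simp only [Finset.sum_empty]
    exact Lp.coeFn_zero (E d) p (volume.restrict Ω)
  | insert a s ha ih =>
    rw [Finset.sum_insert ha]
    filter_upwards [wgrad_add (v a) (∑ j ∈ s, v j), ih] with x h1 h2
    rw [h1, Pi.add_apply, h2, Finset.sum_insert ha]

variable {d n : ℕ} {P : Data d n}

/-- The gradient of `testU`. -/
noncomputable def Data.gradU (P : Data d n) (ε : ℝ) (ub : Fin n → ℝ) (Ub : Fin n → E d) (Vb : E d)
    (i : Fin n) : E d :=
  P.z i • Vb + ∑ j, P.a i j • Ub j + (P.σ / (ub i + ε)) • Ub i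

/-- The gradient of `testB`. -/
noncomputable def Data.gradB (P : Data d n) (ε : ℝ) (u ub : Fin n → ℝ) (U Ub : Fin n → E d)
    (V Vb : E d) (i : Fin n) : E d :=
  P.z i • (V - Vb) + ∑ j, P.a i j • (U j - Ub j) + (P.σ / (ub i + ε)) • U i
    - (P.σ * u i / (ub i + ε) ^ 2) • Ub i

theorem abs_two_mul_div_le {ε : ℝ} (hε : 0 < ε) (s : ℝ) :
    |2 * s / (s ^ 2 + ε)| ≤ 1 + 1 / ε := by
  have h : 0 < s ^ 2 + ε := by positivity
  rw [abs_div, abs_of_pos h, div_le_iff₀ h, abs_mul, abs_two]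
  have h1 : (1 + 1 / ε) * (s ^ 2 + ε) = s ^ 2 + ε + s ^ 2 / ε + 1 := by field_simp; ring
  have h2 : 0 ≤ s ^ 2 / ε := by positivity
  rw [h1]
  nlinarith [sq_nonneg (|s| - 1), sq_abs s]

/-- Write log(u+ε) as a function of √u: s ↦ log(s²+ε) is smooth with bounded derivative on all of ℝ,
whereas r ↦ log(r+ε) is singular on the negative axis and does not fit the chain rule. -/
theorem exists_H1_log (hP : Assumptions P) {ε : ℝ} (hε : 0 < ε) (s u : H1 P.Ω)
    (h : ∀ᵐ x ∂(volume.restrict P.Ω), fn u x = fn s x ^ 2) :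
    ∃ v : H1 P.Ω, fn v =ᵐ[volume.restrict P.Ω] (fun x => Real.log (fn u x + ε)) ∧
      wgrad v =ᵐ[volume.restrict P.Ω] fun x => (1 / (fn u x + ε)) • wgrad u x := by
  have hpos : ∀ s : ℝ, 0 < s ^ 2 + ε := fun s => by positivity
  have hder : ∀ s : ℝ, HasDerivAt (fun s : ℝ => Real.log (s ^ 2 + ε)) (2 * s / (s ^ 2 + ε)) s := by
    intro s
    simpa using (((hasDerivAt_id s).pow 2).add_const ε).log (hpos s).ne'
  obtain ⟨h1, h2, h3⟩ := hasWeakGradient_comp hP.isOpen hP.isBounded hP.lipschitz s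
    (g := fun s => Real.log (s ^ 2 + ε)) (K := 1 + 1 / ε)
    (((contDiff_id.pow 2).add contDiff_const).log fun s => (hpos s).ne')
    (fun s => by rw [(hder s).deriv]; exact abs_two_mul_div_le hε s)
  obtain ⟨v, hv1, hv2⟩ := exists_W1 h1 h2 h3
  refine ⟨v, ?_, ?_⟩
  · filter_upwards [hv1, h] with x e1 e2
    rw [e1, e2]
  · filter_upwards [hv2, h, wgrad_eq_of_sq hP.isOpen hP.isBounded hP.lipschitz u s h] with x e1 e2 e3
    rw [e1, e2, e3, (hder _).deriv, smul_smul]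
    congr 1; ring

/-- The factor 1/(b+ε) is a C¹ function of √b with bounded derivative, as for the logarithm, and the
product rule does the rest. The bound on ∇b is what puts u∇b/(b+ε)² in L². -/
theorem exists_H1_div (hP : Assumptions P) {ε M : ℝ} (hε : 0 < ε) (u s b : H1 P.Ω)
    (h : ∀ᵐ x ∂(volume.restrict P.Ω), fn b x = fn s x ^ 2)
    (hM : ∀ᵐ x ∂(volume.restrict P.Ω), ‖wgrad b x‖ ≤ M) :
    ∃ v : H1 P.Ω, fn v =ᵐ[volume.restrict P.Ω] (fun x => fn u x / (fn b x + ε)) ∧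
      wgrad v =ᵐ[volume.restrict P.Ω] fun x =>
        (1 / (fn b x + ε)) • wgrad u x - (fn u x / (fn b x + ε) ^ 2) • wgrad b x := by
  have := isFiniteMeasure_restrict_of_isBounded hP.isBounded
  have hpos : ∀ s : ℝ, 0 < s ^ 2 + ε := fun s => by positivity
  have hder : ∀ s : ℝ, HasDerivAt (fun s : ℝ => (s ^ 2 + ε)⁻¹) (-(2 * s) / (s ^ 2 + ε) ^ 2) s := by
    intro s
    have h2 := (((hasDerivAt_id s).pow 2).add_const ε).inv (hpos s).ne'
    simp at h2
    exact h2
  obtain ⟨h1, h2, h3⟩ := hasWeakGradient_comp hP.isOpen hP.isBounded hP.lipschitz s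
    (g := fun s => (s ^ 2 + ε)⁻¹) (K := (1 + 1 / ε) * (1 / ε))
    (((contDiff_id.pow 2).add contDiff_const).inv fun s => (hpos s).ne')
    (fun s => by
      rw [(hder s).deriv, sq (s ^ 2 + ε), neg_div, abs_neg, ← div_div, div_eq_mul_one_div _ (s ^ 2 + ε),
        abs_mul, abs_of_pos (one_div_pos.2 (hpos s))]
      exact mul_le_mul (abs_two_mul_div_le hε s)
        (one_div_le_one_div_of_le hε (by nlinarith [sq_nonneg s])) (one_div_pos.2 (hpos s)).le
        (by positivity))
  obtain ⟨r, hr1, hr2⟩ := exists_W1 h1 h2 h3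
  have h4 := hasWeakGradient_mul hP.isOpen hP.isBounded hP.lipschitz u r
  have hb0 : ∀ᵐ x ∂(volume.restrict P.Ω), 0 ≤ fn b x := by
    filter_upwards [h] with x hx; rw [hx]; positivity
  have e1 : (fun x => fn u x * fn r x) =ᵐ[volume.restrict P.Ω] fun x => fn u x / (fn b x + ε) := by
    filter_upwards [hr1, h] with x a1 a2
    rw [a1, a2, div_eq_mul_inv]
  have e2 : (fun x => fn u x • wgrad r x + fn r x • wgrad u x) =ᵐ[volume.restrict P.Ω] fun x =>
      (1 / (fn b x + ε)) • wgrad u x - (fn u x / (fn b x + ε) ^ 2) • wgrad b x := by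
    filter_upwards [hr1, hr2, h, wgrad_eq_of_sq hP.isOpen hP.isBounded hP.lipschitz b s h]
      with x a1 a2 a3 a4
    rw [a1, a2, a3, a4, (hder _).deriv, smul_smul, smul_smul, one_div, add_comm, sub_eq_add_neg,
      ← neg_smul]
    congr 2; ring
  have i1 := memLp_div_add hε (fn_memLp u) (fn_memLp b) hb0
  have hm : ∀ k : ℕ, AEStronglyMeasurable (fun x => ((fn b x + ε) ^ k)⁻¹) (volume.restrict P.Ω) :=
    fun k => (((fn_memLp b).1.aemeasurable.add_const ε).pow_const k).inv.aestronglyMeasurable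
  have hle : ∀ k : ℕ, ∀ᵐ x ∂(volume.restrict P.Ω), ‖((fn b x + ε) ^ k)⁻¹‖ ≤ (ε ^ k)⁻¹ := fun k => by
    filter_upwards [hb0] with x hx
    have : 0 ≤ fn b x + ε := by linarith
    rw [Real.norm_of_nonneg (by positivity)]
    exact inv_anti₀ (by positivity) (pow_le_pow_left₀ hε.le (by linarith) k)
  have i2 : MemLp (fun x => (1 / (fn b x + ε)) • wgrad u x - (fn u x / (fn b x + ε) ^ 2) • wgrad b x)
      2 (volume.restrict P.Ω) := by
    refine MemLp.sub (MemLp.of_le_mul (c := ε⁻¹) (wgrad_memLp u) ?_ ?_)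
      (MemLp.of_le_mul (c := (ε ^ 2)⁻¹ * M) (fn_memLp u) ?_ ?_)
    · exact ((hm 1).smul (wgrad_memLp u).1).congr (.of_forall fun x => by simp)
    · filter_upwards [hle 1] with x hx
      rw [norm_smul, one_div]
      simp only [pow_one] at hx
      exact mul_le_mul_of_nonneg_right hx (norm_nonneg _)
    · exact (((fn_memLp u).1.mul (hm 2)).smul (wgrad_memLp b).1).congr
        (.of_forall fun x => by simp [div_eq_mul_inv])
    · filter_upwards [hle 2, hM] with x hx hx2
      rw [norm_smul, div_eq_mul_inv, norm_mul, mul_assoc, mul_comm]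
      exact mul_le_mul_of_nonneg_right (mul_le_mul hx hx2 (norm_nonneg _)
        (by positivity)) (norm_nonneg _)
  exact exists_W1 i1 i2 (h4.congr e1 e2)

theorem exists_H1_testU (hP : Assumptions P) {ε : ℝ} (hε : 0 < ε) (s b : Fin n → H1 P.Ω)
    (Φb : H1 P.Ω) (h : ∀ i, ∀ᵐ x ∂(volume.restrict P.Ω), fn (b i) x = fn (s i) x ^ 2) (i : Fin n) :
    ∃ v : H1 P.Ω,
      fn v =ᵐ[volume.restrict P.Ω] (fun x => P.testU ε (fun j => fn (b j) x) (fn Φb x) i) ∧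
      wgrad v =ᵐ[volume.restrict P.Ω] fun x =>
        P.gradU ε (fun j => fn (b j) x) (fun j => wgrad (b j) x) (wgrad Φb x) i := by
  obtain ⟨L, hL1, hL2⟩ := exists_H1_log hP hε (s i) (b i) (h i)
  refine ⟨P.z i • Φb + ∑ j, P.a i j • b j + P.σ • L, ?_, ?_⟩
  · filter_upwards [fn_add (P.z i • Φb + ∑ j, P.a i j • b j) (P.σ • L),
      fn_add (P.z i • Φb) (∑ j, P.a i j • b j), fn_smul (P.z i) Φb, fn_smul P.σ L,
      fn_sum Finset.univ fun j => P.a i j • b j, ae_all_iff.2 fun j => fn_smul (P.a i j) (b j), hL1]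
      with x e1 e2 e3 e4 e5 e6 e7
    rw [e1, Pi.add_apply, e2, Pi.add_apply, e3, e4, e5, Pi.smul_apply, Pi.smul_apply, e7]
    simp only [e6, Data.testU, Pi.smul_apply, smul_eq_mul]
  · filter_upwards [wgrad_add (P.z i • Φb + ∑ j, P.a i j • b j) (P.σ • L),
      wgrad_add (P.z i • Φb) (∑ j, P.a i j • b j), wgrad_smul (P.z i) Φb, wgrad_smul P.σ L,
      wgrad_sum Finset.univ fun j => P.a i j • b j,
      ae_all_iff.2 fun j => wgrad_smul (P.a i j) (b j), hL2] with x e1 e2 e3 e4 e5 e6 e7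
    rw [e1, Pi.add_apply, e2, Pi.add_apply, e3, e4, e5, Pi.smul_apply, Pi.smul_apply, e7]
    simp only [e6, Data.gradU, Pi.smul_apply, smul_smul, mul_one_div]

theorem exists_H1_testB (hP : Assumptions P) {ε M : ℝ} (hε : 0 < ε) (u s b : Fin n → H1 P.Ω)
    (Φ Φb : H1 P.Ω) (h : ∀ i, ∀ᵐ x ∂(volume.restrict P.Ω), fn (b i) x = fn (s i) x ^ 2)
    (hM : ∀ i, ∀ᵐ x ∂(volume.restrict P.Ω), ‖wgrad (b i) x‖ ≤ M) (i : Fin n) :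
    ∃ v : H1 P.Ω,
      fn v =ᵐ[volume.restrict P.Ω] (fun x => P.testB ε (fun j => fn (u j) x)
        (fun j => fn (b j) x) (fn Φ x) (fn Φb x) i) ∧
      wgrad v =ᵐ[volume.restrict P.Ω] fun x => P.gradB ε (fun j => fn (u j) x)
        (fun j => fn (b j) x) (fun j => wgrad (u j) x) (fun j => wgrad (b j) x)
        (wgrad Φ x) (wgrad Φb x) i := by
  have := isFiniteMeasure_restrict_of_isBounded hP.isBounded
  obtain ⟨L, hL1, hL2⟩ := exists_H1_div hP hε (u i) (s i) (b i) (h i) (hM i)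
  obtain ⟨c, hc1, hc2⟩ := exists_W1_const (Ω := P.Ω) (p := 2) P.σ
  refine ⟨P.z i • (Φ - Φb) + ∑ j, P.a i j • (u j - b j) + P.σ • L - c, ?_, ?_⟩
  · filter_upwards [fn_sub (P.z i • (Φ - Φb) + ∑ j, P.a i j • (u j - b j) + P.σ • L) c,
      fn_add (P.z i • (Φ - Φb) + ∑ j, P.a i j • (u j - b j)) (P.σ • L),
      fn_add (P.z i • (Φ - Φb)) (∑ j, P.a i j • (u j - b j)), fn_smul (P.z i) (Φ - Φb),
      fn_smul P.σ L, fn_sum Finset.univ fun j => P.a i j • (u j - b j),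
      ae_all_iff.2 fun j => fn_smul (P.a i j) (u j - b j), hL1, fn_sub Φ Φb,
      ae_all_iff.2 fun j => fn_sub (u j) (b j), hc1]
      with x e0 e1 e2 e3 e4 e5 e6 e7 e8 e9 e10
    rw [e0, Pi.sub_apply, e1, Pi.add_apply, e2, Pi.add_apply, e3, e4, e5, Pi.smul_apply,
      Pi.smul_apply, e7, e8, e10]
    simp only [e6, e9, Data.testB, Pi.smul_apply, smul_eq_mul, Pi.sub_apply]
  · filter_upwards [wgrad_sub (P.z i • (Φ - Φb) + ∑ j, P.a i j • (u j - b j) + P.σ • L) c,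
      wgrad_add (P.z i • (Φ - Φb) + ∑ j, P.a i j • (u j - b j)) (P.σ • L),
      wgrad_add (P.z i • (Φ - Φb)) (∑ j, P.a i j • (u j - b j)), wgrad_smul (P.z i) (Φ - Φb),
      wgrad_smul P.σ L, wgrad_sum Finset.univ fun j => P.a i j • (u j - b j),
      ae_all_iff.2 fun j => wgrad_smul (P.a i j) (u j - b j), hL2, wgrad_sub Φ Φb,
      ae_all_iff.2 fun j => wgrad_sub (u j) (b j), hc2]
      with x e0 e1 e2 e3 e4 e5 e6 e7 e8 e9 e10
    rw [e0, Pi.sub_apply, e1, Pi.add_apply, e2, Pi.add_apply, e3, e4, e5, Pi.smul_apply,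
      Pi.smul_apply, e7, e8, e10]
    simp only [e6, e9, Data.gradB, Pi.smul_apply, Pi.sub_apply, sub_zero]
    rw [smul_sub P.σ, smul_smul, smul_smul, mul_one_div, mul_div_assoc, add_sub_assoc]

theorem exists_potential_bound (hP : Assumptions P) :
    ∃ C > 0, ∀ (f : Lp ℝ 2 (volume.restrict P.Ω)) (φ : H1 P.Ω), IsPotential P f φ →
      ‖φ.1.1‖ ≤ C * (‖f‖ + 1) := by
  obtain ⟨C, hC, h⟩ := hP.h2_regularity
  refine ⟨C, hC, fun f φ hφ => ?_⟩
  obtain ⟨D, -, hD⟩ := h f φ hφ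
  refine le_trans (Real.le_sqrt_of_sq_le ?_) hD
  have h1 : 0 ≤ ∑ j, ‖(D j).1.2‖ ^ 2 := Finset.sum_nonneg fun j _ => sq_nonneg _
  nlinarith [sq_nonneg ‖φ.1.2‖]

theorem IsPotential.congr {f g : E d → ℝ} {φ : H1 P.Ω} (h : IsPotential P f φ)
    (hfg : f =ᵐ[volume.restrict P.Ω] g) : IsPotential P g φ :=
  ⟨h.dirichlet, fun ψ hψ => (h.poisson ψ hψ).trans
    (integral_congr_ae (by filter_upwards [hfg] with x hx; rw [hx])), h.mean_zero⟩

/-- Two solutions with the same right-hand side span an affine line of solutions, and the regularity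
estimate bounds their L² norms by one constant. A bounded line is a point. This takes the place of a
Poincaré inequality. -/
theorem IsPotential.unique (hP : Assumptions P) {f : E d → ℝ}
    (hf : MemLp f 2 (volume.restrict P.Ω)) {φ φ' : H1 P.Ω} (h : IsPotential P f φ)
    (h' : IsPotential P f φ') : fn φ =ᵐ[volume.restrict P.Ω] fn φ' := by
  have := isFiniteMeasure_restrict_of_isBounded hP.isBounded
  obtain ⟨C, hC, hbd⟩ := exists_potential_bound hP
  have hv : VanishesOn P.ΓD (φ - φ') := by
    have := h.dirichlet.sub h'.dirichlet
    rwa [sub_sub_sub_cancel_right] at this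
  have key : ∀ k : ℝ, IsPotential P (hf.toLp f) (φ' + k • (φ - φ')) := by
    intro k
    refine IsPotential.congr (f := f) ⟨?_, fun ψ hψ => ?_, fun hΓ => ?_⟩ hf.coeFn_toLp.symm
    · have := h'.dirichlet.add (hv.smul k)
      have e : φ' - P.ΦD + k • (φ - φ') = φ' + k • (φ - φ') - P.ΦD := by abel
      rwa [e] at this
    · have n1 := integrable_inner_of_memLp (wgrad_memLp φ) (wgrad_memLp ψ)
      have n2 := integrable_inner_of_memLp (wgrad_memLp φ') (wgrad_memLp ψ)
      have n3 : Integrable (fun x => ⟪wgrad φ x, wgrad ψ x⟫_ℝ - ⟪wgrad φ' x, wgrad ψ x⟫_ℝ)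
        (volume.restrict P.Ω) := n1.sub n2
      have e : ∫ x in P.Ω, ⟪wgrad (φ' + k • (φ - φ')) x, wgrad ψ x⟫_ℝ =
          ∫ x in P.Ω, (⟪wgrad φ' x, wgrad ψ x⟫_ℝ +
            k * (⟪wgrad φ x, wgrad ψ x⟫_ℝ - ⟪wgrad φ' x, wgrad ψ x⟫_ℝ)) := by
        refine integral_congr_ae ?_
        filter_upwards [wgrad_add φ' (k • (φ - φ')), wgrad_smul k (φ - φ'), wgrad_sub φ φ']
          with x e1 e2 e3
        rw [e1, Pi.add_apply, e2, Pi.smul_apply, e3, Pi.sub_apply, inner_add_left,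
          real_inner_smul_left, inner_sub_left]
      rw [e, integral_add n2 (n3.const_mul k), integral_const_mul, integral_sub n1 n2,
        h.poisson ψ hψ, h'.poisson ψ hψ]
      ring
    · have n1 := (fn_memLp φ).integrable (by norm_num)
      have n2 := (fn_memLp φ').integrable (by norm_num)
      have n3 : Integrable (fun x => fn φ x - fn φ' x) (volume.restrict P.Ω) := n1.sub n2
      have e : ∫ x in P.Ω, fn (φ' + k • (φ - φ')) x =
          ∫ x in P.Ω, (fn φ' x + k * (fn φ x - fn φ' x)) := by
        refine integral_congr_ae ?_
        filter_upwards [fn_add φ' (k • (φ - φ')), fn_smul k (φ - φ'), fn_sub φ φ'] with x e1 e2 e3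
        rw [e1, Pi.add_apply, e2, Pi.smul_apply, e3, Pi.sub_apply, smul_eq_mul]
      rw [e, integral_add n2 (n3.const_mul k), integral_const_mul, integral_sub n1 n2,
        h.mean_zero hΓ, h'.mean_zero hΓ]
      ring
  have hz : φ.1.1 - φ'.1.1 = 0 := by
    rw [← norm_eq_zero]
    by_contra hne
    have hpos : 0 < ‖φ.1.1 - φ'.1.1‖ := lt_of_le_of_ne (norm_nonneg _) (Ne.symm hne)
    set A := C * (‖hf.toLp f‖ + 1) + ‖φ'.1.1‖
    have hA : 0 ≤ A := by positivity
    -- The parameter puts the solution at distance A + 1 from φ', more than the bound plus ‖φ'‖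
    -- allows.
    have h1 := hbd _ _ (key ((A + 1) / ‖φ.1.1 - φ'.1.1‖))
    have h2 : ((φ' + ((A + 1) / ‖φ.1.1 - φ'.1.1‖) • (φ - φ') : H1 P.Ω)).1.1 =
        φ'.1.1 + ((A + 1) / ‖φ.1.1 - φ'.1.1‖) • (φ.1.1 - φ'.1.1) := rfl
    have h3 : ‖((A + 1) / ‖φ.1.1 - φ'.1.1‖) • (φ.1.1 - φ'.1.1)‖ = A + 1 := by
      rw [norm_smul, norm_div, norm_norm, Real.norm_of_nonneg (by positivity)]
      field_simp
    have h4 := norm_sub_le (φ'.1.1 + ((A + 1) / ‖φ.1.1 - φ'.1.1‖) • (φ.1.1 - φ'.1.1)) φ'.1.1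
    rw [add_sub_cancel_left, h3] at h4
    rw [h2] at h1
    linarith
  have : φ.1.1 = φ'.1.1 := sub_eq_zero.1 hz
  show (φ.1.1 : E d → ℝ) =ᵐ[_] (φ'.1.1 : E d → ℝ)
  rw [this]

end StericPNP

namespace StericPNP

/-! ### Steklov averages -/

section Steklov

variable {d : ℕ} {G : Type*} [NormedAddCommGroup G] [NormedSpace ℝ G]

/-- The forward time average of `F` over an interval of length `h`. -/
noncomputable def steklov (F : ℝ × E d → G) (h : ℝ) (q : ℝ × E d) : G :=
  h⁻¹ • ∫ τ in Ioo 0 h, F (q.1 + τ, q.2)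

theorem isAddHaarMeasure_volume_prod :
    (volume : Measure (ℝ × E d)).IsAddHaarMeasure := by
  rw [Measure.volume_eq_prod]; infer_instance

theorem stronglyMeasurable_steklov {F : ℝ × E d → G} (hF : StronglyMeasurable F) (h : ℝ) :
    StronglyMeasurable (steklov F h) := by
  refine StronglyMeasurable.fun_const_smul ?_ _
  have : StronglyMeasurable fun p : (ℝ × E d) × ℝ => F (p.1.1 + p.2, p.1.2) :=
    hF.comp_measurable (((measurable_fst.comp measurable_fst).add measurable_snd).prodMk
      (measurable_snd.comp measurable_fst))
  exact this.integral_prod_right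

theorem tendsto_eLpNorm_steklov [CompleteSpace G] {p : ℝ≥0∞} (hp1 : 1 ≤ p) (hp : p ≠ ⊤)
    {F : ℝ × E d → G} (hF : MemLp F p volume) (hFm : StronglyMeasurable F) {h : ℕ → ℝ}
    (hpos : ∀ n, 0 < h n) (hlim : Tendsto h atTop (𝓝 0)) :
    Tendsto (fun n => eLpNorm (steklov F (h n) - F) p volume) atTop (𝓝 0) := by
  have := isAddHaarMeasure_volume_prod (d := d)
  have hι : Measurable fun τ : ℝ => ((τ, 0) : ℝ × E d) := measurable_id.prodMk measurable_const
  -- The time average is the mean of translates under the uniform probability on (0, h) × {0}.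
  let κ : ℕ → Measure (ℝ × E d) := fun n =>
    (ENNReal.ofReal (h n)⁻¹ • volume.restrict (Ioo 0 (h n))).map fun τ : ℝ => ((τ, 0) : ℝ × E d)
  have hκ : ∀ n, IsProbabilityMeasure (κ n) := fun n => by
    refine ⟨?_⟩
    simp only [κ]
    rw [Measure.map_apply hι MeasurableSet.univ]
    simp only [preimage_univ, Measure.smul_apply, Measure.restrict_apply_univ, Real.volume_Ioo,
      sub_zero, smul_eq_mul]
    rw [← ENNReal.ofReal_mul (inv_nonneg.2 (hpos n).le), inv_mul_cancel₀ (hpos n).ne',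
      ENNReal.ofReal_one]
  refine (tendsto_eLpNorm_average_translate hp1 hp hF hFm hκ hlim fun n => ?_).congr fun n => ?_
  · simp only [κ]
    rw [ae_map_iff hι.aemeasurable (measurableSet_le measurable_norm measurable_const)]
    refine Measure.ae_smul_measure ?_ _
    filter_upwards [ae_restrict_mem measurableSet_Ioo] with τ hτ
    simp only [Prod.norm_mk, norm_zero, sup_le_iff]
    rw [Real.norm_of_nonneg hτ.1.le]
    exact ⟨hτ.2.le, (hpos n).le⟩
  · congr 1
    ext1 y
    simp only [Pi.sub_apply, steklov, κ]
    rw [integral_map hι.aemeasurable, integral_smul_measure,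
      ENNReal.toReal_ofReal (inv_nonneg.2 (hpos n).le)]
    · simp [Prod.add_def]
    · exact (hFm.comp_measurable (measurable_const.add measurable_id)).aestronglyMeasurable

/-- Translations are continuous in L², and a subsequence of time steps gives convergence almost
everywhere; the limit h → 0 is later taken along such steps. -/
theorem exists_seq_tendsto_translate {Y : ℝ × E d → G} (hY : MemLp Y 2 volume) :
    ∃ h : ℕ → ℝ, (∀ n, 0 < h n) ∧ Tendsto h atTop (𝓝 0) ∧
      ∀ᵐ q, Tendsto (fun n => Y (q.1 + h n, q.2)) atTop (𝓝 (Y q)) := by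
  have := isAddHaarMeasure_volume_prod (d := d)
  have h1 := tendsto_eLpNorm_translate (by norm_num) (by norm_num) hY
  have h0 : Tendsto (fun n : ℕ => (((1 : ℝ) / (n + 1), 0) : ℝ × E d)) atTop (𝓝 0) := by
    have := (tendsto_one_div_add_atTop_nhds_zero_nat (𝕜 := ℝ)).prodMk_nhds
      (tendsto_const_nhds (x := (0 : E d)))
    exact this
  obtain ⟨ns, hns, hae⟩ := exists_subseq_tendsto_ae (p := 2) two_ne_zero
    (f := fun n q => Y (q + ((1 : ℝ) / ((n : ℕ) + 1), 0)))
    (fun n => hY.1.comp_measurePreserving (measurePreserving_add_right _ _)) hY.1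
    (h1.comp h0)
  refine ⟨fun n => 1 / ((ns n : ℝ) + 1), fun n => by positivity,
    (tendsto_one_div_add_atTop_nhds_zero_nat (𝕜 := ℝ)).comp hns.tendsto_atTop, ?_⟩
  filter_upwards [hae] with q hq
  simpa [Prod.add_def] using hq

theorem integrable_inner_of_holder {α : Type*} [MeasurableSpace α] {μ : Measure α} {H : Type*}
    [NormedAddCommGroup H] [InnerProductSpace ℝ H] {p q : ℝ≥0∞} [p.HolderTriple q 1]
    {f g : α → H} (hf : MemLp f p μ) (hg : MemLp g q μ) :
    Integrable (fun x => ⟪f x, g x⟫_ℝ) μ := by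
  refine memLp_one_iff_integrable.1 ⟨hf.1.inner hg.1, ?_⟩
  refine (eLpNorm_bilin_le (p := p) (q := q) (innerSL ℝ) hf.1 hg.1).trans_lt ?_
  exact ENNReal.mul_lt_top (by simp) (ENNReal.mul_lt_top hf.2 hg.2)

/-- Exchange of the time average with the space integral. -/
theorem integral_strip_eq_steklov {μ : Measure (E d)} [IsFiniteMeasure μ] {p q : ℝ≥0∞}
    [p.HolderTriple q 1] (hp : 1 ≤ p) {F : ℝ × E d → E d}
    (hF : MemLp F p (volume.prod μ)) {r h : ℝ} (hh : 0 < h) {g : E d → E d} (hg : MemLp g q μ) :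
    ∫ z, ⟪F z, g z.2⟫_ℝ ∂((volume.restrict (Ioo r (r + h))).prod μ) =
      h * ∫ x, ⟪steklov F h (r, x), g x⟫_ℝ ∂μ := by
  have hF' : MemLp F p ((volume.restrict (Ioo r (r + h))).prod μ) :=
    hF.mono_measure (Measure.prod_mono Measure.restrict_le_self le_rfl)
  have hint := integrable_inner_of_holder hF' (hg.comp_snd (volume.restrict (Ioo r (r + h))))
  rw [integral_prod_symm _ hint, ← integral_const_mul]
  refine integral_congr_ae ?_
  filter_upwards [(hF'.integrable hp).prod_left_ae] with x hx
  have h1 : ∫ s in Ioo r (r + h), ⟪F (s, x), g x⟫_ℝ = ⟪∫ s in Ioo r (r + h), F (s, x), g x⟫_ℝ := by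
    have h3 : ∫ s in Ioo r (r + h), ⟪g x, F (s, x)⟫_ℝ = ⟪g x, ∫ s in Ioo r (r + h), F (s, x)⟫_ℝ :=
      integral_inner hx (g x)
    rw [real_inner_comm, ← h3]
    exact integral_congr_ae (.of_forall fun s => real_inner_comm _ _)
  have h2 : ∫ s in Ioo r (r + h), F (s, x) = ∫ τ in Ioo 0 h, F (r + τ, x) := by
    rw [← integral_Ioc_eq_integral_Ioo, ← integral_Ioc_eq_integral_Ioo,
      ← intervalIntegral.integral_of_le (by linarith), ← intervalIntegral.integral_of_le hh.le,
      intervalIntegral.integral_comp_add_left (fun s => F (s, x)), add_zero]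
  simp only [steklov]
  rw [h1, h2, real_inner_smul_left, ← mul_assoc, mul_inv_cancel₀ hh.ne', one_mul]

/-- Averaged fluxes converge in L^p while the test gradients converge only almost everywhere under
an L^q dominant. It is used with (p, q) = (1, ∞) for the flux of u and (2, 2) for that of ū. -/
theorem tendsto_integral_steklov_inner {p q : ℝ≥0∞} [p.HolderTriple q 1] (hp1 : 1 ≤ p)
    (hp : p ≠ ⊤) {ν : Measure (ℝ × E d)} (hν : ν ≤ volume) {F : ℝ × E d → E d}
    (hF : MemLp F p volume) (hFm : StronglyMeasurable F) {h : ℕ → ℝ}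
    (hpos : ∀ n, 0 < h n) (hlim : Tendsto h atTop (𝓝 0)) {g : ℕ → ℝ × E d → E d}
    {g₀ : ℝ × E d → E d} (hg : ∀ n, AEStronglyMeasurable (g n) ν) {D : ℝ × E d → ℝ}
    (hD : MemLp D q ν) (hgD : ∀ n, ∀ᵐ x ∂ν, ‖g n x‖ ≤ D x)
    (hgl : ∀ᵐ x ∂ν, Tendsto (fun n => g n x) atTop (𝓝 (g₀ x))) :
    (∀ᶠ n in atTop, Integrable (fun z => ⟪steklov F (h n) z, g n z⟫_ℝ) ν) ∧
    Integrable (fun z => ⟪F z, g₀ z⟫_ℝ) ν ∧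
    Tendsto (fun n => ∫ z, ⟪steklov F (h n) z, g n z⟫_ℝ ∂ν) atTop (𝓝 (∫ z, ⟪F z, g₀ z⟫_ℝ ∂ν)) := by
  have hs : ∀ n, AEStronglyMeasurable (steklov F (h n)) ν := fun n =>
    (stronglyMeasurable_steklov hFm _).aestronglyMeasurable
  have hFν : MemLp F p ν := hF.mono_measure hν
  have hg₀ : MemLp g₀ q ν := by
    refine hD.mono' (aestronglyMeasurable_of_tendsto_ae _ hg hgl) ?_
    filter_upwards [ae_all_iff.2 hgD, hgl] with x h1 h2
    exact le_of_tendsto h2.norm (.of_forall h1)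
  have hi : Integrable (fun z => ⟪F z, g₀ z⟫_ℝ) ν := integrable_inner_of_holder hFν hg₀
  have hl : Tendsto (fun n => eLpNorm (steklov F (h n) - F) p ν) atTop (𝓝 0) :=
    tendsto_of_tendsto_of_tendsto_of_le_of_le tendsto_const_nhds
      (tendsto_eLpNorm_steklov hp1 hp hF hFm hpos hlim) (fun _ => zero_le)
      fun n => eLpNorm_mono_measure _ hν
  have h1 := tendsto_eLpNorm_bilin_of_dominated hp1 (innerSL ℝ) hs hg hFν hl hD hgD hgl
  have hm : ∀ n, AEStronglyMeasurable (fun z => ⟪steklov F (h n) z, g n z⟫_ℝ) ν := fun n =>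
    (hs n).inner (hg n)
  refine ⟨?_, hi, tendsto_integral_of_tendsto_eLpNorm hi hm h1⟩
  filter_upwards [h1.eventually (gt_mem_nhds ENNReal.zero_lt_top)] with n hn
  have h2 : Integrable ((fun z => ⟪steklov F (h n) z, g n z⟫_ℝ) - fun z => ⟪F z, g₀ z⟫_ℝ) ν :=
    memLp_one_iff_integrable.1 ⟨(hm n).sub hi.1, hn⟩
  simpa using h2.add hi

end Steklov

end StericPNP

namespace StericPNP

/-! ### Increments of the linear part of the relative entropy -/

variable {d n : ℕ} {P : Data d n}

namespace JointRep

variable {S Sb : WeakSolution P} (J : JointRep S) (Jb : JointRep Sb)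

/-- At the time `t` all the identities required of a weak solution hold. -/
structure Good (t : ℝ) : Prop where
  mem : t ∈ Ioo 0 P.T
  s_eq : ∀ i, fn (S.sqrtU i t) =ᵐ[volume.restrict P.Ω] fun x => J.s i (t, x)
  u_eq : ∀ i, fn (S.u i t) =ᵐ[volume.restrict P.Ω] fun x => J.u i (t, x)
  U_eq : ∀ i, wgrad (S.u i t) =ᵐ[volume.restrict P.Ω] fun x => J.U i (t, x)
  V_eq : wgrad (S.Φ t) =ᵐ[volume.restrict P.Ω] fun x => J.V (t, x)
  rep_eq : ∀ i, ∀ φ : W1 P.Ω 4, S.rep i t φ = ∫ x in P.Ω, fn (S.u i t) x * fn φ x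
  potential : IsPotential P (charge P fun i => fn (S.u i t)) (S.Φ t)

theorem ae_good : ∀ᵐ t ∂(volume.restrict (Ioo 0 P.T)), J.Good t := by
  filter_upwards [ae_restrict_mem measurableSet_Ioo, ae_all_iff.2 J.sqrt_eq, ae_all_iff.2 J.u_eq,
    ae_all_iff.2 J.u_grad_eq, J.V_eq, ae_all_iff.2 S.rep_eq, S.poisson] with t h1 h2 h3 h4 h5 h6 h7
  exact ⟨h1, h2, h3, h4, h5, h6, h7⟩

variable {J Jb}

theorem Good.isTrace {t : ℝ} (h : J.Good t) (i : Fin n) : S.IsTrace i t fun x => J.u i (t, x) :=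
  ⟨(fn_memLp _).ae_eq (h.u_eq i), fun φ => (h.rep_eq i φ).trans
    (integral_congr_ae (by filter_upwards [h.u_eq i] with x hx; rw [hx]))⟩

theorem Good.isState {t : ℝ} (h : J.Good t) : IsState P (fun i x => J.u i (t, x)) (S.Φ t) :=
  ⟨fun i => (h.isTrace i).1, fun i => .of_forall fun x => J.u_nonneg i _, h.potential.congr (by
    filter_upwards [ae_all_iff.2 h.u_eq] with x hx
    simp only [charge, hx])⟩

theorem Good.sq_eq {t : ℝ} (h : J.Good t) (i : Fin n) :
    ∀ᵐ x ∂(volume.restrict P.Ω), fn (S.u i t) x = fn (S.sqrtU i t) x ^ 2 := by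
  filter_upwards [h.s_eq i, h.u_eq i] with x h1 h2
  rw [h1, h2]; rfl

variable (J Jb)

/-- The gradient of the test function for `uᵢ`. -/
noncomputable def gU (ε : ℝ) (i : Fin n) (q : ℝ × E d) : E d :=
  P.gradU ε (fun j => Jb.u j q) (fun j => Jb.U j q) (Jb.V q) i

/-- The gradient of the test function for `ūᵢ`. -/
noncomputable def gB (ε : ℝ) (i : Fin n) (q q' : ℝ × E d) : E d :=
  P.gradB ε (fun j => J.u j q) (fun j => Jb.u j q') (fun j => J.U j q) (fun j => Jb.U j q')
    (J.V q) (Jb.V q') i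

/-- The space-time function `crossDensity`. -/
noncomputable def c (ε : ℝ) (q : ℝ × E d) : ℝ :=
  P.crossDensity ε (fn P.ΦD q.2) (wgrad P.ΦD q.2) (fun j => J.u j q) (fun j => Jb.u j q)
    (J.V q) (Jb.V q)

/-- Bounded gradients. -/
def IsBdd (M : ℝ) : Prop := 0 ≤ M ∧ (∀ q, ‖Jb.V q‖ ≤ M) ∧ ∀ i q, ‖Jb.U i q‖ ≤ M

variable {J Jb}

theorem norm_gU_le {ε M : ℝ} (hε : 0 < ε) (hσ : 0 < P.σ) (hM : Jb.IsBdd M) (i : Fin n)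
    (q : ℝ × E d) : ‖Jb.gU ε i q‖ ≤ |P.z i| * M + ∑ j, |P.a i j| * M + P.σ / ε * M := by
  obtain ⟨h0, hV, hU⟩ := hM
  have hu := Jb.u_nonneg i q
  refine (norm_add₃_le).trans (add_le_add (add_le_add ?_ ?_) ?_)
  · rw [norm_smul]; exact mul_le_mul_of_nonneg_left (hV q) (norm_nonneg _)
  · refine (norm_sum_le _ _).trans (Finset.sum_le_sum fun j _ => ?_)
    rw [norm_smul]; exact mul_le_mul_of_nonneg_left (hU j q) (norm_nonneg _)
  · rw [norm_smul, Real.norm_of_nonneg (by positivity)]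
    exact mul_le_mul (div_le_div_of_nonneg_left hσ.le hε (by linarith)) (hU i q)
      (norm_nonneg _) (by positivity)

/-- The bound does not involve the second point q', so it dominates the test gradients uniformly in
the time shift. -/
theorem norm_gB_le {ε M : ℝ} (hε : 0 < ε) (hσ : 0 < P.σ) (hM : Jb.IsBdd M) (i : Fin n)
    (q q' : ℝ × E d) : ‖gB J Jb ε i q q'‖ ≤ |P.z i| * (‖J.V q‖ + M) +
      ∑ j, |P.a i j| * (‖J.U j q‖ + M) + P.σ / ε * ‖J.U i q‖ + P.σ / ε ^ 2 * M * J.u i q := by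
  obtain ⟨h0, hV, hU⟩ := hM
  have hu := Jb.u_nonneg i q'
  have hu' := J.u_nonneg i q
  refine (norm_sub_le _ _).trans (add_le_add (norm_add₃_le.trans
    (add_le_add (add_le_add ?_ ?_) ?_)) ?_)
  · rw [norm_smul]
    exact mul_le_mul_of_nonneg_left ((norm_sub_le _ _).trans (add_le_add le_rfl (hV q')))
      (norm_nonneg _)
  · refine (norm_sum_le _ _).trans (Finset.sum_le_sum fun j _ => ?_)
    rw [norm_smul]
    exact mul_le_mul_of_nonneg_left ((norm_sub_le _ _).trans (add_le_add le_rfl (hU j q')))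
      (norm_nonneg _)
  · rw [norm_smul, Real.norm_of_nonneg (by positivity)]
    exact mul_le_mul_of_nonneg_right (div_le_div_of_nonneg_left hσ.le hε (by linarith))
      (norm_nonneg _)
  · rw [norm_smul, Real.norm_of_nonneg (by positivity)]
    calc P.σ * J.u i q / (Jb.u i q' + ε) ^ 2 * ‖Jb.U i q'‖ ≤ P.σ * J.u i q / ε ^ 2 * M :=
          mul_le_mul (div_le_div_of_nonneg_left (by positivity) (by positivity)
            (pow_le_pow_left₀ hε.le (by linarith) 2)) (hU i q') (norm_nonneg _) (by positivity)
      _ = P.σ / ε ^ 2 * M * J.u i q := by ring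

/-- The test function is frozen at the final time and has bounded gradient, so an L¹ flux is enough.
The earlier density enters only through its trace, which permits r = 0. -/
theorem integral_testU (hP : Assumptions P) {ε M : ℝ} (hε : 0 < ε) (hM : Jb.IsBdd M) {i : Fin n}
    {r r' : ℝ} (hr : 0 ≤ r) (hrr : r ≤ r') (h' : J.Good r') (hb' : Jb.Good r') {w : E d → ℝ}
    (hw : S.IsTrace i r w) :
    ∫ x in P.Ω, (J.u i (r', x) - w x) *
        P.testU ε (fun j => Jb.u j (r', x)) (fn (Sb.Φ r') x) i =
      - ∫ q, ⟪J.F i q, Jb.gU ε i (r', q.2)⟫_ℝ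
        ∂((volume.restrict (Ioo r r')).prod (volume.restrict P.Ω)) := by
  obtain ⟨v, hv1, hv2⟩ := exists_H1_testU hP hε (fun j => Sb.sqrtU j r') (fun j => Sb.u j r')
    (Sb.Φ r') hb'.sq_eq i
  have e2 : wgrad v =ᵐ[volume.restrict P.Ω] fun x => Jb.gU ε i (r', x) := by
    filter_upwards [hv2, ae_all_iff.2 hb'.u_eq, ae_all_iff.2 hb'.U_eq, hb'.V_eq] with x h1 h2 h3 h4
    rw [h1]
    simp only [gU, h2, h3, h4]
  have key := J.integral_trace_sub_of_bounded hP.isOpen hP.isBounded hP.lipschitz hr hrr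
    h'.mem.2.le hw (h'.isTrace i) v (M := |P.z i| * M + ∑ j, |P.a i j| * M + P.σ / ε * M) (by
      filter_upwards [e2] with x hx
      rw [hx]; exact norm_gU_le hε hP.σ_pos hM i _)
  refine Eq.trans (integral_congr_ae ?_) (key.trans (congrArg _ (integral_congr_ae ?_)))
  · filter_upwards [hv1, ae_all_iff.2 hb'.u_eq] with x h1 h2
    simp only [h1, h2]
  · filter_upwards [Measure.quasiMeasurePreserving_snd.ae e2] with q hq
    rw [hq]

theorem integral_testB (hP : Assumptions P) {ε M : ℝ} (hε : 0 < ε) (hM : Jb.IsBdd M) {i : Fin n}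
    {r r' : ℝ} (hrr : r ≤ r') (h : J.Good r) (hb : Jb.Good r) (hb' : Jb.Good r') :
    ∫ x in P.Ω, (Jb.u i (r', x) - Jb.u i (r, x)) *
        P.testB ε (fun j => J.u j (r, x)) (fun j => Jb.u j (r', x)) (fn (S.Φ r) x)
          (fn (Sb.Φ r') x) i =
      - ∫ q, ⟪Jb.F i q, gB J Jb ε i (r, q.2) (r', q.2)⟫_ℝ
        ∂((volume.restrict (Ioo r r')).prod (volume.restrict P.Ω)) := by
  obtain ⟨v, hv1, hv2⟩ := exists_H1_testB hP (M := M) hε (fun j => S.u j r)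
    (fun j => Sb.sqrtU j r') (fun j => Sb.u j r') (S.Φ r) (Sb.Φ r') hb'.sq_eq (fun i => by
      filter_upwards [hb'.U_eq i] with x hx
      rw [hx]; exact hM.2.2 i _) i
  have e2 : wgrad v =ᵐ[volume.restrict P.Ω] fun x => gB J Jb ε i (r, x) (r', x) := by
    filter_upwards [hv2, ae_all_iff.2 hb'.u_eq, ae_all_iff.2 hb'.U_eq, hb'.V_eq,
      ae_all_iff.2 h.u_eq, ae_all_iff.2 h.U_eq, h.V_eq] with x h1 h2 h3 h4 h5 h6 h7
    rw [h1]
    simp only [gB, h2, h3, h4, h5, h6, h7]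
  have key := Jb.integral_trace_sub_of_memLp hP.isOpen hP.isBounded hP.lipschitz
    (Jb.F_memLp_two hM.2.1 hM.2.2 i) h.mem.1.le hrr
    hb'.mem.2.le (hb.isTrace i) (hb'.isTrace i) v
  refine Eq.trans (integral_congr_ae ?_) (key.trans (congrArg _ (integral_congr_ae ?_)))
  · filter_upwards [hv1, ae_all_iff.2 hb'.u_eq, ae_all_iff.2 h.u_eq] with x h1 h2 h3
    simp only [h1, h2, h3]
  · filter_upwards [Measure.quasiMeasurePreserving_snd.ae e2] with q hq
    rw [hq]

theorem cross_eq {ε t : ℝ} (h : J.Good t) (hb : Jb.Good t) :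
    P.cross ε (fun i x => J.u i (t, x)) (fun i x => Jb.u i (t, x)) (wgrad (S.Φ t))
      (wgrad (Sb.Φ t)) = ∫ x in P.Ω, c J Jb ε (t, x) := by
  refine integral_congr_ae ?_
  filter_upwards [h.V_eq, hb.V_eq] with x h1 h2
  simp only [c, h1, h2]

theorem c_sub_le (hP : Assumptions P) {ε M : ℝ} (hε : 0 < ε) (hM : Jb.IsBdd M)
    {r r' : ℝ} (hrr : r ≤ r') (h : J.Good r) (hb : Jb.Good r) (h' : J.Good r') (hb' : Jb.Good r') :
    (∫ x in P.Ω, c J Jb ε (r', x)) - ∫ x in P.Ω, c J Jb ε (r, x) ≤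
      (∑ i, ∫ q, ⟪J.F i q, Jb.gU ε i (r', q.2)⟫_ℝ
        ∂((volume.restrict (Ioo r r')).prod (volume.restrict P.Ω))) +
      ∑ i, ∫ q, ⟪Jb.F i q, gB J Jb ε i (r, q.2) (r', q.2)⟫_ℝ
        ∂((volume.restrict (Ioo r r')).prod (volume.restrict P.Ω)) := by
  have key := cross_twoPoint hP hε h.isState hb.isState h'.isState hb'.isState
  rw [cross_eq h' hb', cross_eq h hb] at key
  refine key.trans (le_of_eq ?_)
  simp only [integral_testU hP hε hM h.mem.1.le hrr h' hb' (h.isTrace _),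
    integral_testB hP hε hM hrr h hb hb', Finset.sum_neg_distrib]
  ring

/-- The second sum is not rewritten as a flux term: its test function contains u⁰, which is merely
in L² and has no gradient. It is made small instead by the strong attainment of the initial data. -/
theorem c_sub_initial_le (hP : Assumptions P) {ε M : ℝ} (hε : 0 < ε) (hM : Jb.IsBdd M)
    {Φ0 : H1 P.Ω} (h0 : IsState P P.u0 Φ0) {r : ℝ} (h : J.Good r) (hb : Jb.Good r) :
    (∫ x in P.Ω, c J Jb ε (r, x)) - P.cross ε P.u0 P.u0 (wgrad Φ0) (wgrad Φ0) ≤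
      (∑ i, ∫ q, ⟪J.F i q, Jb.gU ε i (r, q.2)⟫_ℝ
        ∂((volume.restrict (Ioo 0 r)).prod (volume.restrict P.Ω))) -
      ∑ i, ∫ x in P.Ω, (Jb.u i (r, x) - P.u0 i x) * P.testB ε (fun j => P.u0 j x)
        (fun j => Jb.u j (r, x)) (fn Φ0 x) (fn (Sb.Φ r) x) i := by
  have key := cross_twoPoint hP hε h0 h0 h.isState hb.isState
  rw [cross_eq h hb] at key
  refine key.trans (le_of_eq ?_)
  have htr : ∀ i, S.IsTrace i 0 (P.u0 i) := fun i => ⟨hP.u0_memLp i, S.initial i⟩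
  simp only [integral_testU hP hε hM le_rfl h.mem.1.le h hb (htr _), Finset.sum_neg_distrib]
  ring

end JointRep

end StericPNP

namespace StericPNP

/-! ### Attainment of the initial data -/

section L2Norm

variable {α : Type*} [MeasurableSpace α] {μ : Measure α} {f g : α → ℝ}

/-- The real-valued `L²` seminorm. -/
noncomputable def l2 (μ : Measure α) (f : α → ℝ) : ℝ := (eLpNorm f 2 μ).toReal

theorem l2_nonneg : 0 ≤ l2 μ f := ENNReal.toReal_nonneg

theorem l2_eq_norm (hf : MemLp f 2 μ) : l2 μ f = ‖hf.toLp f‖ := by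
  rw [Lp.norm_toLp]; rfl

theorem l2_add_le (hf : MemLp f 2 μ) (hg : MemLp g 2 μ) :
    l2 μ (fun x => f x + g x) ≤ l2 μ f + l2 μ g := by
  have h : l2 μ (fun x => f x + g x) = ‖(hf.add hg).toLp (f + g)‖ := l2_eq_norm (hf.add hg)
  rw [h, l2_eq_norm hf, l2_eq_norm hg, MemLp.toLp_add]
  exact norm_add_le _ _

theorem l2_sub_le (hf : MemLp f 2 μ) (hg : MemLp g 2 μ) :
    l2 μ (fun x => f x - g x) ≤ l2 μ f + l2 μ g := by
  have h : l2 μ (fun x => f x - g x) = ‖(hf.sub hg).toLp (f - g)‖ := l2_eq_norm (hf.sub hg)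
  rw [h, l2_eq_norm hf, l2_eq_norm hg, MemLp.toLp_sub]
  exact norm_sub_le _ _

theorem l2_le_of_abs_le {c : ℝ} (hc : 0 ≤ c) (hg : MemLp g 2 μ)
    (h : ∀ᵐ x ∂μ, |f x| ≤ c * |g x|) : l2 μ f ≤ c * l2 μ g := by
  have h1 := eLpNorm_le_mul_eLpNorm_of_ae_le_mul (f := f) (g := g) (p := 2) h
  have h2 := ENNReal.toReal_mono (ENNReal.mul_ne_top ENNReal.ofReal_ne_top hg.2.ne) h1
  rwa [ENNReal.toReal_mul, ENNReal.toReal_ofReal hc] at h2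

theorem l2_const_mul_le (c : ℝ) (hg : MemLp g 2 μ) : l2 μ (fun x => c * g x) ≤ |c| * l2 μ g :=
  l2_le_of_abs_le (abs_nonneg c) hg (.of_forall fun x => (abs_mul _ _).le)

theorem l2_sum_le {ι : Type*} (s : Finset ι) {f : ι → α → ℝ} (hf : ∀ i, MemLp (f i) 2 μ) :
    l2 μ (fun x => ∑ i ∈ s, f i x) ≤ ∑ i ∈ s, l2 μ (f i) := by
  classical
  induction s using Finset.induction_on with
  | empty => simp [l2]
  | insert a s ha ih =>
    simp only [Finset.sum_insert ha]
    exact (l2_add_le (hf a) (memLp_finsetSum s fun i _ => hf i)).trans (add_le_add le_rfl ih)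

theorem inner_toLp_eq (hf : MemLp f 2 μ) (hg : MemLp g 2 μ) :
    ⟪hf.toLp f, hg.toLp g⟫_ℝ = ∫ x, f x * g x ∂μ := by
  rw [L2.inner_def]
  refine integral_congr_ae ?_
  filter_upwards [hf.coeFn_toLp, hg.coeFn_toLp] with x h1 h2
  rw [h1, h2]
  simp [mul_comm]

theorem abs_integral_mul_le (hf : MemLp f 2 μ) (hg : MemLp g 2 μ) :
    |∫ x, f x * g x ∂μ| ≤ l2 μ f * l2 μ g := by
  rw [← inner_toLp_eq hf hg, l2_eq_norm hf, l2_eq_norm hg]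
  exact abs_real_inner_le_norm _ _

theorem l2_sq (hf : MemLp f 2 μ) : l2 μ f ^ 2 = ∫ x, f x * f x ∂μ := by
  rw [← inner_toLp_eq hf hf, l2_eq_norm hf, real_inner_self_eq_norm_sq]

end L2Norm

theorem exists_integral_strip_le {d : ℕ} {Ω : Set (E d)} {f : ℝ × E d → ℝ}
    (hf : Integrable f volume) {δ : ℝ} (hδ : 0 < δ) :
    ∃ r₀ > 0, ∀ r, 0 < r → r < r₀ →
      ∫ q, ‖f q‖ ∂((volume.restrict (Ioo 0 r)).prod (volume.restrict Ω)) ≤ δ := by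
  have hf' : Integrable f ((volume : Measure ℝ).prod (volume.restrict Ω)) :=
    hf.mono_measure (by
      rw [Measure.volume_eq_prod]
      exact Measure.prod_mono le_rfl Measure.restrict_le_self)
  have hk : Integrable (fun s : ℝ => ∫ x in Ω, ‖f (s, x)‖) := hf'.integral_norm_prod_left
  have hc := (intervalIntegral.continuous_primitive
    (fun a b => hk.intervalIntegrable) 0).tendsto 0
  rw [intervalIntegral.integral_same] at hc
  obtain ⟨r₀, hr₀, h⟩ := Metric.eventually_nhds_iff.1 (hc.eventually (gt_mem_nhds hδ))
  refine ⟨r₀, hr₀, fun r h0 hr => ?_⟩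
  have h1 := h (y := r) (by rw [Real.dist_eq, sub_zero, abs_of_pos h0]; exact hr)
  rw [integral_prod _ (hf'.norm.mono_measure
    (Measure.prod_mono Measure.restrict_le_self le_rfl)), ← integral_Ioc_eq_integral_Ioo,
    ← intervalIntegral.integral_of_le h0.le]
  exact h1.le

theorem abs_integral_inner_le {α G : Type*} [MeasurableSpace α] {μ : Measure α}
    [NormedAddCommGroup G] [InnerProductSpace ℝ G] {f g : α → G} (hf : Integrable f μ) {K : ℝ}
    (hg : ∀ᵐ x ∂μ, ‖g x‖ ≤ K) : |∫ x, ⟪f x, g x⟫_ℝ ∂μ| ≤ K * ∫ x, ‖f x‖ ∂μ := by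
  rw [← integral_const_mul, ← Real.norm_eq_abs]
  refine norm_integral_le_of_norm_le (hf.norm.const_mul K) ?_
  filter_upwards [hg] with x hx
  refine (norm_inner_le_norm _ _).trans ?_
  rw [mul_comm]
  exact mul_le_mul_of_nonneg_right hx (norm_nonneg _)

variable {d n : ℕ} {P : Data d n}

namespace JointRep

variable {S Sb : WeakSolution P} {J : JointRep S} {Jb : JointRep Sb}

theorem integrable_F (J : JointRep S) (hP : Assumptions P) (i : Fin n) : Integrable (J.F i) :=
  memLp_one_iff_integrable.1 (J.F_memLp_one hP.isBounded hP.isOpen i)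

theorem integrable_F_strip (J : JointRep S) (hP : Assumptions P) (i : Fin n) (r r' : ℝ) :
    Integrable (J.F i) ((volume.restrict (Ioo r r')).prod (volume.restrict P.Ω)) :=
  (J.integrable_F hP i).mono_measure (by
    rw [Measure.volume_eq_prod]
    exact Measure.prod_mono Measure.restrict_le_self Measure.restrict_le_self)

/-- For v = ū(r) − u⁰ and smooth φ close to u⁰ in L², write ‖v‖² = ∫vū(r) − ∫vφ − ∫v(u⁰−φ). The
first two terms are integrals over the strip (0,r) of the flux against the bounded gradients of ū(r)
and φ, hence small; the third is handled by Cauchy–Schwarz. This upgrades the weak attainment of the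
initial data to L². -/
theorem exists_l2_sub_initial_le (hP : Assumptions P) {M : ℝ} (hM : Jb.IsBdd M) (i : Fin n)
    {δ : ℝ} (hδ : 0 < δ) : ∃ r₀ > 0, ∀ r, r < r₀ → Jb.Good r →
      l2 (volume.restrict P.Ω) (fun x => Jb.u i (r, x) - P.u0 i x) ≤ δ := by
  obtain ⟨φ, hφc, hφ, hφδ⟩ : ∃ φ : E d → ℝ, HasCompactSupport φ ∧ ContDiff ℝ ∞ φ ∧
      eLpNorm (P.u0 i - φ) 2 (volume.restrict P.Ω) ≤ ENNReal.ofReal (δ / 2) := by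
    obtain ⟨φ, h1, h2, h3⟩ := (hP.u0_memLp i).exist_eLpNorm_sub_le (by norm_num) (by norm_num)
      (ε := δ / 2) (by positivity)
    exact ⟨φ, h1, h2, h3⟩
  have hφ1 : ContDiff ℝ 1 φ := hφ.of_le (by simp)
  have hφm : MemLp φ 2 (volume.restrict P.Ω) :=
    (hφ.continuous.memLp_of_hasCompactSupport hφc).restrict _
  obtain ⟨K, hK⟩ := (continuous_gradient hφ1).bounded_above_of_compact_support
    (hasCompactSupport_gradient hφc)
  obtain ⟨ψ, hψ1, hψ2⟩ := exists_W1_of_contDiff (Ω := P.Ω) (p := 2) hφ1 hφc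
  have hK0 : 0 ≤ K := (norm_nonneg _).trans (hK 0)
  have hlφ : l2 (volume.restrict P.Ω) (fun x => P.u0 i x - φ x) ≤ δ / 2 := by
    have := ENNReal.toReal_mono ENNReal.ofReal_ne_top hφδ
    rwa [ENNReal.toReal_ofReal (by positivity)] at this
  -- This makes the two flux terms at most δ²/4 together; the 1 covers the case M = K = 0.
  obtain ⟨r₀, hr₀, h⟩ := exists_integral_strip_le (Ω := P.Ω) (Jb.integrable_F hP i).norm
    (δ := δ ^ 2 / (4 * (M + K + 1))) (by have := hM.1; positivity)
  refine ⟨r₀, hr₀, fun r hr hg => ?_⟩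
  have hω := h r hg.mem.1 hr
  simp only [norm_norm] at hω
  set W := ∫ q, ‖Jb.F i q‖ ∂((volume.restrict (Ioo 0 r)).prod (volume.restrict P.Ω)) with hWdef
  have hω0 : 0 ≤ W := integral_nonneg fun _ => norm_nonneg _
  have htr : Sb.IsTrace i 0 (P.u0 i) := ⟨hP.u0_memLp i, Sb.initial i⟩
  have hFi := Jb.integrable_F_strip hP i 0 r
  have hUb : ∀ᵐ x ∂(volume.restrict P.Ω), ‖wgrad (Sb.u i r) x‖ ≤ M := by
    filter_upwards [hg.U_eq i] with x hx
    rw [hx]; exact hM.2.2 i _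
  have hψb : ∀ᵐ x ∂(volume.restrict P.Ω), ‖wgrad ψ x‖ ≤ K := by
    filter_upwards [hψ2] with x hx
    rw [hx]; exact hK x
  have t1 := Jb.integral_trace_sub_of_bounded hP.isOpen hP.isBounded hP.lipschitz le_rfl
    hg.mem.1.le hg.mem.2.le htr (hg.isTrace i) (Sb.u i r) hUb
  have t2 := Jb.integral_trace_sub_of_bounded hP.isOpen hP.isBounded hP.lipschitz le_rfl
    hg.mem.1.le hg.mem.2.le htr (hg.isTrace i) ψ hψb
  have b1 := abs_integral_inner_le hFi (g := fun q : ℝ × E d => wgrad (Sb.u i r) q.2)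
    (Measure.quasiMeasurePreserving_snd.ae hUb)
  have b2 := abs_integral_inner_le hFi (g := fun q : ℝ × E d => wgrad ψ q.2)
    (Measure.quasiMeasurePreserving_snd.ae hψb)
  rw [← hWdef] at b1 b2
  set v : E d → ℝ := fun x => Jb.u i (r, x) - P.u0 i x with hv
  have hvm : MemLp v 2 (volume.restrict P.Ω) := (hg.isTrace i).1.sub htr.1
  have hwm : MemLp (fun x => P.u0 i x - φ x) 2 (volume.restrict P.Ω) := htr.1.sub hφm
  have b3 := abs_integral_mul_le hvm hwm
  have hsplit : l2 (volume.restrict P.Ω) v ^ 2 = (∫ x in P.Ω, v x * fn (Sb.u i r) x) -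
      (∫ x in P.Ω, v x * fn ψ x) - ∫ x in P.Ω, v x * (P.u0 i x - φ x) := by
    have i1 : Integrable (fun x => v x * fn (Sb.u i r) x) (volume.restrict P.Ω) :=
      hvm.integrable_mul (fn_memLp _)
    have i2 : Integrable (fun x => v x * fn ψ x) (volume.restrict P.Ω) :=
      hvm.integrable_mul (fn_memLp _)
    have i3 : Integrable (fun x => v x * (P.u0 i x - φ x)) (volume.restrict P.Ω) :=
      hvm.integrable_mul hwm
    have i4 : Integrable (fun x => v x * fn (Sb.u i r) x - v x * fn ψ x) (volume.restrict P.Ω) :=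
      i1.sub i2
    rw [l2_sq hvm, ← integral_sub i1 i2, ← integral_sub i4 i3]
    refine integral_congr_ae ?_
    filter_upwards [hg.u_eq i, hψ1] with x h1 h2
    simp only [hv, h1, h2]; ring
  have hl0 := l2_nonneg (μ := volume.restrict P.Ω) (f := v)
  have hωb : (M + K) * W ≤ δ ^ 2 / 4 := by
    have hM0 := hM.1
    rw [le_div_iff₀ (by positivity)] at hω
    rw [le_div_iff₀ (by positivity)]
    nlinarith
  have a1 := abs_le.1 b1
  have a2 := abs_le.1 b2
  have a3 := abs_le.1 b3
  have hlw := mul_le_mul_of_nonneg_left hlφ hl0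
  rw [t1, t2] at hsplit
  -- For x = ‖v‖ the estimates give x² ≤ δ²/4 + xδ/2, which is impossible for x > δ.
  by_contra hne
  push Not at hne
  nlinarith [mul_pos hδ (sub_pos.2 hne)]

/-- Each summand of the test function is affine in ū(r) or Φ̄(r), or is u⁰ divided by at least ε.
The regularity estimate bounds Φ̄(r) by the charge, hence by ū(r), which is within 1 of u⁰. -/
theorem exists_l2_testB_initial_le (hP : Assumptions P) {ε : ℝ} (hε : 0 < ε) (Φ0 : H1 P.Ω)
    (i : Fin n) :
    ∃ K ≥ 0, ∀ r, Jb.Good r →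
      (∀ j, l2 (volume.restrict P.Ω) (fun x => Jb.u j (r, x) - P.u0 j x) ≤ 1) →
      l2 (volume.restrict P.Ω) (fun x => P.testB ε (fun j => P.u0 j x)
        (fun j => Jb.u j (r, x)) (fn Φ0 x) (fn (Sb.Φ r) x) i) ≤ K := by
  have := isFiniteMeasure_restrict_of_isBounded hP.isBounded
  set μ := volume.restrict P.Ω with hμ
  obtain ⟨C, hC, hpot⟩ := exists_potential_bound hP
  obtain ⟨A, hAdef⟩ : ∃ A : Fin n → ℝ, ∀ j, A j = l2 μ (P.u0 j) + 1 := ⟨_, fun _ => rfl⟩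
  have hA : ∀ j, 0 ≤ A j := fun j => by
    rw [hAdef]; exact add_nonneg l2_nonneg zero_le_one
  obtain ⟨B, hBdef⟩ : ∃ B : ℝ, B = C * ((∑ j, |P.z j| * A j) + 1) := ⟨_, rfl⟩
  have hB : 0 ≤ B := by
    rw [hBdef]
    exact mul_nonneg hC.le (add_nonneg
      (Finset.sum_nonneg fun j _ => mul_nonneg (abs_nonneg _) (hA j)) zero_le_one)
  refine ⟨|P.z i| * (l2 μ (fn Φ0) + B) + (∑ j, |P.a i j| * (l2 μ (P.u0 j) + A j)) +
    |P.σ| * (1 / ε * l2 μ (P.u0 i)) + l2 μ (fun _ => P.σ), ?_, fun r hg hr => ?_⟩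
  · have h1 : 0 ≤ ∑ j, |P.a i j| * (l2 μ (P.u0 j) + A j) := Finset.sum_nonneg fun j _ =>
      mul_nonneg (abs_nonneg _) (add_nonneg l2_nonneg (hA j))
    have h2 := l2_nonneg (μ := μ) (f := fn Φ0)
    have h3 := l2_nonneg (μ := μ) (f := P.u0 i)
    have h4 := l2_nonneg (μ := μ) (f := fun _ => P.σ)
    exact add_nonneg (add_nonneg (add_nonneg (mul_nonneg (abs_nonneg _) (add_nonneg h2 hB)) h1)
      (mul_nonneg (abs_nonneg _) (mul_nonneg (one_div_pos.2 hε).le h3))) h4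
  · have hum : ∀ j, MemLp (fun x => Jb.u j (r, x)) 2 μ := fun j => (hg.isTrace j).1
    have hu0 := hP.u0_memLp
    have hul : ∀ j, l2 μ (fun x => Jb.u j (r, x)) ≤ A j := fun j => by
      have h1 := l2_add_le (hu0 j) ((hum j).sub (hu0 j))
      have h2 : (fun x => P.u0 j x + ((fun x => Jb.u j (r, x)) - P.u0 j) x) =
          fun x => Jb.u j (r, x) := by ext x; simp
      rw [h2] at h1
      rw [hAdef]
      exact h1.trans (add_le_add le_rfl (hr j))
    have hΦl : l2 μ (fn (Sb.Φ r)) ≤ B := by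
      have hch := hg.isState.memLp_charge
      have h1 := hpot (hch.toLp _) (Sb.Φ r) (hg.isState.potential.congr hch.coeFn_toLp.symm)
      have h2 : l2 μ (fn (Sb.Φ r)) = ‖(Sb.Φ r).1.1‖ := by rw [Lp.norm_def]; rfl
      rw [h2, hBdef]
      refine h1.trans (mul_le_mul_of_nonneg_left (add_le_add ?_ le_rfl) hC.le)
      rw [← l2_eq_norm hch]
      refine (l2_sum_le Finset.univ fun j => (hum j).const_mul (P.z j)).trans
        (Finset.sum_le_sum fun j _ => ?_)
      exact (l2_const_mul_le _ (hum j)).trans (mul_le_mul_of_nonneg_left (hul j) (abs_nonneg _))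
    have hb0 : ∀ᵐ x ∂μ, 0 ≤ Jb.u i (r, x) := .of_forall fun x => Jb.u_nonneg i _
    have m1 : MemLp (fun x => P.z i * (fn Φ0 x - fn (Sb.Φ r) x)) 2 μ :=
      ((fn_memLp Φ0).sub (fn_memLp (Sb.Φ r))).const_mul _
    have m2' : ∀ j, MemLp (fun x => P.a i j * (P.u0 j x - Jb.u j (r, x))) 2 μ := fun j =>
      ((hu0 j).sub (hum j)).const_mul _
    have m2 : MemLp (fun x => ∑ j, P.a i j * (P.u0 j x - Jb.u j (r, x))) 2 μ :=
      memLp_finsetSum _ fun j _ => m2' j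
    have m3' := memLp_div_add hε (hu0 i) (hum i) hb0
    have m3 : MemLp (fun x => P.σ * (P.u0 i x / (Jb.u i (r, x) + ε))) 2 μ := m3'.const_mul _
    refine (l2_sub_le ((m1.add m2).add m3) (memLp_const P.σ)).trans (add_le_add ?_ le_rfl)
    refine (l2_add_le (m1.add m2) m3).trans (add_le_add ?_ ?_)
    · refine (l2_add_le m1 m2).trans (add_le_add ?_ ?_)
      · refine (l2_const_mul_le _ ((fn_memLp Φ0).sub (fn_memLp (Sb.Φ r)))).trans
          (mul_le_mul_of_nonneg_left ?_ (abs_nonneg _))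
        exact (l2_sub_le (fn_memLp Φ0) (fn_memLp (Sb.Φ r))).trans (add_le_add le_rfl hΦl)
      · refine (l2_sum_le _ m2').trans (Finset.sum_le_sum fun j _ => ?_)
        refine (l2_const_mul_le _ ((hu0 j).sub (hum j))).trans
          (mul_le_mul_of_nonneg_left ?_ (abs_nonneg _))
        exact (l2_sub_le (hu0 j) (hum j)).trans (add_le_add le_rfl (hul j))
    · refine (l2_const_mul_le _ m3').trans (mul_le_mul_of_nonneg_left ?_ (abs_nonneg _))
      refine l2_le_of_abs_le (by positivity) (hu0 i) (.of_forall fun x => ?_)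
      have h1 := Jb.u_nonneg i (r, x)
      have h2 : 0 < Jb.u i (r, x) + ε := by linarith
      rw [abs_div, abs_of_pos h2, div_mul_eq_mul_div, one_mul]
      exact div_le_div_of_nonneg_left (abs_nonneg _) hε (by linarith)

/-- The flux term is an L¹ mass on a thin strip times a bounded gradient; the other is a small L²
increment of ū times a test function bounded in L². -/
theorem exists_c_le_initial (hP : Assumptions P) {ε M : ℝ} (hε : 0 < ε) (hM : Jb.IsBdd M)
    {Φ0 : H1 P.Ω} (h0 : IsState P P.u0 Φ0) {δ : ℝ} (hδ : 0 < δ) :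
    ∃ r₀ > 0, ∀ r, r < r₀ → J.Good r → Jb.Good r →
      (∫ x in P.Ω, c J Jb ε (r, x)) ≤ P.cross ε P.u0 P.u0 (wgrad Φ0) (wgrad Φ0) + δ := by
  have := isFiniteMeasure_restrict_of_isBounded hP.isBounded
  choose K hK0 hK using fun i => exists_l2_testB_initial_le (Jb := Jb) hP hε Φ0 i
  let N : Fin n → ℝ := fun i => |P.z i| * M + ∑ j, |P.a i j| * M + P.σ / ε * M
  have hN : ∀ i, 0 ≤ N i := fun i => (norm_nonneg _).trans (norm_gU_le hε hP.σ_pos hM i 0)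
  -- Two sums of n terms each must stay below δ/2.
  have hη : 0 < δ / (2 * (n + 1)) := by positivity
  have hd : ∀ i, 0 < min 1 (δ / (2 * (n + 1)) / (K i + 1)) := fun i =>
    lt_min one_pos (div_pos hη (by linarith [hK0 i]))
  choose r₁ hr₁ h1 using fun i => exists_l2_sub_initial_le (Jb := Jb) hP hM i (hd i)
  choose r₂ hr₂ h2 using fun i => exists_integral_strip_le (Ω := P.Ω) (J.integrable_F hP i).norm
    (δ := δ / (2 * (n + 1)) / (N i + 1)) (div_pos hη (by linarith [hN i]))
  obtain ⟨r₀, hr₀, hr⟩ : ∃ r₀ > 0, ∀ i, r₀ ≤ r₁ i ∧ r₀ ≤ r₂ i := by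
    rcases isEmpty_or_nonempty (Fin n) with he | hne
    · exact ⟨1, one_pos, fun i => he.elim i⟩
    · refine ⟨Finset.univ.inf' Finset.univ_nonempty fun i => min (r₁ i) (r₂ i), ?_, fun i => ?_⟩
      · rw [gt_iff_lt, Finset.lt_inf'_iff]
        exact fun i _ => lt_min (hr₁ i) (hr₂ i)
      · exact le_min_iff.1 (Finset.inf'_le _ (Finset.mem_univ i))
  refine ⟨r₀, hr₀, fun r hrr hg hb => ?_⟩
  have key := c_sub_initial_le hP hε hM h0 hg hb
  have e1 : ∀ i, (∫ q, ⟪J.F i q, Jb.gU ε i (r, q.2)⟫_ℝ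
      ∂((volume.restrict (Ioo 0 r)).prod (volume.restrict P.Ω))) ≤ δ / (2 * (n + 1)) := fun i => by
    have a1 := abs_integral_inner_le (J.integrable_F_strip hP i 0 r)
      (g := fun q : ℝ × E d => Jb.gU ε i (r, q.2)) (K := N i)
      (.of_forall fun q => norm_gU_le hε hP.σ_pos hM i _)
    have a2 := h2 i r hg.mem.1 (hrr.trans_le (hr i).2)
    simp only [norm_norm] at a2
    have hNi := hN i
    rw [le_div_iff₀ (by linarith)] at a2
    have a3 : 0 ≤ ∫ q, ‖J.F i q‖ ∂((volume.restrict (Ioo 0 r)).prod (volume.restrict P.Ω)) :=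
      integral_nonneg fun _ => norm_nonneg _
    have a4 := le_of_abs_le a1
    nlinarith
  have e2 : ∀ i, -(∫ x in P.Ω, (Jb.u i (r, x) - P.u0 i x) * P.testB ε (fun j => P.u0 j x)
        (fun j => Jb.u j (r, x)) (fn Φ0 x) (fn (Sb.Φ r) x) i) ≤ δ / (2 * (n + 1)) := fun i => by
    have hl : ∀ j, _ := fun j => h1 j r (hrr.trans_le (hr j).1) hb
    have a1 := hK i r hb fun j => (hl j).trans (min_le_left _ _)
    have a2 := abs_integral_mul_le (μ := volume.restrict P.Ω)
      (f := fun x => Jb.u i (r, x) - P.u0 i x) ((hb.isTrace i).1.sub (hP.u0_memLp i))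
      (memLp_testB (P := P) hε hP.u0_memLp (fun j => (hb.isTrace j).1)
        (fun j => .of_forall fun x => Jb.u_nonneg j _) (fn_memLp Φ0) (fn_memLp (Sb.Φ r)) i)
    have a3 := (hl i).trans (min_le_right _ _)
    have hKi := hK0 i
    rw [le_div_iff₀ (by linarith)] at a3
    have a4 := neg_le_of_abs_le a2
    have a5 := l2_nonneg (μ := volume.restrict P.Ω) (f := fun x => Jb.u i (r, x) - P.u0 i x)
    have a6 := mul_le_mul_of_nonneg_left a1 a5
    nlinarith
  have s1 := Finset.sum_le_sum fun i (_ : i ∈ Finset.univ) => e1 i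
  have s2 := Finset.sum_le_sum fun i (_ : i ∈ Finset.univ) => e2 i
  rw [Finset.sum_neg_distrib] at s2
  simp only [Finset.sum_const, Finset.card_univ, Fintype.card_fin, nsmul_eq_mul] at s1 s2
  have s3 : (n : ℝ) * (δ / (2 * (n + 1))) ≤ δ / 2 := by
    rw [mul_div_assoc', div_le_div_iff₀ (by positivity) (by positivity)]
    nlinarith
  linarith

end JointRep

end StericPNP

namespace StericPNP

/-! ### Passage to the limit in the time averages -/

variable {d n : ℕ} {P : Data d n}

section TestGradients

theorem stronglyMeasurable_gradU {α : Type*} [MeasurableSpace α] (ε : ℝ) {b : Fin n → α → ℝ}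
    {B : Fin n → α → E d} {V : α → E d} (hb : ∀ j, StronglyMeasurable (b j))
    (hB : ∀ j, StronglyMeasurable (B j)) (hV : StronglyMeasurable V) (i : Fin n) :
    StronglyMeasurable fun x => P.gradU ε (fun j => b j x) (fun j => B j x) (V x) i :=
  ((hV.fun_const_smul (P.z i)).add
    (Finset.stronglyMeasurable_fun_sum _ fun j _ => (hB j).fun_const_smul (P.a i j))).add
    (StronglyMeasurable.smul (measurable_const.div
      ((hb i).measurable.add_const ε)).stronglyMeasurable (hB i))

theorem stronglyMeasurable_gradB {α : Type*} [MeasurableSpace α] (ε : ℝ) {u b : Fin n → α → ℝ}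
    {U B : Fin n → α → E d} {V W : α → E d} (hu : ∀ j, StronglyMeasurable (u j))
    (hb : ∀ j, StronglyMeasurable (b j)) (hU : ∀ j, StronglyMeasurable (U j))
    (hB : ∀ j, StronglyMeasurable (B j)) (hV : StronglyMeasurable V) (hW : StronglyMeasurable W)
    (i : Fin n) :
    StronglyMeasurable fun x => P.gradB ε (fun j => u j x) (fun j => b j x) (fun j => U j x)
      (fun j => B j x) (V x) (W x) i :=
  ((((hV.sub hW).fun_const_smul (P.z i)).add
    (Finset.stronglyMeasurable_fun_sum _ fun j _ => ((hU j).sub (hB j)).fun_const_smul (P.a i j))).add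
    (StronglyMeasurable.smul (measurable_const.div
      ((hb i).measurable.add_const ε)).stronglyMeasurable (hU i))).sub
    (StronglyMeasurable.smul (((hu i).measurable.const_mul P.σ).div
      (((hb i).measurable.add_const ε).pow_const 2)).stronglyMeasurable (hB i))

theorem tendsto_gradU {ι : Type*} {l : Filter ι} {ε : ℝ} (hε : 0 < ε) {b : ι → Fin n → ℝ}
    {B : ι → Fin n → E d} {V : ι → E d} {b₀ : Fin n → ℝ} {B₀ : Fin n → E d} {V₀ : E d}
    (h₀ : ∀ i, 0 ≤ b₀ i) (hb : ∀ j, Tendsto (fun k => b k j) l (𝓝 (b₀ j)))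
    (hB : ∀ j, Tendsto (fun k => B k j) l (𝓝 (B₀ j))) (hV : Tendsto V l (𝓝 V₀)) (i : Fin n) :
    Tendsto (fun k => P.gradU ε (b k) (B k) (V k) i) l (𝓝 (P.gradU ε b₀ B₀ V₀ i)) :=
  ((hV.const_smul (P.z i)).add (tendsto_finsetSum _ fun j _ => (hB j).const_smul (P.a i j))).add
    ((tendsto_const_nhds.div ((hb i).add_const ε) (by linarith [h₀ i])).smul (hB i))

theorem tendsto_gradB {ι : Type*} {l : Filter ι} {ε : ℝ} (hε : 0 < ε) {b : ι → Fin n → ℝ}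
    {B : ι → Fin n → E d} {W : ι → E d} {b₀ : Fin n → ℝ} {B₀ : Fin n → E d} {W₀ : E d}
    (h₀ : ∀ i, 0 ≤ b₀ i) (hb : ∀ j, Tendsto (fun k => b k j) l (𝓝 (b₀ j)))
    (hB : ∀ j, Tendsto (fun k => B k j) l (𝓝 (B₀ j))) (hW : Tendsto W l (𝓝 W₀))
    (u : Fin n → ℝ) (U : Fin n → E d) (V : E d) (i : Fin n) :
    Tendsto (fun k => P.gradB ε u (b k) U (B k) V (W k) i) l (𝓝 (P.gradB ε u b₀ U B₀ V W₀ i)) := by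
  have h1 : b₀ i + ε ≠ 0 := by linarith [h₀ i]
  exact ((((tendsto_const_nhds.sub hW).const_smul (P.z i)).add
    (tendsto_finsetSum _ fun j _ => (tendsto_const_nhds.sub (hB j)).const_smul (P.a i j))).add
    ((tendsto_const_nhds.div ((hb i).add_const ε) h1).smul tendsto_const_nhds)).sub
    ((tendsto_const_nhds.div (((hb i).add_const ε).pow 2) (pow_ne_zero 2 h1)).smul (hB i))

end TestGradients

namespace JointRep

variable {S Sb : WeakSolution P} {J : JointRep S} {Jb : JointRep Sb}

theorem measurable_shift (h : ℝ) : Measurable fun q : ℝ × E d => (q.1 + h, q.2) :=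
  (measurable_fst.add_const h).prodMk measurable_snd

/-- All densities and gradients of ū are bundled into one L² function, so that a single sequence of
time steps serves them all. -/
theorem exists_seq (Jb : JointRep Sb) : ∃ h : ℕ → ℝ, (∀ k, 0 < h k) ∧ Tendsto h atTop (𝓝 0) ∧
    ∀ᵐ q : ℝ × E d, (∀ j, Tendsto (fun k => Jb.u j (q.1 + h k, q.2)) atTop (𝓝 (Jb.u j q))) ∧
      (∀ j, Tendsto (fun k => Jb.U j (q.1 + h k, q.2)) atTop (𝓝 (Jb.U j q))) ∧
      Tendsto (fun k => Jb.V (q.1 + h k, q.2)) atTop (𝓝 (Jb.V q)) := by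
  let Y : ℝ × E d → (Fin n → ℝ) × (Fin n → E d) × E d := fun q =>
    (fun j => Jb.u j q, fun j => Jb.U j q, Jb.V q)
  have hYm : Measurable Y := (measurable_pi_lambda _ fun j => (Jb.u_meas j).measurable).prodMk
    ((measurable_pi_lambda _ fun j => (Jb.U_meas j).measurable).prodMk Jb.V_meas.measurable)
  have hY : MemLp Y 2 volume := by
    have hs : MemLp (fun q => (∑ j, ‖Jb.u j q‖) + (∑ j, ‖Jb.U j q‖) + ‖Jb.V q‖) 2 volume :=
      ((memLp_finsetSum _ fun j _ => (Jb.memLp_u j).norm).add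
        (memLp_finsetSum _ fun j _ => (Jb.memLp_U j).norm)).add Jb.V_memLp.norm
    refine hs.mono' hYm.aestronglyMeasurable (.of_forall fun q => ?_)
    have a1 : 0 ≤ ∑ j, ‖Jb.u j q‖ := Finset.sum_nonneg fun _ _ => norm_nonneg _
    have a2 : 0 ≤ ∑ j, ‖Jb.U j q‖ := Finset.sum_nonneg fun _ _ => norm_nonneg _
    have a3 := norm_nonneg (Jb.V q)
    simp only [Y, Prod.norm_mk, sup_le_iff]
    refine ⟨?_, ?_, by linarith⟩
    · refine (pi_norm_le_iff_of_nonneg (by linarith)).2 fun j => ?_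
      have := Finset.single_le_sum (f := fun j => ‖Jb.u j q‖) (fun _ _ => norm_nonneg _)
        (Finset.mem_univ j)
      linarith
    · refine (pi_norm_le_iff_of_nonneg (by linarith)).2 fun j => ?_
      have := Finset.single_le_sum (f := fun j => ‖Jb.U j q‖) (fun _ _ => norm_nonneg _)
        (Finset.mem_univ j)
      linarith
  obtain ⟨h, h1, h2, h3⟩ := exists_seq_tendsto_translate hY
  refine ⟨h, h1, h2, ?_⟩
  filter_upwards [h3] with q hq
  exact ⟨fun j => ((continuous_apply j).comp continuous_fst).continuousAt.tendsto.comp hq,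
    fun j => ((continuous_apply j).comp (continuous_fst.comp continuous_snd)).continuousAt.tendsto.comp
      hq, (continuous_snd.comp continuous_snd).continuousAt.tendsto.comp hq⟩

theorem integrable_c (hP : Assumptions P) {ε : ℝ} (hε : 0 < ε) :
    Integrable (c J Jb ε) ((volume.restrict (Ioo 0 P.T)).prod (volume.restrict P.Ω)) := by
  have := isFiniteMeasure_restrict_of_isBounded hP.isBounded
  have hle : (volume.restrict (Ioo 0 P.T)).prod (volume.restrict P.Ω) ≤
      (volume : Measure (ℝ × E d)) := by
    rw [Measure.volume_eq_prod]
    exact Measure.prod_mono Measure.restrict_le_self Measure.restrict_le_self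
  exact integrable_crossDensity (P := P) hε (fun i => (J.memLp_u i).mono_measure hle)
    (fun i => (Jb.memLp_u i).mono_measure hle) (fun i => .of_forall fun q => Jb.u_nonneg i q)
    ((fn_memLp P.ΦD).comp_snd _) ((wgrad_memLp P.ΦD).comp_snd _) (J.V_memLp.mono_measure hle)
    (Jb.V_memLp.mono_measure hle)

/-- The integrand of the evolution of the linear part of the relative entropy. -/
noncomputable def k (J : JointRep S) (Jb : JointRep Sb) (ε : ℝ) (q : ℝ × E d) : ℝ :=
  ∑ i, ⟪J.F i q, Jb.gU ε i q⟫_ℝ + ∑ i, ⟪Jb.F i q, gB J Jb ε i q q⟫_ℝ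

theorem tendsto_steklov_gU (hP : Assumptions P) {ε M : ℝ} (hε : 0 < ε) (hM : Jb.IsBdd M)
    {h : ℕ → ℝ} (hpos : ∀ k, 0 < h k) (hlim : Tendsto h atTop (𝓝 0))
    (hae : ∀ᵐ q : ℝ × E d,
      (∀ j, Tendsto (fun k => Jb.u j (q.1 + h k, q.2)) atTop (𝓝 (Jb.u j q))) ∧
      (∀ j, Tendsto (fun k => Jb.U j (q.1 + h k, q.2)) atTop (𝓝 (Jb.U j q))) ∧
      Tendsto (fun k => Jb.V (q.1 + h k, q.2)) atTop (𝓝 (Jb.V q)))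
    {ν : Measure (ℝ × E d)} [IsFiniteMeasure ν] (hν : ν ≤ volume) (i : Fin n) :
    (∀ᶠ k in atTop, Integrable (fun q => ⟪steklov (J.F i) (h k) q, Jb.gU ε i (q.1 + h k, q.2)⟫_ℝ) ν) ∧
    Integrable (fun q => ⟪J.F i q, Jb.gU ε i q⟫_ℝ) ν ∧
    Tendsto (fun k => ∫ q, ⟪steklov (J.F i) (h k) q, Jb.gU ε i (q.1 + h k, q.2)⟫_ℝ ∂ν) atTop
      (𝓝 (∫ q, ⟪J.F i q, Jb.gU ε i q⟫_ℝ ∂ν)) := by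
  refine tendsto_integral_steklov_inner (p := 1) (q := ⊤) le_rfl (by simp) hν
    (J.F_memLp_one hP.isBounded hP.isOpen i) (J.F_meas i) hpos hlim
    (g := fun k q => Jb.gU ε i (q.1 + h k, q.2)) (fun k => ?_)
    (D := fun _ => |P.z i| * M + ∑ j, |P.a i j| * M + P.σ / ε * M) (memLp_top_const _)
    (fun k => .of_forall fun q => norm_gU_le hε hP.σ_pos hM i _) ?_
  · exact ((stronglyMeasurable_gradU ε Jb.u_meas Jb.U_meas Jb.V_meas i).comp_measurable
      (measurable_shift (h k))).aestronglyMeasurable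
  · filter_upwards [(Measure.absolutelyContinuous_of_le hν).ae_le hae] with q hq
    exact tendsto_gradU hε (fun j => Jb.u_nonneg j q) hq.1 hq.2.1 hq.2.2 i

theorem memLp_gB_bound (J : JointRep S) {ε M : ℝ} {ν : Measure (ℝ × E d)} [IsFiniteMeasure ν]
    (hν : ν ≤ volume) (i : Fin n) :
    MemLp (fun q => |P.z i| * (‖J.V q‖ + M) +
      ∑ j, |P.a i j| * (‖J.U j q‖ + M) + P.σ / ε * ‖J.U i q‖ + P.σ / ε ^ 2 * M * J.u i q) 2 ν := by
  have m1 := (J.V_memLp.mono_measure hν).norm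
  have m2 : ∀ j, MemLp (fun q => ‖J.U j q‖) 2 ν := fun j => ((J.memLp_U j).mono_measure hν).norm
  have m3 := (J.memLp_u i).mono_measure hν
  exact ((((m1.add (memLp_const M)).const_mul _).add (memLp_finsetSum _ fun j _ =>
    ((m2 j).add (memLp_const M)).const_mul _)).add ((m2 i).const_mul _)).add (m3.const_mul _)

theorem tendsto_steklov_gB (hP : Assumptions P) {ε M : ℝ} (hε : 0 < ε) (hM : Jb.IsBdd M)
    {h : ℕ → ℝ} (hpos : ∀ k, 0 < h k) (hlim : Tendsto h atTop (𝓝 0))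
    (hae : ∀ᵐ q : ℝ × E d,
      (∀ j, Tendsto (fun k => Jb.u j (q.1 + h k, q.2)) atTop (𝓝 (Jb.u j q))) ∧
      (∀ j, Tendsto (fun k => Jb.U j (q.1 + h k, q.2)) atTop (𝓝 (Jb.U j q))) ∧
      Tendsto (fun k => Jb.V (q.1 + h k, q.2)) atTop (𝓝 (Jb.V q)))
    {ν : Measure (ℝ × E d)} [IsFiniteMeasure ν] (hν : ν ≤ volume) (i : Fin n) :
    (∀ᶠ k in atTop,
      Integrable (fun q => ⟪steklov (Jb.F i) (h k) q, gB J Jb ε i q (q.1 + h k, q.2)⟫_ℝ) ν) ∧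
    Integrable (fun q => ⟪Jb.F i q, gB J Jb ε i q q⟫_ℝ) ν ∧
    Tendsto (fun k => ∫ q, ⟪steklov (Jb.F i) (h k) q, gB J Jb ε i q (q.1 + h k, q.2)⟫_ℝ ∂ν) atTop
      (𝓝 (∫ q, ⟪Jb.F i q, gB J Jb ε i q q⟫_ℝ ∂ν)) := by
  refine tendsto_integral_steklov_inner (p := 2) (q := 2) (by norm_num) (by norm_num) hν
    (Jb.F_memLp_two hM.2.1 hM.2.2 i) (Jb.F_meas i) hpos hlim
    (g := fun k q => gB J Jb ε i q (q.1 + h k, q.2)) (fun k => ?_)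
    (memLp_gB_bound J (ε := ε) (M := M) hν i)
    (fun k => .of_forall fun q => norm_gB_le hε hP.σ_pos hM i _ _) ?_
  · have hs := measurable_shift (d := d) (h k)
    exact (stronglyMeasurable_gradB ε J.u_meas (fun j => (Jb.u_meas j).comp_measurable hs)
      J.U_meas (fun j => (Jb.U_meas j).comp_measurable hs) J.V_meas
      (Jb.V_meas.comp_measurable hs) i).aestronglyMeasurable
  · filter_upwards [(Measure.absolutelyContinuous_of_le hν).ae_le hae] with q hq
    exact tendsto_gradB hε (fun j => Jb.u_nonneg j q) hq.1 hq.2.1 hq.2.2 _ _ _ i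

/-- The two-point inequality in terms of time averages of the fluxes. -/
theorem c_sub_le_steklov (hP : Assumptions P) {ε M : ℝ} (hε : 0 < ε) (hM : Jb.IsBdd M)
    {r h : ℝ} (hh : 0 < h) (hg : J.Good r) (hb : Jb.Good r) (hg' : J.Good (r + h))
    (hb' : Jb.Good (r + h)) :
    (∫ x in P.Ω, c J Jb ε (r + h, x)) - ∫ x in P.Ω, c J Jb ε (r, x) ≤
      h * ((∑ i, ∫ x in P.Ω, ⟪steklov (J.F i) h (r, x), Jb.gU ε i (r + h, x)⟫_ℝ) +
        ∑ i, ∫ x in P.Ω, ⟪steklov (Jb.F i) h (r, x), gB J Jb ε i (r, x) (r + h, x)⟫_ℝ) := by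
  have := isFiniteMeasure_restrict_of_isBounded hP.isBounded
  have hle : (volume : Measure ℝ).prod (volume.restrict P.Ω) ≤ (volume : Measure (ℝ × E d)) := by
    rw [Measure.volume_eq_prod]
    exact Measure.prod_mono le_rfl Measure.restrict_le_self
  refine (c_sub_le hP hε hM (by linarith) hg hb hg' hb').trans (le_of_eq ?_)
  rw [mul_add, Finset.mul_sum, Finset.mul_sum]
  congr 1
  · refine Finset.sum_congr rfl fun i _ => ?_
    refine integral_strip_eq_steklov (p := 1) (q := ⊤) le_rfl
      ((J.F_memLp_one hP.isBounded hP.isOpen i).mono_measure hle) hh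
      (g := fun x => Jb.gU ε i (r + h, x)) (memLp_top_of_bound ?_
        (|P.z i| * M + ∑ j, |P.a i j| * M + P.σ / ε * M)
        (.of_forall fun x => norm_gU_le hε hP.σ_pos hM i _))
    exact ((stronglyMeasurable_gradU ε Jb.u_meas Jb.U_meas Jb.V_meas i).comp_measurable
      measurable_prodMk_left).aestronglyMeasurable
  · refine Finset.sum_congr rfl fun i _ => ?_
    refine integral_strip_eq_steklov (p := 2) (q := 2) (by norm_num)
      ((Jb.F_memLp_two hM.2.1 hM.2.2 i).mono_measure hle) hh
      (g := fun x => gB J Jb ε i (r, x) (r + h, x)) ?_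
    have hl : ∀ s : ℝ, Measurable fun x : E d => (s, x) := fun s => measurable_prodMk_left
    have m1 : MemLp (fun x => ‖J.V (r, x)‖) 2 (volume.restrict P.Ω) :=
      ((wgrad_memLp _).ae_eq hg.V_eq).norm
    have m2 : ∀ j, MemLp (fun x => ‖J.U j (r, x)‖) 2 (volume.restrict P.Ω) := fun j =>
      ((wgrad_memLp _).ae_eq (hg.U_eq j)).norm
    have m3 := (hg.isTrace i).1
    refine MemLp.mono' (((((m1.add (memLp_const M)).const_mul |P.z i|).add
      (memLp_finsetSum Finset.univ fun j _ => ((m2 j).add (memLp_const M)).const_mul |P.a i j|)).add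
      ((m2 i).const_mul (P.σ / ε))).add (m3.const_mul (P.σ / ε ^ 2 * M))) ?_
      (.of_forall fun x => norm_gB_le hε hP.σ_pos hM i _ _)
    exact (stronglyMeasurable_gradB ε (fun j => (J.u_meas j).comp_measurable (hl r))
      (fun j => (Jb.u_meas j).comp_measurable (hl _))
      (fun j => (J.U_meas j).comp_measurable (hl r)) (fun j => (Jb.U_meas j).comp_measurable (hl _))
      (J.V_meas.comp_measurable (hl r)) (Jb.V_meas.comp_measurable (hl _)) i).aestronglyMeasurable

end JointRep

end StericPNP

namespace StericPNP

/-! ### Evolution of the linear part of the relative entropy -/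

variable {d n : ℕ} {P : Data d n}

namespace JointRep

variable {S Sb : WeakSolution P} {J : JointRep S} {Jb : JointRep Sb}

/-- Integrate the two-point inequality for (r, r+h) over r ∈ (0,t) and divide by h. On the left the
integrals telescope to the mean of `c` over (t, t+h) minus its mean over (0, h). The first tends to
the value at t at Lebesgue points; the second is at most the initial value plus δ. On the right the
averaged fluxes converge. Neither continuity in time of `c` nor convergence of its initial means is
needed, only the upper bound near 0. -/
theorem ae_c_sub_initial_le (hP : Assumptions P) {ε M : ℝ} (hε : 0 < ε) (hM : Jb.IsBdd M)
    {Φ0 : H1 P.Ω} (h0 : IsState P P.u0 Φ0) :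
    ∀ᵐ t ∂(volume.restrict (Ioo 0 P.T)),
      Integrable (J.k Jb ε) ((volume.restrict (Ioo 0 t)).prod (volume.restrict P.Ω)) ∧
      (∫ x in P.Ω, c J Jb ε (t, x)) - P.cross ε P.u0 P.u0 (wgrad Φ0) (wgrad Φ0) ≤
        ∫ q, J.k Jb ε q ∂((volume.restrict (Ioo 0 t)).prod (volume.restrict P.Ω)) := by
  have := isFiniteMeasure_restrict_of_isBounded hP.isBounded
  set C₀ := P.cross ε P.u0 P.u0 (wgrad Φ0) (wgrad Φ0)
  -- Extended by zero, the function is integrable on the line and may be shifted; for small steps r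
  -- + h stays inside (0,T), so the extension is not seen.
  let Cf : ℝ → ℝ := (Ioo 0 P.T).indicator fun s => ∫ x in P.Ω, c J Jb ε (s, x)
  have hCf : Integrable Cf :=
    (integrable_indicator_iff measurableSet_Ioo).2 (integrable_c hP hε).integral_prod_left
  have hCmem : ∀ s ∈ Ioo 0 P.T, Cf s = ∫ x in P.Ω, c J Jb ε (s, x) := fun s hs =>
    indicator_of_mem hs _
  have hgood : ∀ᵐ s : ℝ, s ∈ Ioo 0 P.T → J.Good s ∧ Jb.Good s := by
    rw [← ae_restrict_iff' measurableSet_Ioo]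
    filter_upwards [J.ae_good, Jb.ae_good] with s h1 h2 using ⟨h1, h2⟩
  obtain ⟨h, hpos, hlim, hae⟩ := exists_seq Jb
  filter_upwards [ae_restrict_of_ae (LocallyIntegrable.ae_hasDerivAt_integral hCf.locallyIntegrable),
    ae_restrict_mem measurableSet_Ioo] with t ht htm
  set ν := (volume.restrict (Ioo 0 t)).prod (volume.restrict P.Ω) with hνdef
  have hν : ν ≤ (volume : Measure (ℝ × E d)) := by
    rw [hνdef, Measure.volume_eq_prod]
    exact Measure.prod_mono Measure.restrict_le_self Measure.restrict_le_self
  have hU := fun i => tendsto_steklov_gU (J := J) hP hε hM hpos hlim hae hν i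
  have hB := fun i => tendsto_steklov_gB (J := J) hP hε hM hpos hlim hae hν i
  have iU := integrable_finsetSum Finset.univ fun i _ => (hU i).2.1
  have iB := integrable_finsetSum Finset.univ fun i _ => (hB i).2.1
  refine ⟨iU.add iB, ?_⟩
  have hkint : ∫ q, J.k Jb ε q ∂ν = (∑ i, ∫ q, ⟪J.F i q, Jb.gU ε i q⟫_ℝ ∂ν) +
      ∑ i, ∫ q, ⟪Jb.F i q, gB J Jb ε i q q⟫_ℝ ∂ν := by
    rw [← integral_finsetSum _ fun i _ => (hU i).2.1, ← integral_finsetSum _ fun i _ => (hB i).2.1,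
      ← integral_add iU iB]
    rfl
  let X : ℕ → ℝ := fun k =>
    (∑ i, ∫ q, ⟪steklov (J.F i) (h k) q, Jb.gU ε i (q.1 + h k, q.2)⟫_ℝ ∂ν) +
      ∑ i, ∫ q, ⟪steklov (Jb.F i) (h k) q, gB J Jb ε i q (q.1 + h k, q.2)⟫_ℝ ∂ν
  have hX : Tendsto X atTop (𝓝 (∫ q, J.k Jb ε q ∂ν)) := by
    rw [hkint]
    exact (tendsto_finsetSum _ fun i _ => (hU i).2.2).add (tendsto_finsetSum _ fun i _ => (hB i).2.2)
  rw [← hCmem t htm]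
  refine le_of_forall_pos_le_add fun δ hδ => ?_
  obtain ⟨r₀, hr₀, hinit⟩ := exists_c_le_initial (J := J) (Jb := Jb) hP hε hM h0 hδ
  let I : ℝ → ℝ := fun x => ∫ s in (0 : ℝ)..x, Cf s
  have hii : ∀ a b, IntervalIntegrable Cf volume a b := fun a b => hCf.intervalIntegrable
  have hslope : Tendsto (fun k => (h k)⁻¹ * (I (t + h k) - I t)) atTop (𝓝 (Cf t)) := by
    have h1 := (ht 0).tendsto_slope_zero
    have h2 : Tendsto h atTop (𝓝[≠] 0) := tendsto_nhdsWithin_iff.2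
      ⟨hlim, .of_forall fun k => (hpos k).ne'⟩
    exact h1.comp h2
  suffices hev : ∀ᶠ k in atTop, (h k)⁻¹ * (I (t + h k) - I t) ≤ C₀ + δ + X k by
    have := le_of_tendsto_of_tendsto hslope (hX.const_add (C₀ + δ)) hev
    linarith
  filter_upwards [hlim.eventually (gt_mem_nhds hr₀), hlim.eventually (gt_mem_nhds (sub_pos.2 htm.2)),
    eventually_all.2 fun i => (hU i).1, eventually_all.2 fun i => (hB i).1] with k k1 k2 k3 k4
  have hk := hpos k
  have hshift : ∀ᵐ s : ℝ, s + h k ∈ Ioo 0 P.T → J.Good (s + h k) ∧ Jb.Good (s + h k) :=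
    (measurePreserving_add_right volume (h k)).quasiMeasurePreserving.ae hgood
  have hA : ∫ r in Ioo 0 t, (Cf (r + h k) - Cf r) ≤ h k * X k := by
    have j1 : ∀ i, Integrable (fun r => ∫ x in P.Ω, ⟪steklov (J.F i) (h k) (r, x),
        Jb.gU ε i (r + h k, x)⟫_ℝ) (volume.restrict (Ioo 0 t)) := fun i => (k3 i).integral_prod_left
    have j2 : ∀ i, Integrable (fun r => ∫ x in P.Ω, ⟪steklov (Jb.F i) (h k) (r, x),
        gB J Jb ε i (r, x) (r + h k, x)⟫_ℝ) (volume.restrict (Ioo 0 t)) := fun i =>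
      (k4 i).integral_prod_left
    have j1s := integrable_finsetSum Finset.univ fun i _ => j1 i
    have j2s := integrable_finsetSum Finset.univ fun i _ => j2 i
    have hXk : h k * X k = ∫ r in Ioo 0 t, h k * ((∑ i, ∫ x in P.Ω, ⟪steklov (J.F i) (h k) (r, x),
        Jb.gU ε i (r + h k, x)⟫_ℝ) + ∑ i, ∫ x in P.Ω, ⟪steklov (Jb.F i) (h k) (r, x),
        gB J Jb ε i (r, x) (r + h k, x)⟫_ℝ) := by
      rw [integral_const_mul, integral_add j1s j2s, integral_finsetSum _ fun i _ => j1 i,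
        integral_finsetSum _ fun i _ => j2 i]
      simp only [X, hνdef]
      congr 2
      · exact Finset.sum_congr rfl fun i _ => integral_prod _ (k3 i)
      · exact Finset.sum_congr rfl fun i _ => integral_prod _ (k4 i)
    rw [hXk]
    refine integral_mono_ae ((hCf.comp_add_right (h k)).sub hCf).integrableOn
      ((j1s.add j2s).const_mul _) ?_
    filter_upwards [ae_restrict_mem measurableSet_Ioo, ae_restrict_of_ae hgood,
      ae_restrict_of_ae hshift] with r hr g1 g2
    have hr1 : r ∈ Ioo 0 P.T := ⟨hr.1, hr.2.trans htm.2⟩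
    have hr2 : r + h k ∈ Ioo 0 P.T := ⟨by linarith [hr.1], by linarith [hr.2]⟩
    simp only [hCmem r hr1, hCmem _ hr2]
    exact c_sub_le_steklov hP hε hM hk (g1 hr1).1 (g1 hr1).2 (g2 hr2).1 (g2 hr2).2
  -- The telescoping identity, in terms of the primitive I.
  have hBint : ∫ r in Ioo 0 t, (Cf (r + h k) - Cf r) = I (t + h k) - I (h k) - I t := by
    have e1 := intervalIntegral.integral_interval_sub_left (hii 0 (t + h k)) (hii 0 (h k))
    rw [← integral_Ioc_eq_integral_Ioo, ← intervalIntegral.integral_of_le htm.1.le,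
      intervalIntegral.integral_sub (hCf.comp_add_right (h k)).intervalIntegrable (hii _ _),
      intervalIntegral.integral_comp_add_right, zero_add, ← e1]
  have hC : I (h k) ≤ h k * (C₀ + δ) := by
    have e1 : h k * (C₀ + δ) = ∫ _ in Ioo 0 (h k), (C₀ + δ) := by
      simp [hk.le]
    simp only [I]
    rw [intervalIntegral.integral_of_le hk.le, integral_Ioc_eq_integral_Ioo, e1]
    refine integral_mono_ae hCf.integrableOn (integrable_const _) ?_
    filter_upwards [ae_restrict_mem measurableSet_Ioo, ae_restrict_of_ae hgood] with r hr g1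
    have hr1 : r ∈ Ioo 0 P.T := ⟨hr.1, by linarith [hr.2, htm.1]⟩
    rw [hCmem r hr1]
    exact hinit r (hr.2.trans k1) (g1 hr1).1 (g1 hr1).2
  rw [hBint] at hA
  rw [← div_eq_inv_mul, div_le_iff₀ hk]
  nlinarith

end JointRep

end StericPNP

namespace StericPNP

/-! ### Estimate of the dissipation -/

/-- The dissipation identity for one species. -/
theorem dissipation_identity {H : Type*} [NormedAddCommGroup H] [InnerProductSpace ℝ H]
    {σ s w b ε : ℝ} (hw : w = b + ε) (hw0 : w ≠ 0) (g B D Db : H) :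
    ⟪σ • ((2 * s) • g) + s ^ 2 • D, Db + (σ / w) • B⟫_ℝ
      + ⟪σ • B + b • Db, (D - Db) + (σ / w) • ((2 * s) • g) - (σ * s ^ 2 / w ^ 2) • B⟫_ℝ
      - ‖(2 * σ) • g + s • D‖ ^ 2 =
    -(‖σ • (2 • g - (s / w) • B)‖ ^ 2 + ⟪σ • (2 • g - (s / w) • B), s • (D - Db)⟫_ℝ
      + ‖s • (D - Db)‖ ^ 2)
      - (ε / w * s) * ⟪Db, σ • (2 • g - (s / w) • B)⟫_ℝ - (s ^ 2 - b) * ⟪Db, D - Db⟫_ℝ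
      - σ * ⟪(2 * s) • g - B, D - Db⟫_ℝ := by
  have hε : ε = w - b := by linarith
  subst hε
  have h2 : (2 : ℕ) • g = (2 : ℝ) • g := by rw [two_smul, two_smul]
  simp only [h2, ← real_inner_self_eq_norm_sq, inner_add_left, inner_add_right, inner_sub_left,
    inner_sub_right, real_inner_smul_left, real_inner_smul_right]
  rw [real_inner_comm g B, real_inner_comm g D, real_inner_comm g Db, real_inner_comm B D,
    real_inner_comm B Db, real_inner_comm D Db]
  field_simp
  ring

/-- In the identity let A be the relative gradient σ(2∇√u − (√u/w)∇ū) and b' = √u(D − Db). The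
quadratic form gives −½‖A‖², which absorbs the regularization error containing A by Young's
inequality. The error with u − ū is split with a small parameter η. The term −σ⟨∇(u−ū), D − Db⟩ is
kept, since it becomes coercive only after summation over the species. -/
theorem dissipation_le {H : Type*} [NormedAddCommGroup H] [InnerProductSpace ℝ H]
    {σ s w b ε M η : ℝ} (hw : w = b + ε) (hw0 : 0 < w) (hη : 0 < η) (g B D Db : H)
    (hM : ‖Db‖ ≤ M) :
    ⟪σ • ((2 * s) • g) + s ^ 2 • D, Db + (σ / w) • B⟫_ℝ
      + ⟪σ • B + b • Db, (D - Db) + (σ / w) • ((2 * s) • g) - (σ * s ^ 2 / w ^ 2) • B⟫_ℝ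
      - ‖(2 * σ) • g + s • D‖ ^ 2 ≤
    1 / 2 * M ^ 2 * ((ε / w) ^ 2 * s ^ 2) + M ^ 2 / (4 * η) * (s ^ 2 - b) ^ 2
      + η * ‖D - Db‖ ^ 2 - σ * ⟪(2 * s) • g - B, D - Db⟫_ℝ := by
  rw [dissipation_identity hw hw0.ne']
  set A := σ • (2 • g - (s / w) • B)
  set b' := s • (D - Db)
  have hM0 : 0 ≤ M := (norm_nonneg _).trans hM
  have e1 : -(‖A‖ ^ 2 + ⟪A, b'⟫_ℝ + ‖b'‖ ^ 2) ≤ -(1 / 2) * ‖A‖ ^ 2 := by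
    have h1 := neg_le_of_abs_le (abs_real_inner_le_norm A b')
    nlinarith [sq_nonneg (‖A‖ - ‖b'‖), sq_nonneg ‖b'‖]
  have e2 : -((ε / w * s) * ⟪Db, A⟫_ℝ) ≤ 1 / 2 * ‖A‖ ^ 2 + 1 / 2 * M ^ 2 * ((ε / w) ^ 2 * s ^ 2) := by
    have h1 : |(ε / w * s) * ⟪Db, A⟫_ℝ| ≤ (|ε / w * s| * M) * ‖A‖ := by
      rw [abs_mul, mul_assoc]
      refine mul_le_mul_of_nonneg_left ((abs_real_inner_le_norm _ _).trans
        (mul_le_mul_of_nonneg_right hM (norm_nonneg _))) (abs_nonneg _)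
    have h2 := neg_le_of_abs_le h1
    have h3 : (|ε / w * s| * M) ^ 2 = M ^ 2 * ((ε / w) ^ 2 * s ^ 2) := by
      rw [mul_pow, sq_abs]; ring
    nlinarith [sq_nonneg (|ε / w * s| * M - ‖A‖)]
  have e3 : -((s ^ 2 - b) * ⟪Db, D - Db⟫_ℝ) ≤ M ^ 2 / (4 * η) * (s ^ 2 - b) ^ 2
      + η * ‖D - Db‖ ^ 2 := by
    have h1 : |(s ^ 2 - b) * ⟪Db, D - Db⟫_ℝ| ≤ (|s ^ 2 - b| * M) * ‖D - Db‖ := by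
      rw [abs_mul, mul_assoc]
      refine mul_le_mul_of_nonneg_left ((abs_real_inner_le_norm _ _).trans
        (mul_le_mul_of_nonneg_right hM (norm_nonneg _))) (abs_nonneg _)
    have h2 := neg_le_of_abs_le h1
    have h3 : M ^ 2 / (4 * η) * (s ^ 2 - b) ^ 2 = (|s ^ 2 - b| * M) ^ 2 / (4 * η) := by
      rw [mul_pow, sq_abs]; ring
    have h4 : (|s ^ 2 - b| * M) * ‖D - Db‖ ≤ (|s ^ 2 - b| * M) ^ 2 / (4 * η) + η * ‖D - Db‖ ^ 2 := by
      rw [div_add' _ _ _ (by positivity), le_div_iff₀ (by positivity)]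
      nlinarith [sq_nonneg (|s ^ 2 - b| * M - 2 * η * ‖D - Db‖)]
    rw [h3]
    linarith
  linarith

theorem relEntropy_nonneg {u w : ℝ} (hu : 0 ≤ u) (hw : 0 < w) :
    0 ≤ u * Real.log u - u - u * Real.log w + w := by
  rcases hu.eq_or_lt with rfl | hu
  · simpa using hw.le
  · have h1 := Real.log_le_sub_one_of_pos (div_pos hw hu)
    rw [Real.log_div hw.ne' hu.ne'] at h1
    have h2 := mul_le_mul_of_nonneg_left h1 hu.le
    have h3 : u * (w / u - 1) = w - u := by field_simp
    linarith

/-- If u ≤ e²w, the left side is at most e²ε²/w ≤ e²ε. If u > e²w, then log(u/w) > 2, so the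
relative entropy density already exceeds u. The threshold e² is chosen for the second case. -/
theorem sq_mul_le_relEntropy {u w ε : ℝ} (hu : 0 ≤ u) (hε : 0 < ε) (hw : ε ≤ w) :
    (ε / w) ^ 2 * u ≤ (u * Real.log u - u - u * Real.log w + w) + Real.exp 2 * ε := by
  have hw0 : 0 < w := hε.trans_le hw
  have hr : ε / w ≤ 1 := (div_le_one hw0).2 hw
  have hr0 : 0 ≤ ε / w := by positivity
  have hh := relEntropy_nonneg hu hw0
  rcases le_or_gt u (Real.exp 2 * w) with h | h
  · have h1 : (ε / w) ^ 2 * u ≤ (ε / w) ^ 2 * (Real.exp 2 * w) :=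
      mul_le_mul_of_nonneg_left h (sq_nonneg _)
    have h2 : (ε / w) ^ 2 * (Real.exp 2 * w) = (ε / w) * (Real.exp 2 * ε) := by
      field_simp
    have h3 : (ε / w) * (Real.exp 2 * ε) ≤ 1 * (Real.exp 2 * ε) :=
      mul_le_mul_of_nonneg_right hr (by positivity)
    linarith
  · have hu0 : 0 < u := lt_of_le_of_lt (by positivity) h
    have h1 : 2 + Real.log w ≤ Real.log u := by
      have := Real.log_le_log (by positivity) h.le
      rwa [Real.log_mul (Real.exp_pos 2).ne' hw0.ne', Real.log_exp] at this
    have h2 := mul_le_mul_of_nonneg_left h1 hu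
    have h3 : (ε / w) ^ 2 * u ≤ 1 * u :=
      mul_le_mul_of_nonneg_right (pow_le_one₀ hr0 hr) hu
    have h4 : 0 < Real.exp 2 * ε := by positivity
    nlinarith

variable {d n : ℕ} {P : Data d n}

/-- The density of the regularized relative entropy. -/
noncomputable def Data.relDensity (P : Data d n) (ε : ℝ) (u ub : Fin n → ℝ) (V Vb : E d) : ℝ :=
  P.σ * ∑ i, (u i * Real.log (u i) - u i - u i * Real.log (ub i + ε) + (ub i + ε))
    + 1 / 2 * ‖V - Vb‖ ^ 2 + 1 / 2 * P.bil (u - ub) (u - ub)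

/-- The constant σεn is the part of ∑(ūᵢ+ε) missing from `crossDensity`; the product with `VD`
remains because the entropy measures ∇Φ relative to ∇Φ_D. -/
theorem entropy_add_crossDensity (hP : Assumptions P) (ε φD : ℝ) (VD V Vb : E d)
    (u ub : Fin n → ℝ) :
    (P.σ * ∑ i, u i * (Real.log (u i) - 1) + 1 / 2 * ‖V - VD‖ ^ 2
      + 1 / 2 * ∑ i, ∑ j, P.a i j * u i * u j + ∑ i, P.z i * u i * φD)
      + P.crossDensity ε φD VD u ub V Vb + P.σ * ε * n =
    P.relDensity ε u ub V Vb - ⟪VD, Vb - VD⟫_ℝ := by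
  have e1 : ∑ i, u i * (P.z i * φD + ∑ j, P.a i j * ub j + P.σ * Real.log (ub i + ε)) =
      (∑ i, P.z i * u i * φD) + P.bil u ub + P.σ * ∑ i, u i * Real.log (ub i + ε) := by
    simp only [Data.bil, Finset.mul_sum, mul_add, Finset.sum_add_distrib]
    congr 1
    · congr 1
      exact Finset.sum_congr rfl fun i _ => by ring
    · exact Finset.sum_congr rfl fun i _ => by ring
  have e2 : ∑ i, (u i * Real.log (u i) - u i - u i * Real.log (ub i + ε) + (ub i + ε)) =
      ∑ i, u i * (Real.log (u i) - 1) - ∑ i, u i * Real.log (ub i + ε) + ∑ i, ub i + n * ε := by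
    rw [← Finset.sum_sub_distrib, ← Finset.sum_add_distrib]
    have : (n : ℝ) * ε = ∑ _i : Fin n, ε := by simp
    rw [this, ← Finset.sum_add_distrib]
    exact Finset.sum_congr rfl fun i _ => by ring
  rw [← bil_eq u u, Data.crossDensity, Data.relDensity, e1, e2, bil_sub_left, bil_sub_right,
    bil_sub_right, bil_comm hP ub u]
  simp only [← real_inner_self_eq_norm_sq, inner_sub_left, inner_sub_right]
  rw [real_inner_comm V Vb, real_inner_comm V VD, real_inner_comm Vb VD]
  linear_combination

theorem le_relDensity {c : ℝ}
    (hc : ∀ x : Fin n → ℝ, c * ∑ i, x i ^ 2 ≤ P.bil x x) (ε : ℝ) (u ub : Fin n → ℝ) (V Vb : E d) :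
    P.σ * (∑ i, (u i * Real.log (u i) - u i - u i * Real.log (ub i + ε) + (ub i + ε)))
      + 1 / 2 * ‖V - Vb‖ ^ 2 + c / 2 * ∑ i, (u i - ub i) ^ 2 ≤ P.relDensity ε u ub V Vb := by
  have := hc (u - ub)
  simp only [Pi.sub_apply] at this
  unfold Data.relDensity
  linarith

/-- For identical states only the regularization survives: u log u ≤ u log(u+ε), leaving ε per
species. -/
theorem relDensity_self_le (hP : Assumptions P) {ε : ℝ} (hε : 0 < ε) {u : Fin n → ℝ}
    (hu : ∀ i, 0 < u i) (V : E d) : P.relDensity ε u u V V ≤ P.σ * ε * n := by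
  have h1 : ∑ i, (u i * Real.log (u i) - u i - u i * Real.log (u i + ε) + (u i + ε)) ≤
      ∑ _i : Fin n, ε := Finset.sum_le_sum fun i _ => by
    have := mul_le_mul_of_nonneg_left (Real.log_le_log (hu i) (by linarith : u i ≤ u i + ε)) (hu i).le
    linarith
  have h2 := mul_le_mul_of_nonneg_left h1 hP.σ_pos.le
  simp only [Finset.sum_const, Finset.card_univ, Fintype.card_fin, nsmul_eq_mul] at h2
  have h3 : P.bil (0 : Fin n → ℝ) 0 = 0 := by simp [Data.bil]
  simp only [Data.relDensity, sub_self, norm_zero, h3]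
  linarith

/-- The gradient of `zᵢ Φ + pᵢ(u)`. -/
noncomputable def Data.drift (P : Data d n) (U : Fin n → E d) (V : E d) (i : Fin n) : E d :=
  P.z i • V + ∑ j, P.a i j • U j

/-- The matrix acts on species indices only, so coercivity for vectors is scalar coercivity summed
over the coordinates. -/
theorem bil_coercive_inner {c : ℝ} (hc : ∀ x : Fin n → ℝ, c * ∑ i, x i ^ 2 ≤ P.bil x x)
    (x : Fin n → E d) : c * ∑ i, ‖x i‖ ^ 2 ≤ ∑ i, ⟪x i, ∑ j, P.a i j • x j⟫_ℝ := by
  have h1 : ∑ i, ‖x i‖ ^ 2 = ∑ k, ∑ i, x i k ^ 2 := by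
    rw [Finset.sum_comm]
    exact Finset.sum_congr rfl fun i _ => EuclideanSpace.real_norm_sq_eq _
  have h2 : ∑ i, ⟪x i, ∑ j, P.a i j • x j⟫_ℝ = ∑ k, P.bil (fun i => x i k) (fun i => x i k) := by
    simp only [Data.bil]
    rw [Finset.sum_comm]
    refine Finset.sum_congr rfl fun i _ => ?_
    rw [PiLp.inner_apply]
    refine Finset.sum_congr rfl fun k _ => ?_
    simp [mul_comm]
  rw [h1, h2, Finset.mul_sum]
  exact Finset.sum_le_sum fun k _ => hc _

-- Sum `dissipation_le` over the species. With y = ∇(u−ū) and W = ∇(Φ−Φ̄), the drift difference is B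
-- = zW + ay, so −σ∑⟨y, B⟩ contains −σ⟨y, ay⟩ ≤ −σc|y|². This absorbs every other |y|² term; what
-- remains involves |W|², |u−ū|² and the logarithmic relative entropy, all parts of `relDensity`,
-- plus O(ε).
set_option maxHeartbeats 800000 in
theorem exists_dissipation_le (hP : Assumptions P) {M : ℝ} :
    ∃ C ≥ 0, ∀ ε > 0, ∀ (s ub : Fin n → ℝ) (g Ub : Fin n → E d) (V Vb : E d), (∀ i, 0 ≤ ub i) →
      (∀ i, ‖P.drift Ub Vb i‖ ≤ M) →
      (∑ i, ⟪P.σ • ((2 * s i) • g i) + s i ^ 2 • P.drift (fun j => (2 * s j) • g j) V i,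
        P.gradU ε ub Ub Vb i⟫_ℝ)
      + (∑ i, ⟪P.σ • Ub i + ub i • P.drift Ub Vb i,
        P.gradB ε (fun j => s j ^ 2) ub (fun j => (2 * s j) • g j) Ub V Vb i⟫_ℝ)
      - ∑ i, ‖(2 * P.σ) • g i + s i • P.drift (fun j => (2 * s j) • g j) V i‖ ^ 2
      ≤ C * (P.relDensity ε (fun j => s j ^ 2) ub V Vb + ε) := by
  obtain ⟨c, hc0, hc⟩ := exists_bil_coercive hP
  have hσ := hP.σ_pos
  obtain ⟨A2, hA2e⟩ : ∃ A2, A2 = ∑ i, ∑ j, P.a i j ^ 2 := ⟨_, rfl⟩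
  obtain ⟨Z, hZe⟩ : ∃ Z, Z = ∑ i, P.z i ^ 2 := ⟨_, rfl⟩
  have hA2 : 0 ≤ A2 := by
    rw [hA2e]; exact Finset.sum_nonneg fun i _ => Finset.sum_nonneg fun j _ => sq_nonneg _
  have hZ : 0 ≤ Z := by rw [hZe]; exact Finset.sum_nonneg fun i _ => sq_nonneg _
  -- From η‖B‖² comes at most σc/2·|y|², and Young's inequality for ⟨y, zW⟩ takes another σc/4,
  -- still below the available σc.
  obtain ⟨η, hη, hηA⟩ : ∃ η > 0, 2 * η * A2 ≤ P.σ * c / 2 := by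
    refine ⟨P.σ * c / (4 * (A2 + 1)), by positivity, ?_⟩
    have h1 : 2 * (P.σ * c / (4 * (A2 + 1))) * A2 = P.σ * c / 2 * (A2 / (A2 + 1)) := by
      field_simp; ring
    rw [h1]
    exact mul_le_of_le_one_right (by positivity) ((div_le_one (by positivity)).2 (by linarith))
  obtain ⟨K1, hK1e⟩ : ∃ K1, K1 = M ^ 2 / (4 * η) := ⟨_, rfl⟩
  obtain ⟨K2, hK2e⟩ : ∃ K2, K2 = 2 * η * Z + P.σ / c * Z := ⟨_, rfl⟩
  have hK1 : 0 ≤ K1 := by rw [hK1e]; positivity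
  have hK2 : 0 ≤ K2 := by rw [hK2e]; positivity
  -- The first three summands compare the logarithmic, quadratic and electric terms with their
  -- weights σ, c/2, ½ in the lower bound for `relDensity`; the last collects the e²ε of each
  -- species.
  refine ⟨1 / 2 * M ^ 2 / P.σ + 2 * K1 / c + 2 * K2 + 1 / 2 * M ^ 2 * (n * Real.exp 2),
    by positivity, fun ε hε s ub g Ub V Vb hub hM => ?_⟩
  let u : Fin n → ℝ := fun j => s j ^ 2
  let U : Fin n → E d := fun j => (2 * s j) • g j
  let W : E d := V - Vb
  let y : Fin n → E d := fun j => U j - Ub j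
  let B : Fin n → E d := fun i => P.drift U V i - P.drift Ub Vb i
  have hB : ∀ i, B i = P.z i • W + ∑ j, P.a i j • y j := fun i => by
    simp only [B, Data.drift, W, y, smul_sub, Finset.sum_sub_distrib]; abel
  let h : Fin n → ℝ := fun i =>
    u i * Real.log (u i) - u i - u i * Real.log (ub i + ε) + (ub i + ε)
  have hh : ∀ i, 0 ≤ h i := fun i => relEntropy_nonneg (sq_nonneg _) (by linarith [hub i])
  have hi : ∀ i, ⟪P.σ • U i + u i • P.drift U V i, P.gradU ε ub Ub Vb i⟫_ℝ +
      ⟪P.σ • Ub i + ub i • P.drift Ub Vb i, P.gradB ε u ub U Ub V Vb i⟫_ℝ -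
      ‖(2 * P.σ) • g i + s i • P.drift U V i‖ ^ 2 ≤
      1 / 2 * M ^ 2 * (h i + Real.exp 2 * ε) + K1 * (u i - ub i) ^ 2 + η * ‖B i‖ ^ 2
        - P.σ * ⟪y i, B i⟫_ℝ := fun i => by
    have hw0 : 0 < ub i + ε := by linarith [hub i]
    have e1 := dissipation_le (σ := P.σ) (s := s i) (η := η) rfl hw0 hη (g i) (Ub i)
      (P.drift U V i) (P.drift Ub Vb i) (hM i)
    have e2 := sq_mul_le_relEntropy (sq_nonneg (s i)) hε (by linarith [hub i] : ε ≤ ub i + ε)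
    have e3 : P.gradB ε u ub U Ub V Vb i = B i + (P.σ / (ub i + ε)) • U i
        - (P.σ * s i ^ 2 / (ub i + ε) ^ 2) • Ub i := by
      rw [hB]; rfl
    rw [e3]
    refine e1.trans ?_
    have e4 := mul_le_mul_of_nonneg_left e2 (by positivity : 0 ≤ 1 / 2 * M ^ 2)
    rw [hK1e]
    simp only [u, h, y, U, B] at e4 ⊢
    linarith
  have hBsq : ∀ i, ‖B i‖ ^ 2 ≤ 2 * (P.z i ^ 2 * ‖W‖ ^ 2) + 2 * ((∑ j, P.a i j ^ 2) * ∑ j, ‖y j‖ ^ 2) := by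
    intro i
    rw [hB]
    have e1 : ‖∑ j, P.a i j • y j‖ ^ 2 ≤ (∑ j, P.a i j ^ 2) * ∑ j, ‖y j‖ ^ 2 := by
      have e2 : ‖∑ j, P.a i j • y j‖ ≤ ∑ j, |P.a i j| * ‖y j‖ :=
        (norm_sum_le _ _).trans (Finset.sum_le_sum fun j _ => (norm_smul _ _).le)
      have e3 := Finset.sum_mul_sq_le_sq_mul_sq Finset.univ (fun j => |P.a i j|) fun j => ‖y j‖
      simp only [sq_abs] at e3
      exact (pow_le_pow_left₀ (norm_nonneg _) e2 2).trans e3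
    have e4 : ‖P.z i • W‖ ^ 2 = P.z i ^ 2 * ‖W‖ ^ 2 := by
      rw [norm_smul, mul_pow, Real.norm_eq_abs, sq_abs]
    have e5 := norm_add_le (P.z i • W) (∑ j, P.a i j • y j)
    have e6 := pow_le_pow_left₀ (norm_nonneg _) e5 2
    nlinarith [sq_nonneg (‖P.z i • W‖ - ‖∑ j, P.a i j • y j‖)]
  have hyB : ∀ i, -(P.σ * ⟪y i, B i⟫_ℝ) ≤ P.σ * c / 4 * ‖y i‖ ^ 2 + P.σ / c * (P.z i ^ 2 * ‖W‖ ^ 2)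
      - P.σ * ⟪y i, ∑ j, P.a i j • y j⟫_ℝ := by
    intro i
    rw [hB, inner_add_right, real_inner_smul_right]
    have e1 : |P.z i * ⟪y i, W⟫_ℝ| ≤ ‖y i‖ * (|P.z i| * ‖W‖) := by
      rw [abs_mul, mul_left_comm]
      exact mul_le_mul_of_nonneg_left (abs_real_inner_le_norm _ _) (abs_nonneg _)
    have e2 := neg_le_of_abs_le e1
    have e3 : ‖y i‖ * (|P.z i| * ‖W‖) ≤ c / 4 * ‖y i‖ ^ 2 + 1 / c * (P.z i ^ 2 * ‖W‖ ^ 2) := by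
      have e4 : P.z i ^ 2 * ‖W‖ ^ 2 = (|P.z i| * ‖W‖) ^ 2 := by rw [mul_pow, sq_abs]
      rw [e4, div_mul_eq_mul_div 1 c, add_div' _ _ _ hc0.ne', le_div_iff₀ hc0]
      nlinarith [sq_nonneg (c * ‖y i‖ - 2 * (|P.z i| * ‖W‖))]
    have e5 := mul_le_mul_of_nonneg_left (show -(P.z i * ⟪y i, W⟫_ℝ) ≤
      c / 4 * ‖y i‖ ^ 2 + 1 / c * (P.z i ^ 2 * ‖W‖ ^ 2) by linarith) hσ.le
    have e6 : P.σ * (c / 4 * ‖y i‖ ^ 2 + 1 / c * (P.z i ^ 2 * ‖W‖ ^ 2)) =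
      P.σ * c / 4 * ‖y i‖ ^ 2 + P.σ / c * (P.z i ^ 2 * ‖W‖ ^ 2) := by ring
    linarith
  have hco := mul_le_mul_of_nonneg_left (bil_coercive_inner hc y) hσ.le
  have hrel := le_relDensity hc ε u ub V Vb
  have hsum := Finset.sum_le_sum fun i (_ : i ∈ Finset.univ) => hi i
  have hsum2 := Finset.sum_le_sum fun i (_ : i ∈ Finset.univ) =>
    mul_le_mul_of_nonneg_left (hBsq i) hη.le
  have hsum3 := Finset.sum_le_sum fun i (_ : i ∈ Finset.univ) => hyB i
  simp only [Finset.sum_add_distrib, Finset.sum_sub_distrib, ← Finset.mul_sum, ← Finset.sum_mul,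
    Finset.sum_neg_distrib, Finset.sum_const, Finset.card_univ, Fintype.card_fin,
    nsmul_eq_mul, ← hA2e, ← hZe] at hsum hsum2 hsum3
  have hX : 0 ≤ ∑ i, ‖y i‖ ^ 2 := Finset.sum_nonneg fun i _ => sq_nonneg _
  have hY : 0 ≤ ∑ i, (u i - ub i) ^ 2 := Finset.sum_nonneg fun i _ => sq_nonneg _
  have hH : 0 ≤ ∑ i, h i := Finset.sum_nonneg fun i _ => hh i
  have hW := sq_nonneg ‖W‖
  have hXη := mul_le_mul_of_nonneg_right hηA hX
  have hXσ : 0 ≤ P.σ * c / 4 * ∑ i, ‖y i‖ ^ 2 :=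
    mul_nonneg (by positivity) hX
  have hmain : (∑ i, ⟪P.σ • U i + u i • P.drift U V i, P.gradU ε ub Ub Vb i⟫_ℝ) +
      (∑ i, ⟪P.σ • Ub i + ub i • P.drift Ub Vb i, P.gradB ε u ub U Ub V Vb i⟫_ℝ) -
      ∑ i, ‖(2 * P.σ) • g i + s i • P.drift U V i‖ ^ 2 ≤
      1 / 2 * M ^ 2 * (∑ i, h i) + 1 / 2 * M ^ 2 * (n * Real.exp 2) * ε
        + K1 * ∑ i, (u i - ub i) ^ 2 + K2 * ‖W‖ ^ 2 := by
    rw [hK2e]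
    refine hsum.trans ?_
    generalize ∑ i, ‖B i‖ ^ 2 = b1 at *
    generalize ∑ i, ⟪y i, B i⟫_ℝ = b2 at *
    generalize ∑ i, ‖y i‖ ^ 2 = b3 at *
    generalize ∑ i, ⟪y i, ∑ j, P.a i j • y j⟫_ℝ = b4 at *
    generalize ∑ i, h i = b5 at *
    generalize ∑ i, (u i - ub i) ^ 2 = b6 at *
    generalize ‖W‖ ^ 2 = b7 at *
    generalize P.σ / c = b8 at *
    clear_value u U W y B h
    linarith [hsum2, hsum3, hco, hXη, hXσ]
  refine hmain.trans ?_
  have hR0 : 0 ≤ P.σ * ∑ i, h i := mul_nonneg hσ.le hH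
  have hR1 : 0 ≤ c / 2 * ∑ i, (u i - ub i) ^ 2 :=
    mul_nonneg (by positivity) hY
  have hR2 : 0 ≤ 1 / 2 * ‖W‖ ^ 2 := mul_nonneg (by norm_num) hW
  have hrel' : P.σ * (∑ i, h i) + 1 / 2 * ‖W‖ ^ 2 + c / 2 * ∑ i, (u i - ub i) ^ 2 ≤
      P.relDensity ε u ub V Vb := hrel
  change _ ≤ _ * (P.relDensity ε u ub V Vb + ε)
  generalize P.relDensity ε u ub V Vb = R at *
  have f1 : 1 / 2 * M ^ 2 * (∑ i, h i) ≤ 1 / 2 * M ^ 2 / P.σ * R := by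
    have : 1 / 2 * M ^ 2 * (∑ i, h i) = 1 / 2 * M ^ 2 / P.σ * (P.σ * ∑ i, h i) := by
      field_simp
    rw [this]
    exact mul_le_mul_of_nonneg_left (by linarith) (by positivity)
  have f2 : K1 * ∑ i, (u i - ub i) ^ 2 ≤ 2 * K1 / c * R := by
    have : K1 * ∑ i, (u i - ub i) ^ 2 = 2 * K1 / c * (c / 2 * ∑ i, (u i - ub i) ^ 2) := by
      field_simp
    rw [this]
    exact mul_le_mul_of_nonneg_left (by linarith) (by positivity)
  have f3 : K2 * ‖W‖ ^ 2 ≤ 2 * K2 * R := by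
    have : K2 * ‖W‖ ^ 2 = 2 * K2 * (1 / 2 * ‖W‖ ^ 2) := by ring
    rw [this]
    exact mul_le_mul_of_nonneg_left (by linarith) (by positivity)
  have hRpos : 0 ≤ R := by linarith
  have f4 : 0 ≤ 1 / 2 * M ^ 2 * (n * Real.exp 2) * R := by positivity
  have f5 : 0 ≤ (1 / 2 * M ^ 2 / P.σ + 2 * K1 / c + 2 * K2) * ε := by positivity
  have f6 : (1 / 2 * M ^ 2 / P.σ + 2 * K1 / c + 2 * K2 + 1 / 2 * M ^ 2 * (n * Real.exp 2)) * (R + ε)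
      = 1 / 2 * M ^ 2 / P.σ * R + 2 * K1 / c * R + 2 * K2 * R + 1 / 2 * M ^ 2 * (n * Real.exp 2) * R
        + ((1 / 2 * M ^ 2 / P.σ + 2 * K1 / c + 2 * K2) * ε) + 1 / 2 * M ^ 2 * (n * Real.exp 2) * ε := by
    ring
  rw [f6]
  linarith

end StericPNP

namespace StericPNP

/-! ### The entropy inequality and the relative entropy -/

variable {d n : ℕ} {P : Data d n}

theorem integrable_mul_log {α : Type*} [MeasurableSpace α] {μ : Measure α} [IsFiniteMeasure μ]
    {u : α → ℝ} (hu : MemLp u 2 μ) (h0 : ∀ᵐ x ∂μ, 0 ≤ u x) :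
    Integrable (fun x => u x * Real.log (u x)) μ := by
  refine ((integrable_const (1 : ℝ)).add hu.integrable_sq).mono'
    (Real.continuous_mul_log.comp_aestronglyMeasurable hu.1) ?_
  filter_upwards [h0] with x hx
  rw [Real.norm_eq_abs, Pi.add_apply, abs_le]
  rcases hx.eq_or_lt with h | h
  · rw [← h]; norm_num
  · have h1 := mul_le_mul_of_nonneg_left (Real.log_le_sub_one_of_pos h) h.le
    have h2 := mul_le_mul_of_nonneg_left (Real.log_le_sub_one_of_pos (inv_pos.2 h)) h.le
    rw [Real.log_inv, mul_sub, mul_inv_cancel₀ h.ne'] at h2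
    constructor <;> nlinarith

theorem integrable_relDensity {α : Type*} [MeasurableSpace α] {μ : Measure α} [IsFiniteMeasure μ]
    {ε : ℝ} (hε : 0 < ε) {u b : Fin n → α → ℝ} {V Vb : α → E d} (hu : ∀ i, MemLp (u i) 2 μ)
    (hu0 : ∀ i, ∀ᵐ x ∂μ, 0 ≤ u i x) (hb : ∀ i, MemLp (b i) 2 μ)
    (hb0 : ∀ i, ∀ᵐ x ∂μ, 0 ≤ b i x) (hV : MemLp V 2 μ) (hVb : MemLp Vb 2 μ) :
    Integrable (fun x => P.relDensity ε (fun j => u j x) (fun j => b j x) (V x) (Vb x)) μ := by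
  refine ((Integrable.const_mul (integrable_finsetSum _ fun i _ => ?_) _).add
    ((integrable_norm_sq (hV.sub hVb)).const_mul _)).add
    ((integrable_bil (fun i => (hu i).sub (hb i)) (fun i => (hu i).sub (hb i))).const_mul _)
  exact (((integrable_mul_log (hu i) (hu0 i)).sub ((hu i).integrable (by norm_num))).sub
    ((hu i).integrable_mul (memLp_log_add hε (hb i) (hb0 i)))).add
    (((hb i).integrable (by norm_num)).add (integrable_const ε))

/-- After integration of the pointwise identity the product with ∇Φ_D drops out, because Φ̄ − Φ_D
vanishes on Γ_D and Φ_D is harmonic. -/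
theorem entropyBR_add_cross (hP : Assumptions P) {ε : ℝ} (hε : 0 < ε)
    {u ub : Fin n → E d → ℝ} {Φ Φb : H1 P.Ω} (h : IsState P u Φ) (hb : IsState P ub Φb) :
    entropyBR P u Φ + P.cross ε u ub (wgrad Φ) (wgrad Φb)
      + P.σ * ε * n * volume.real P.Ω =
    ∫ x in P.Ω, P.relDensity ε (fun j => u j x) (fun j => ub j x) (wgrad Φ x) (wgrad Φb x) := by
  have := isFiniteMeasure_restrict_of_isBounded hP.isBounded
  have iR : Integrable (fun x => P.relDensity ε (fun j => u j x) (fun j => ub j x) (wgrad Φ x)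
      (wgrad Φb x)) (volume.restrict P.Ω) :=
    integrable_relDensity hε h.memLp h.nonneg hb.memLp hb.nonneg (wgrad_memLp _) (wgrad_memLp _)
  have iC := integrable_crossDensity (P := P) hε h.memLp hb.memLp hb.nonneg (fn_memLp P.ΦD)
    (wgrad_memLp P.ΦD) (wgrad_memLp Φ) (wgrad_memLp Φb)
  have iD : Integrable (fun x => ⟪wgrad P.ΦD x, wgrad Φb x - wgrad P.ΦD x⟫_ℝ)
      (volume.restrict P.Ω) :=
    integrable_inner_of_memLp (wgrad_memLp _) ((wgrad_memLp _).sub (wgrad_memLp _))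
  have p3 : ∫ x in P.Ω, ⟪wgrad P.ΦD x, wgrad Φb x - wgrad P.ΦD x⟫_ℝ = 0 := by
    rw [← hP.ΦD_harmonic _ hb.potential.dirichlet]
    refine integral_congr_ae ?_
    filter_upwards [wgrad_sub Φb P.ΦD] with x hx
    rw [hx, Pi.sub_apply]
  have iRD : Integrable (fun x => P.relDensity ε (fun j => u j x) (fun j => ub j x) (wgrad Φ x)
      (wgrad Φb x) - ⟪wgrad P.ΦD x, wgrad Φb x - wgrad P.ΦD x⟫_ℝ) (volume.restrict P.Ω) :=
    iR.sub iD
  have iRDC : Integrable (fun x => P.relDensity ε (fun j => u j x) (fun j => ub j x) (wgrad Φ x)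
      (wgrad Φb x) - ⟪wgrad P.ΦD x, wgrad Φb x - wgrad P.ΦD x⟫_ℝ
      - P.crossDensity ε (fn P.ΦD x) (wgrad P.ΦD x) (fun j => u j x) (fun j => ub j x)
        (wgrad Φ x) (wgrad Φb x)) (volume.restrict P.Ω) :=
    iRD.sub iC
  have key : entropyBR P u Φ = ∫ x in P.Ω, (P.relDensity ε (fun j => u j x) (fun j => ub j x)
      (wgrad Φ x) (wgrad Φb x) - ⟪wgrad P.ΦD x, wgrad Φb x - wgrad P.ΦD x⟫_ℝ
      - P.crossDensity ε (fn P.ΦD x) (wgrad P.ΦD x) (fun j => u j x) (fun j => ub j x)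
        (wgrad Φ x) (wgrad Φb x) - P.σ * ε * n) := by
    refine integral_congr_ae (.of_forall fun x => ?_)
    have := entropy_add_crossDensity hP ε (fn P.ΦD x) (wgrad P.ΦD x) (wgrad Φ x) (wgrad Φb x)
      (fun j => u j x) (fun j => ub j x)
    simp only
    linarith
  rw [key, integral_sub iRDC (integrable_const _), integral_sub iRD iC, integral_sub iR iD, p3,
    Data.cross, integral_const, smul_eq_mul, measureReal_restrict_apply_univ]
  ring

namespace JointRep

variable {S Sb : WeakSolution P}

/-- The representative of `√uᵢ ∇wᵢ`. -/
noncomputable def entropyGrad (J : JointRep S) (i : Fin n) (q : ℝ × E d) : E d :=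
  (2 * P.σ) • J.g i q + J.s i q • J.drift i q

theorem entropyGrad_meas (J : JointRep S) (i : Fin n) : StronglyMeasurable (J.entropyGrad i) :=
  ((J.g_meas i).fun_const_smul (2 * P.σ)).add ((J.s_meas i).smul (J.drift_meas i))

theorem weightedEntropyGrad_eq (J : JointRep S) (i : Fin n) :
    ∀ᵐ t ∂(volume.restrict (Ioo 0 P.T)),
      weightedEntropyGrad S i t =ᵐ[volume.restrict P.Ω] fun x => J.entropyGrad i (t, x) := by
  filter_upwards [J.V_eq, ae_all_iff.2 J.u_grad_eq, J.sqrt_eq i, J.sqrt_grad_eq i]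
    with t h1 h3 h7 h8
  filter_upwards [h1, ae_all_iff.2 h3, h7, h8] with x h4 h6 h9 h10
  simp only [weightedEntropyGrad, driftGrad, entropyGrad, drift, U, h4, h6, h9, h10]

theorem exists_entropy_le (hP : Assumptions P) (J : JointRep S) (hS : EntropyInequality S) :
    ∃ Φ0 : H1 P.Ω, IsPotential P (charge P P.u0) Φ0 ∧
      (∀ i, MemLp (J.entropyGrad i) 2
        ((volume.restrict (Ioo 0 P.T)).prod (volume.restrict P.Ω))) ∧
      ∀ᵐ t ∂(volume.restrict (Ioo 0 P.T)),
        entropyBR P (fun i => fn (S.u i t)) (S.Φ t)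
          + ∫ q, ∑ i, ‖J.entropyGrad i q‖ ^ 2
              ∂((volume.restrict (Ioo 0 t)).prod (volume.restrict P.Ω))
        ≤ entropyBR P P.u0 Φ0 := by
  have := isFiniteMeasure_restrict_of_isBounded hP.isBounded
  obtain ⟨G, Φ0, hG, hGe, hΦ0, hent⟩ := hS
  have hGJ : ∀ i, ∀ᵐ t ∂(volume.restrict (Ioo 0 P.T)),
      G i t =ᵐ[volume.restrict P.Ω] fun x => J.entropyGrad i (t, x) := fun i => by
    filter_upwards [hGe i, J.weightedEntropyGrad_eq i] with t h1 h2 using h1.trans h2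
  have hmem : ∀ i, MemLp (J.entropyGrad i) 2
      ((volume.restrict (Ioo 0 P.T)).prod (volume.restrict P.Ω)) := fun i =>
    memLp_two_of_joint (hG i) (J.entropyGrad_meas i) (hGJ i)
  refine ⟨Φ0, hΦ0, hmem, ?_⟩
  filter_upwards [hent, ae_restrict_mem measurableSet_Ioo] with t ht htm
  have hle : volume.restrict (Ioo 0 t) ≤ volume.restrict (Ioo 0 P.T) :=
    Measure.restrict_mono (Ioo_subset_Ioo le_rfl htm.2.le) le_rfl
  have hint : ∀ i, Integrable (fun q => ‖J.entropyGrad i q‖ ^ 2)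
      ((volume.restrict (Ioo 0 t)).prod (volume.restrict P.Ω)) := fun i =>
    (integrable_norm_sq (hmem i)).mono_measure (Measure.prod_mono hle le_rfl)
  rw [integral_finsetSum _ fun i _ => hint i]
  refine le_trans (le_of_eq ?_) ht
  congr 1
  refine Finset.sum_congr rfl fun i _ => ?_
  rw [integral_prod _ (hint i)]
  refine integral_congr_ae (ae_mono hle ?_)
  filter_upwards [hGJ i] with s hs
  refine integral_congr_ae ?_
  filter_upwards [hs] with x hx
  rw [hx]

end JointRep

/-- Grönwall's inequality in integral form, for an integrable function. -/
theorem ae_le_exp_of_ae_le_integral {T A C : ℝ} (hA : 0 ≤ A) (hC : 0 ≤ C) {r : ℝ → ℝ}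
    (hr : Integrable r (volume.restrict (Ioo 0 T))) (h0 : ∀ᵐ t ∂(volume.restrict (Ioo 0 T)), 0 ≤ r t)
    (h : ∀ᵐ t ∂(volume.restrict (Ioo 0 T)), r t ≤ A + C * ∫ s in Ioo 0 t, r s) :
    ∀ᵐ t ∂(volume.restrict (Ioo 0 T)), r t ≤ A * Real.exp (C * T) := by
  let r0 : ℝ → ℝ := (Ioo 0 T).indicator fun t => |r t|
  have hr0 : Integrable r0 := (integrable_indicator_iff measurableSet_Ioo).2 hr.abs
  let Z : ℝ → ℝ := fun t => A + C * ∫ s in (0 : ℝ)..t, r0 s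
  have hZc : Continuous Z := continuous_const.add
    (continuous_const.mul (intervalIntegral.continuous_primitive
      (fun _ _ => hr0.intervalIntegrable) 0))
  have hpos : ∀ s, 0 ≤ r0 s := fun s => indicator_nonneg (fun _ _ => abs_nonneg _) s
  have hZ0 : ∀ t, 0 ≤ t → 0 ≤ Z t := fun t ht =>
    add_nonneg hA (mul_nonneg hC (intervalIntegral.integral_nonneg ht fun s _ => hpos s))
  have hrZ : ∀ᵐ t ∂(volume.restrict (Ioo 0 T)), r0 t = r t ∧ r t ≤ Z t := by
    filter_upwards [h, h0, ae_restrict_mem measurableSet_Ioo] with t h1 h2 ht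
    have e : ∫ s in (0 : ℝ)..t, r0 s = ∫ s in Ioo 0 t, r s := by
      rw [intervalIntegral.integral_of_le ht.1.le, integral_Ioc_eq_integral_Ioo]
      refine integral_congr_ae ?_
      filter_upwards [ae_restrict_of_ae_restrict_of_subset
        (Ioo_subset_Ioo le_rfl ht.2.le) h0, ae_restrict_mem measurableSet_Ioo] with s hs hs'
      simp only [r0, indicator_of_mem (Ioo_subset_Ioo le_rfl ht.2.le hs'), abs_of_nonneg hs]
    refine ⟨by simp only [r0, indicator_of_mem ht, abs_of_nonneg h2], ?_⟩
    simp only [Z, e]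
    exact h1
  -- The majorant Z is only continuous, r0 being merely integrable. One more integration gives a
  -- differentiable W ≥ Z with W' = CZ ≤ CW, to which the differential form of Grönwall applies.
  let W : ℝ → ℝ := fun t => A + C * ∫ s in (0 : ℝ)..t, Z s
  have hW' : ∀ t, HasDerivAt W (C * Z t) t := fun t =>
    ((hZc.integral_hasStrictDerivAt 0 t).hasDerivAt.const_mul C).const_add A
  have hZW : ∀ t ∈ Icc 0 T, Z t ≤ W t := fun t ht => by
    refine add_le_add le_rfl (mul_le_mul_of_nonneg_left ?_ hC)
    refine intervalIntegral.integral_mono_ae_restrict ht.1 hr0.intervalIntegrable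
      (hZc.intervalIntegrable _ _) ?_
    rw [Measure.restrict_congr_set Ioo_ae_eq_Icc.symm]
    filter_upwards [ae_restrict_of_ae_restrict_of_subset
      (Ioo_subset_Ioo le_rfl ht.2) hrZ] with s hs
    rw [hs.1]; exact hs.2
  have hWle : ∀ t ∈ Icc 0 T, W t ≤ A * Real.exp (C * t) := fun t ht => by
    have := norm_le_gronwallBound_of_norm_deriv_right_le (f := W) (f' := fun t => C * Z t) (δ := A)
      (K := C) (ε := 0) (a := 0) (b := T) (fun t _ => (hW' t).continuousAt.continuousWithinAt)
      (fun t _ => (hW' t).hasDerivWithinAt) (by simp [W, abs_of_nonneg hA]) (fun s hs => by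
        have hs' : s ∈ Icc 0 T := ⟨hs.1, hs.2.le⟩
        have h1 := hZ0 s hs.1
        rw [add_zero, Real.norm_of_nonneg (mul_nonneg hC h1),
          Real.norm_of_nonneg (h1.trans (hZW s hs'))]
        exact mul_le_mul_of_nonneg_left (hZW s hs') hC) t ht
    rw [gronwallBound_ε0, sub_zero] at this
    exact (le_abs_self _).trans this
  filter_upwards [hrZ, ae_restrict_mem measurableSet_Ioo] with t h1 ht
  have ht' : t ∈ Icc 0 T := ⟨ht.1.le, ht.2.le⟩
  refine (h1.2.trans (hZW t ht')).trans ((hWle t ht').trans ?_)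
  exact mul_le_mul_of_nonneg_left (Real.exp_le_exp.2 (mul_le_mul_of_nonneg_left ht.2.le hC)) hA

end StericPNP

namespace StericPNP

/-! ### Vanishing of the relative entropy -/

variable {d n : ℕ} {P : Data d n}

namespace JointRep

variable {S Sb : WeakSolution P} {J : JointRep S} {Jb : JointRep Sb}

/-- The space-time function `relDensity`. -/
noncomputable def rel (J : JointRep S) (Jb : JointRep Sb) (ε : ℝ) (q : ℝ × E d) : ℝ :=
  P.relDensity ε (fun j => J.u j q) (fun j => Jb.u j q) (J.V q) (Jb.V q)

theorem rel_nonneg (hP : Assumptions P) {ε : ℝ} (hε : 0 < ε) (q : ℝ × E d) :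
    0 ≤ rel J Jb ε q := by
  have h1 : 0 ≤ ∑ i, (J.u i q * Real.log (J.u i q) - J.u i q
      - J.u i q * Real.log (Jb.u i q + ε) + (Jb.u i q + ε)) := Finset.sum_nonneg fun i _ =>
    relEntropy_nonneg (J.u_nonneg i q) (by linarith [Jb.u_nonneg i q])
  obtain ⟨c, hc, hc'⟩ := exists_bil_coercive hP
  have h2 := le_relDensity hc' ε (fun j => J.u j q) (fun j => Jb.u j q) (J.V q) (Jb.V q)
  have h3 := mul_nonneg hP.σ_pos.le h1
  have h4 : 0 ≤ c / 2 * ∑ i, (J.u i q - Jb.u i q) ^ 2 :=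
    mul_nonneg (by positivity) (Finset.sum_nonneg fun i _ => sq_nonneg _)
  refine le_trans ?_ h2
  positivity

theorem integrable_rel (hP : Assumptions P) {ε : ℝ} (hε : 0 < ε) :
    Integrable (rel J Jb ε) ((volume.restrict (Ioo 0 P.T)).prod (volume.restrict P.Ω)) := by
  have := isFiniteMeasure_restrict_of_isBounded hP.isBounded
  rw [← volume_restrict_cyl]
  have : IsFiniteMeasure ((volume : Measure (ℝ × E d)).restrict P.cyl) := by
    rw [volume_restrict_cyl]; infer_instance
  exact integrable_relDensity hε (fun i => (J.memLp_u i).restrict _)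
    (fun i => .of_forall (J.u_nonneg i)) (fun i => (Jb.memLp_u i).restrict _)
    (fun i => .of_forall (Jb.u_nonneg i)) (J.V_memLp.restrict _) (Jb.V_memLp.restrict _)

theorem entropyBR_add_integral_c (hP : Assumptions P) {ε t : ℝ} (hε : 0 < ε) (h : J.Good t)
    (hb : Jb.Good t) :
    entropyBR P (fun i => fn (S.u i t)) (S.Φ t) + (∫ x in P.Ω, c J Jb ε (t, x))
      + P.σ * ε * n * volume.real P.Ω = ∫ x in P.Ω, rel J Jb ε (t, x) := by
  have e1 : entropyBR P (fun i => fn (S.u i t)) (S.Φ t) =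
      entropyBR P (fun i x => J.u i (t, x)) (S.Φ t) := by
    refine integral_congr_ae ?_
    filter_upwards [ae_all_iff.2 h.u_eq] with x hx
    simp only [hx]
  rw [e1, ← cross_eq h hb, entropyBR_add_cross hP hε h.isState hb.isState]
  refine integral_congr_ae ?_
  filter_upwards [h.V_eq, hb.V_eq] with x h1 h2
  simp only [rel, h1, h2]

theorem exists_k_sub_le (hP : Assumptions P) {M : ℝ} (hM : Jb.IsBdd M) :
    ∃ C ≥ 0, ∀ ε > 0, ∀ q, J.k Jb ε q - ∑ i, ‖J.entropyGrad i q‖ ^ 2 ≤ C * (rel J Jb ε q + ε) := by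
  obtain ⟨C, hC, h⟩ := exists_dissipation_le hP
    (M := ∑ i, (|P.z i| * M + ∑ j, |P.a i j| * M))
  refine ⟨C, hC, fun ε hε q => h ε hε (fun j => J.s j q) (fun j => Jb.u j q) (fun j => J.g j q)
    (fun j => Jb.U j q) (J.V q) (Jb.V q) (fun i => Jb.u_nonneg i q) fun i => ?_⟩
  obtain ⟨h0, hV, hU⟩ := hM
  have h1 : ‖P.drift (fun j => Jb.U j q) (Jb.V q) i‖ ≤ |P.z i| * M + ∑ j, |P.a i j| * M := by
    refine (norm_add_le _ _).trans (add_le_add ?_ ((norm_sum_le _ _).trans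
      (Finset.sum_le_sum fun j _ => ?_)))
    · rw [norm_smul]; exact mul_le_mul_of_nonneg_left (hV q) (norm_nonneg _)
    · rw [norm_smul]; exact mul_le_mul_of_nonneg_left (hU j q) (norm_nonneg _)
  exact h1.trans (Finset.single_le_sum (f := fun i => |P.z i| * M + ∑ j, |P.a i j| * M)
    (fun i _ => by positivity) (Finset.mem_univ i))

/-- Adding the entropy inequality to the evolution of `cross` bounds R_ε(t) by its initial value
plus the integral of flux terms minus dissipation, hence by C∫(R_ε + ε). Grönwall applies, with
constants that do not depend on ε. -/
theorem exists_integral_rel_le (hP : Assumptions P) (hS : EntropyInequality S) {M : ℝ}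
    (hM : Jb.IsBdd M) :
    ∃ C, ∀ ε > 0, ∀ᵐ t ∂(volume.restrict (Ioo 0 P.T)), ∫ x in P.Ω, rel J Jb ε (t, x) ≤ C * ε := by
  have := isFiniteMeasure_restrict_of_isBounded hP.isBounded
  obtain ⟨Φ0, hΦ0, hG, hent⟩ := exists_entropy_le hP J hS
  obtain ⟨C, hC, hk⟩ := exists_k_sub_le (J := J) hP hM
  have h0 : IsState P P.u0 Φ0 := ⟨hP.u0_memLp, fun i => (hP.u0_pos i).mono fun x hx => hx.le, hΦ0⟩
  set m := volume.real P.Ω with hm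
  have hm0 : 0 ≤ m := measureReal_nonneg
  have hσ := hP.σ_pos
  have hT := hP.T_pos
  refine ⟨(P.σ * n * m + C * (P.T * m)) * Real.exp (C * P.T), fun ε hε => ?_⟩
  have hR := integrable_rel (J := J) (Jb := Jb) hP hε
  -- The relative entropy of u⁰ with itself is at most σεn|Ω|, precisely the constant in the
  -- decomposition, so the two cancel.
  have hinit : entropyBR P P.u0 Φ0 + P.cross ε P.u0 P.u0 (wgrad Φ0) (wgrad Φ0) ≤ 0 := by
    have e1 := entropyBR_add_cross hP hε h0 h0
    have e2 : ∫ x in P.Ω, P.relDensity ε (fun j => P.u0 j x) (fun j => P.u0 j x) (wgrad Φ0 x)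
        (wgrad Φ0 x) ≤ ∫ _x in P.Ω, P.σ * ε * n := by
      refine integral_mono_ae (integrable_relDensity hε h0.memLp h0.nonneg h0.memLp h0.nonneg
        (wgrad_memLp _) (wgrad_memLp _)) (integrable_const _) ?_
      filter_upwards [ae_all_iff.2 hP.u0_pos] with x hx
      exact relDensity_self_le hP hε hx _
    rw [integral_const, smul_eq_mul, measureReal_restrict_apply_univ] at e2
    linarith
  have key := ae_le_exp_of_ae_le_integral (T := P.T) (A := (P.σ * n * m + C * (P.T * m)) * ε)
    (by positivity) hC hR.integral_prod_left
    (.of_forall fun t => integral_nonneg fun x => rel_nonneg hP hε _) ?_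
  · filter_upwards [key] with t ht
    linarith
  filter_upwards [hent, ae_c_sub_initial_le (J := J) hP hε hM h0, J.ae_good, Jb.ae_good]
    with t h1 h2 hg hgb
  obtain ⟨h3, h4⟩ := h2
  have htm := hg.mem
  have hle : volume.restrict (Ioo 0 t) ≤ volume.restrict (Ioo 0 P.T) :=
    Measure.restrict_mono (Ioo_subset_Ioo le_rfl htm.2.le) le_rfl
  have hle2 : (volume.restrict (Ioo 0 t)).prod (volume.restrict P.Ω) ≤
      (volume.restrict (Ioo 0 P.T)).prod (volume.restrict P.Ω) := Measure.prod_mono hle le_rfl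
  have hGi : Integrable (fun q => ∑ i, ‖J.entropyGrad i q‖ ^ 2)
      ((volume.restrict (Ioo 0 t)).prod (volume.restrict P.Ω)) :=
    integrable_finsetSum _ fun i _ => (integrable_norm_sq (hG i)).mono_measure hle2
  have hRt := hR.mono_measure hle2
  have h5 := integral_mono (h3.sub hGi) ((hRt.add (integrable_const ε)).const_mul C)
    (fun q => hk ε hε q)
  rw [integral_sub' h3 hGi, integral_const_mul] at h5
  have h6 : ∫ q, (rel J Jb ε q + ε)
      ∂((volume.restrict (Ioo 0 t)).prod (volume.restrict P.Ω)) =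
      (∫ s in Ioo 0 t, ∫ x in P.Ω, rel J Jb ε (s, x)) + t * m * ε := by
    rw [integral_add hRt (integrable_const ε), integral_prod _ hRt, integral_const, smul_eq_mul,
      measureReal_def, ← univ_prod_univ, Measure.prod_prod, ENNReal.toReal_mul,
      ← measureReal_def, ← measureReal_def, measureReal_restrict_apply_univ,
      measureReal_restrict_apply_univ, Real.volume_real_Ioo_of_le htm.1.le, sub_zero]
  simp only [Pi.add_apply] at h5
  rw [h6] at h5
  have h7 := entropyBR_add_integral_c hP hε hg hgb
  have h8 : C * (t * m * ε) ≤ C * (P.T * m * ε) := by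
    have := htm.2.le
    gcongr
  rw [← h7]
  rw [← hm]
  linarith

/-- The part c/2·∑(uᵢ−ūᵢ)² of R_ε does not depend on ε and is bounded by Cε, so its integral
vanishes. Taking ε = 1/(k+1) leaves a countable family, so that one null set of times suffices. -/
theorem ae_u_eq (hP : Assumptions P) (hS : EntropyInequality S) {M : ℝ} (hM : Jb.IsBdd M) :
    ∀ᵐ t ∂(volume.restrict (Ioo 0 P.T)), ∀ᵐ x ∂(volume.restrict P.Ω),
      ∀ i, J.u i (t, x) = Jb.u i (t, x) := by
  have := isFiniteMeasure_restrict_of_isBounded hP.isBounded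
  obtain ⟨C, hC⟩ := exists_integral_rel_le (J := J) hP hS hM
  obtain ⟨c, hc, hc'⟩ := exists_bil_coercive hP
  filter_upwards [ae_all_iff.2 fun k : ℕ => hC (1 / (k + 1)) (by positivity), J.ae_good,
    Jb.ae_good] with t ht hg hgb
  have hi : Integrable (fun x => c / 2 * ∑ i, (J.u i (t, x) - Jb.u i (t, x)) ^ 2)
      (volume.restrict P.Ω) :=
    (integrable_finsetSum _ fun i _ =>
      ((hg.isState.memLp i).sub (hgb.isState.memLp i)).integrable_sq).const_mul _
  have hnn : ∀ x, 0 ≤ c / 2 * ∑ i, (J.u i (t, x) - Jb.u i (t, x)) ^ 2 := fun x =>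
    mul_nonneg (by positivity) (Finset.sum_nonneg fun i _ => sq_nonneg _)
  have hle : ∀ k : ℕ, ∫ x in P.Ω, c / 2 * ∑ i, (J.u i (t, x) - Jb.u i (t, x)) ^ 2 ≤
      C * (1 / ((k : ℝ) + 1)) := fun k => by
    have hε : (0 : ℝ) < 1 / ((k : ℝ) + 1) := by positivity
    refine (integral_mono_ae hi ?_ (.of_forall fun x => ?_)).trans (ht k)
    · refine (integrable_relDensity (P := P) hε hg.isState.memLp hg.isState.nonneg hgb.isState.memLp
        hgb.isState.nonneg (wgrad_memLp (S.Φ t)) (wgrad_memLp (Sb.Φ t))).congr ?_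
      filter_upwards [hg.V_eq, hgb.V_eq] with x h1 h2
      simp only [rel, h1, h2]
    · have h1 := le_relDensity hc' (1 / ((k : ℝ) + 1)) (fun j => J.u j (t, x))
        (fun j => Jb.u j (t, x)) (J.V (t, x)) (Jb.V (t, x))
      have h2 : 0 ≤ ∑ i, (J.u i (t, x) * Real.log (J.u i (t, x)) - J.u i (t, x)
          - J.u i (t, x) * Real.log (Jb.u i (t, x) + 1 / ((k : ℝ) + 1))
          + (Jb.u i (t, x) + 1 / ((k : ℝ) + 1))) := Finset.sum_nonneg fun i _ =>
        relEntropy_nonneg (J.u_nonneg i _) (by linarith [Jb.u_nonneg i (t, x)])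
      have h3 := mul_nonneg hP.σ_pos.le h2
      have h4 := sq_nonneg ‖J.V (t, x) - Jb.V (t, x)‖
      simp only [rel]
      linarith
  have hlim : Tendsto (fun k : ℕ => C * (1 / ((k : ℝ) + 1))) atTop (𝓝 0) := by
    simpa using tendsto_one_div_add_atTop_nhds_zero_nat.const_mul C
  have hz := le_antisymm (ge_of_tendsto' hlim hle) (integral_nonneg hnn)
  filter_upwards [(integral_eq_zero_iff_of_nonneg hnn hi).1 hz] with x hx i
  have hs : ∑ i, (J.u i (t, x) - Jb.u i (t, x)) ^ 2 = 0 :=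
    (mul_eq_zero.1 hx).resolve_left (by positivity)
  have := (Finset.sum_eq_zero_iff_of_nonneg fun i _ => sq_nonneg _).1 hs i (Finset.mem_univ i)
  exact sub_eq_zero.1 (pow_eq_zero_iff two_ne_zero |>.1 this)

end JointRep

/-- Continuous functions that agree almost everywhere on `(0, T)` agree on `[0, T]`. -/
theorem eqOn_Icc_of_ae_eq {X : Type*} [TopologicalSpace X] [T2Space X] {T : ℝ} (hT : 0 < T)
    {f g : ℝ → X} (hf : ContinuousOn f (Icc 0 T)) (hg : ContinuousOn g (Icc 0 T))
    (h : ∀ᵐ t ∂(volume.restrict (Ioo 0 T)), f t = g t) : EqOn f g (Icc 0 T) := by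
  have h1 : f =ᵐ[volume.restrict (Icc 0 T)] g := by
    rw [← Measure.restrict_congr_set (Ioo_ae_eq_Icc (a := (0 : ℝ)) (b := T))]; exact h
  exact Measure.eqOn_Icc_of_ae_eq volume hT.ne h1 hf hg

end StericPNP

/-! ### Weak–strong uniqueness -/

theorem theorem2 {d n : ℕ} (P : StericPNP.Data d n) (hP : StericPNP.Assumptions P)
    (S Sbar : StericPNP.WeakSolution P) (hstrong : StericPNP.IsStrong Sbar)
    (hS : StericPNP.EntropyInequality S) (hSbar : StericPNP.EntropyInequality Sbar) :
    (∀ᵐ t ∂(volume.restrict (Ioo 0 P.T)),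
      (∀ i, StericPNP.fn (S.u i t) =ᵐ[volume.restrict P.Ω] StericPNP.fn (Sbar.u i t)) ∧
      StericPNP.fn (S.Φ t) =ᵐ[volume.restrict P.Ω] StericPNP.fn (Sbar.Φ t)) ∧
    (∀ t ∈ Icc 0 P.T, ∀ i, S.rep i t = Sbar.rep i t) := by
  obtain ⟨J⟩ := StericPNP.exists_jointRep hP.isOpen hP.isBounded hP.lipschitz S
  obtain ⟨J₁⟩ := StericPNP.exists_jointRep hP.isOpen hP.isBounded hP.lipschitz Sbar
  obtain ⟨Jb, M, hM⟩ := J₁.exists_bounded hstrong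
  have hu : ∀ᵐ t ∂(volume.restrict (Ioo 0 P.T)), J.Good t ∧ Jb.Good t ∧
      ∀ i, StericPNP.fn (S.u i t) =ᵐ[volume.restrict P.Ω] StericPNP.fn (Sbar.u i t) := by
    filter_upwards [StericPNP.JointRep.ae_u_eq (J := J) hP hS hM, J.ae_good, Jb.ae_good]
      with t h1 h2 h3
    refine ⟨h2, h3, fun i => ?_⟩
    filter_upwards [h1, h2.u_eq i, h3.u_eq i] with x h4 h5 h6
    rw [h5, h6, h4 i]
  refine ⟨?_, fun t ht i => ?_⟩
  · filter_upwards [hu] with t ⟨h1, h2, h3⟩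
    -- Equal densities have equal charge, so both potentials solve the same mixed problem.
    refine ⟨h3, StericPNP.IsPotential.unique hP h1.isState.memLp_charge h1.isState.potential
      (h2.isState.potential.congr ?_)⟩
    filter_upwards [ae_all_iff.2 h3, ae_all_iff.2 h1.u_eq, ae_all_iff.2 h2.u_eq] with x h4 h5 h6
    refine Finset.sum_congr rfl fun i _ => ?_
    simp only [← h5, ← h6, h4]
  · refine StericPNP.eqOn_Icc_of_ae_eq hP.T_pos (S.rep_continuous i) (Sbar.rep_continuous i) ?_ ht
    filter_upwards [hu] with s ⟨h1, h2, h3⟩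
    ext φ
    rw [h1.rep_eq, h2.rep_eq]
    refine integral_congr_ae ?_
    filter_upwards [h3 i] with x hx
    rw [hx]
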